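/- **Setting.** Consider $x_{t+1}=Ax_t+Bu_t+w_t$, $y_t=Cx_t+v_t$ with $x_t,w_t\in\mathbb R^{n_x}$, $u_t\in\mathbb R^{n_u}$, $y_t\in\mathbb R^{n_y}$, cost weights $Q\succeq0$, $R\succ0$, and a penalty parameter $\lambda>0$. The initial state $x_0$ has finite second moments, mean $m_0$ and covariance $M_0$. The noise $v_t\sim N(0,M)$, $M\succ0$, is independent of $x_0$ and of all $w_s,v_s$ with $s<t$. The information vector is $I_t=(y_0,\dots,y_t,u_0,\dots,u_{t-1})$. A control policy $\pi$ gives $u_t=\pi_t(I_t)$, and a distribution policy $\gamma$ gives the distribution $\mathbb P_t=\gamma_t(I_t)$ from which $w_t$ is drawn, given $x_0$, $(w_s)_{s<t}$ and $(v_s)_{s\le t}$; $\pi_t$ and $\gamma_t$ are measurable. The nominal distributions $\mathbb Q_t$ have finite second moments, mean $\hat w$ and covariance $\hat\Sigma$ for all $t$. For distributions $\mathbb P,\mathbb Q$ with means $m,m'$ and covariances $S,S'$ let $$\mathrm G(\mathbb P,\mathbb Q)=\sqrt{\|m-m'\|_2^2+\mathrm{Tr}\big[S+S'-2(S'^{1/2}SS'^{1/2})^{1/2}\big]}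 ,$$ and let $$J_\infty^\lambda(\pi,\gamma)=\limsup_{T\to\infty}\frac1T\,\mathbb E\Big[\sum_{t=0}^{T-1}\big(\mathbb E[x_t^\top Qx_t+u_t^\top Ru_t\mid I_t,u_t]-\lambda\,\mathrm G(\mathbb P_t,\mathbb Q_t)^2\big)\Big].$$ **Steady-state quantities.** Let $\Phi=BR^{-1}B^\top-\frac1\lambda I$. Assume that $\Phi\succeq0$, that $(A,\Phi^{1/2})$ is stabilizable and that $(A,Q^{1/2})$ is observable. Let $P_{ss}\succeq0$ be the symmetric solution of $P_{ss}=Q+A^\top(I+P_{ss}\Phi)^{-1}P_{ss}A$, and assume $\lambda I\succ P_{ss}$. Put $$\begin{aligned} S_{ss}&=Q+A^\top P_{ss}A-P_{ss},\\ r_{ss}&=[I-A^\top(I+P_{ss}\Phi)^{-1}]^{-1}A^\top(I+P_{ss}\Phi)^{-1}P_{ss}\hat w,\\ K_{ss}&=-R^{-1}B^\top(I+P_{ss}\Phi)^{-1}P_{ss}A,\\ L_{ss}&=-R^{-1}B^\top(I+P_{ss}\Phi)^{-1}(P_{ss}\hat w+r_{ss}),\\ H_{ss}&=(\lambda I-P_{ss})^{-1}P_{ss}(A+BK_{ss}),\\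 G_{ss}&=(\lambda I-P_{ss})^{-1}(P_{ss}BL_{ss}+r_{ss}+\lambda\hat w). \end{aligned}$$ Let $(X_{ss},X^-_{ss},\Sigma^*_{ss})$ be an optimal solution of $$\begin{aligned}\max_{X,\,X^-,\,\Sigma\succeq0}\;&\mathrm{Tr}\big[S_{ss}X+(P_{ss}-\lambda I)\Sigma+2\lambda(\hat\Sigma^{1/2}\Sigma\hat\Sigma^{1/2})^{1/2}\big]\\ \text{s.t. }\;&X^-=AXA^\top+\Sigma,\qquad X=X^--X^-C^\top(CX^-C^\top+M)^{-1}CX^-,\end{aligned}$$ and let $z_{ss}$ be its optimal value. Assume that $(A,C)$ is detectable and that $(A,(\Sigma^*_{ss})^{1/2})$ is stabilizable. **Stationary policy pair.** Let $\pi^*_{ss}(I_t)=K_{ss}\bar x_t+L_{ss}$, and let $\gamma^*_{ss}(I_t)$ be a distribution with finite second moments, mean $\bar w_t=H_{ss}\bar x_t+G_{ss}$ and covariance $\Sigma^*_{ss}$. Here $\bar x_t$, a function of $I_t$, is the state estimate, in any one of the following senses: 1. the Kalman filter $\bar x_t=\bar x_t^-+\bar X_tC^\top M^{-1}(y_t-C\bar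 x_t^-)$, $\bar x_0^-=m_0$, $\bar x_{t+1}^-=A\bar x_t+Bu_t+\bar w_t$, where $\bar X_t=\bar X_t^--\bar X_t^-C^\top(C\bar X_t^-C^\top+M)^{-1}C\bar X_t^-$, $\bar X_0^-=M_0$ and $\bar X_{t+1}^-=A\bar X_tA^\top+\Sigma^*_{ss}$; 2. the steady-state Kalman filter, i.e. the same recursion for $\bar x_t$ with $\bar X_t$ replaced by $X_{ss}$ for all $t$; 3. the conditional expectation $\bar x_t=\mathbb E[x_t\mid I_t]$, when $x_0$ and all distributions $\gamma^*_{ss}(I_t)$ are Gaussian. **Claim.** The expectations in $J_\infty^\lambda(\pi^*_{ss},\gamma^*_{ss})$ are finite, in that $x_t^\top Qx_t+u_t^\top Ru_t$ and $\mathrm G(\mathbb P_t,\mathbb Q_t)^2$ are integrable for every $t$, and the average cost $\rho:=J_\infty^\lambda(\pi_{ss}^*,\gamma_{ss}^*)$ is $$\rho=(2\hat w-\Phi r_{ss})^\top(I+P_{ss}\Phi)^{-1}r_{ss}-\lambda\,\mathrm{Tr}[\hat\Sigma]+\hat w^\top(I+P_{ss}\Phi)^{-1}P_{ss}\hat w+z_{ss}.$$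 -/

import Mathlib

open MeasureTheory ProbabilityTheory Matrix Filter

namespace WDRC

/-! ### Linear-systems notions -/

/-- The positive semidefinite square root of a positive semidefinite matrix. -/
noncomputable def msqrt {n : ℕ} (A : Matrix (Fin n) (Fin n) ℝ) : Matrix (Fin n) (Fin n) ℝ :=
  open scoped MatrixOrder in CFC.sqrt A

/-- Discrete-time (Schur) stability: every complex eigenvalue lies in the open unit disc. -/
def IsStable {n : ℕ} (F : Matrix (Fin n) (Fin n) ℝ) : Prop :=
  ∀ z ∈ spectrum ℂ (F.map (algebraMap ℝ ℂ)), ‖z‖ < 1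

def Stabilizable {n m : ℕ} (A : Matrix (Fin n) (Fin n) ℝ) (B : Matrix (Fin n) (Fin m) ℝ) : Prop :=
  ∃ K : Matrix (Fin m) (Fin n) ℝ, IsStable (A + B * K)

def Detectable {n p : ℕ} (A : Matrix (Fin n) (Fin n) ℝ) (C : Matrix (Fin p) (Fin n) ℝ) : Prop :=
  ∃ L : Matrix (Fin n) (Fin p) ℝ, IsStable (A + L * C)

/-- The observability matrix with blocks `C A ^ k`, `k < n`, has trivial kernel. -/
def Observable {n p : ℕ} (A : Matrix (Fin n) (Fin n) ℝ) (C : Matrix (Fin p) (Fin n) ℝ) : Prop :=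
  ∀ x : Fin n → ℝ, (∀ k < n, (C * A ^ k) *ᵥ x = 0) → x = 0

/-! ### First and second moments, Gelbrich distance -/

noncomputable def meanVec {n : ℕ} (P : Measure (Fin n → ℝ)) : Fin n → ℝ :=
  fun i => ∫ w, w i ∂P

noncomputable def covMat {n : ℕ} (P : Measure (Fin n → ℝ)) : Matrix (Fin n) (Fin n) ℝ :=
  Matrix.of fun i j => ∫ w, (w i - meanVec P i) * (w j - meanVec P j) ∂P

/-- `P` is a probability measure with finite second moments, mean `m` and covariance `S`. -/
structure HasMoments {n : ℕ} (P : Measure (Fin n → ℝ)) (m : Fin n → ℝ)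
    (S : Matrix (Fin n) (Fin n) ℝ) : Prop where
  isProb : IsProbabilityMeasure P
  memLp : MemLp id 2 P
  mean_eq : meanVec P = m
  cov_eq : covMat P = S

/-- `B²(Σ, Σ̂) = Tr[Σ + Σ̂ - 2 (Σ̂^{1/2} Σ Σ̂^{1/2})^{1/2}]`. -/
noncomputable def buresSq {n : ℕ} (S S' : Matrix (Fin n) (Fin n) ℝ) : ℝ :=
  (S + S' - (2 : ℝ) • msqrt (msqrt S' * S * msqrt S')).trace

/-- The Gelbrich distance; `v ⬝ᵥ v` is the squared Euclidean norm of `v`. -/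
noncomputable def gelbrich {n : ℕ} (P P' : Measure (Fin n → ℝ)) : ℝ :=
  Real.sqrt ((meanVec P - meanVec P') ⬝ᵥ (meanVec P - meanVec P') + buresSq (covMat P) (covMat P'))

/-! ### Problem data and the steady-state quantities -/

/-- The data of the problem: system matrices `A, B, C`, cost weights `Q, R`, observation noise
covariance `M`, penalty parameter `lam`, nominal disturbance mean `wHat` and covariance `SigHat`,
initial state mean `m0` and covariance `M0`. -/
structure Data (nx nu ny : ℕ) where
  A : Matrix (Fin nx) (Fin nx) ℝ
  B : Matrix (Fin nx) (Fin nu) ℝ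
  C : Matrix (Fin ny) (Fin nx) ℝ
  Q : Matrix (Fin nx) (Fin nx) ℝ
  R : Matrix (Fin nu) (Fin nu) ℝ
  M : Matrix (Fin ny) (Fin ny) ℝ
  lam : ℝ
  wHat : Fin nx → ℝ
  SigHat : Matrix (Fin nx) (Fin nx) ℝ
  m0 : Fin nx → ℝ
  M0 : Matrix (Fin nx) (Fin nx) ℝ

section SteadyState

variable {nx nu ny : ℕ} (D : Data nx nu ny) (P : Matrix (Fin nx) (Fin nx) ℝ)

/-- `Φ = B R⁻¹ Bᵀ - (1/λ) I`. -/
noncomputable def Data.Phi : Matrix (Fin nx) (Fin nx) ℝ :=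
  D.B * D.R⁻¹ * D.Bᵀ - (1 / D.lam) • (1 : Matrix (Fin nx) (Fin nx) ℝ)

/-- `P` is a symmetric positive semidefinite solution of the control algebraic Riccati equation. -/
def Data.SolvesARE : Prop :=
  P.PosSemidef ∧ P = D.Q + D.Aᵀ * (1 + P * D.Phi)⁻¹ * P * D.A

noncomputable def Data.Sss : Matrix (Fin nx) (Fin nx) ℝ :=
  D.Q + D.Aᵀ * P * D.A - P

noncomputable def Data.rss : Fin nx → ℝ :=
  ((1 - D.Aᵀ * (1 + P * D.Phi)⁻¹)⁻¹ * D.Aᵀ * (1 + P * D.Phi)⁻¹ * P) *ᵥ D.wHat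

noncomputable def Data.Kss : Matrix (Fin nu) (Fin nx) ℝ :=
  -(D.R⁻¹ * D.Bᵀ * (1 + P * D.Phi)⁻¹ * P * D.A)

noncomputable def Data.Lss : Fin nu → ℝ :=
  -((D.R⁻¹ * D.Bᵀ * (1 + P * D.Phi)⁻¹) *ᵥ (P *ᵥ D.wHat + D.rss P))

noncomputable def Data.Hss : Matrix (Fin nx) (Fin nx) ℝ :=
  (D.lam • (1 : Matrix (Fin nx) (Fin nx) ℝ) - P)⁻¹ * P * (D.A + D.B * D.Kss P)

noncomputable def Data.Gss : Fin nx → ℝ :=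
  (D.lam • (1 : Matrix (Fin nx) (Fin nx) ℝ) - P)⁻¹ *ᵥ
    ((P * D.B) *ᵥ D.Lss P + D.rss P + D.lam • D.wHat)

/-! ### The stationary covariance maximization problem -/

/-- Measurement update of the Kalman filter covariance. -/
noncomputable def Data.covUpdate (X : Matrix (Fin nx) (Fin nx) ℝ) : Matrix (Fin nx) (Fin nx) ℝ :=
  X - X * D.Cᵀ * (D.C * X * D.Cᵀ + D.M)⁻¹ * D.C * X

/-- Feasible triples `(X, X⁻, Σ)`. -/
def Data.Feasible (X Xm S : Matrix (Fin nx) (Fin nx) ℝ) : Prop :=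
  X.PosSemidef ∧ Xm.PosSemidef ∧ S.PosSemidef ∧
    Xm = D.A * X * D.Aᵀ + S ∧ X = D.covUpdate Xm

/-- `Tr[S_ss X + (P_ss - λ I) Σ + 2 λ (Σ̂^{1/2} Σ Σ̂^{1/2})^{1/2}]`. -/
noncomputable def Data.objective (X S : Matrix (Fin nx) (Fin nx) ℝ) : ℝ :=
  (D.Sss P * X + (P - D.lam • (1 : Matrix (Fin nx) (Fin nx) ℝ)) * S
    + (2 * D.lam) • msqrt (msqrt D.SigHat * S * msqrt D.SigHat)).trace

/-- `(X, X⁻, Σ)` is an optimal solution of the maximization problem. -/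
def Data.IsOptimal (X Xm S : Matrix (Fin nx) (Fin nx) ℝ) : Prop :=
  D.Feasible X Xm S ∧
    ∀ X' Xm' S', D.Feasible X' Xm' S' → D.objective P X' S' ≤ D.objective P X S

/-- `z_ss`, the optimal value of the maximization problem. -/
noncomputable def Data.zss : ℝ :=
  sSup {z | ∃ X Xm S, D.Feasible X Xm S ∧ z = D.objective P X S}

end SteadyState

/-! ### Information vectors, policies and the controlled process -/

/-- The information vector `I_t = (y_0, …, y_t, u_0, …, u_{t-1})`. -/
abbrev Info (ny nu t : ℕ) : Type := (Fin (t + 1) → Fin ny → ℝ) × (Fin t → Fin nu → ℝ)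

/-- `I_t` as part of `I_{t+1}`. -/
def Info.prev {ny nu t : ℕ} (I : Info ny nu (t + 1)) : Info ny nu t :=
  (fun i => I.1 i.castSucc, fun i => I.2 i.castSucc)

section ControlledSystem

variable {nx nu ny : ℕ} {Ω : Type*}

def infoProc (y : ℕ → Ω → Fin ny → ℝ) (u : ℕ → Ω → Fin nu → ℝ) (t : ℕ) (ω : Ω) : Info ny nu t :=
  (fun i => y i ω, fun i => u i ω)

/-- The primitive random vectors realized before `w_t` is drawn: `x_0`, `w_s` for `s < t`, and
`v_s` for `s ≤ t`. -/
def pastW (x w : ℕ → Ω → Fin nx → ℝ) (v : ℕ → Ω → Fin ny → ℝ) (t : ℕ) (ω : Ω) :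
    (Fin nx → ℝ) × (Fin t → Fin nx → ℝ) × (Fin (t + 1) → Fin ny → ℝ) :=
  (x 0 ω, fun i => w i ω, fun i => v i ω)

/-- The primitive random vectors realized before `v_t` is drawn: `x_0`, and `w_s`, `v_s` for
`s < t`. -/
def pastV (x w : ℕ → Ω → Fin nx → ℝ) (v : ℕ → Ω → Fin ny → ℝ) (t : ℕ) (ω : Ω) :
    (Fin nx → ℝ) × (Fin t → Fin nx → ℝ) × (Fin t → Fin ny → ℝ) :=
  (x 0 ω, fun i => w i ω, fun i => v i ω)

variable [MeasurableSpace Ω]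

/-- `(x, y, u, w, v)` on the probability space `(Ω, μ)` is the process generated by the control
policy `pol` and the distribution policy `γ`: the linear dynamics hold, `u_t = π_t(I_t)`, the
initial state has mean `m0` and covariance `M0`, the noise `v_t` is drawn from `N(0, M)`
independently of everything realized before, and, given everything realized before, `w_t` is
drawn from `γ_t(I_t)`. -/
structure IsClosedLoop (D : Data nx nu ny) (μ : Measure Ω)
    (pol : ∀ t, Info ny nu t → Fin nu → ℝ) (γ : ∀ t, Kernel (Info ny nu t) (Fin nx → ℝ))
    (x : ℕ → Ω → Fin nx → ℝ) (y : ℕ → Ω → Fin ny → ℝ) (u : ℕ → Ω → Fin nu → ℝ)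
    (w : ℕ → Ω → Fin nx → ℝ) (v : ℕ → Ω → Fin ny → ℝ) : Prop where
  measurable_pol : ∀ t, Measurable (pol t)
  markov : ∀ t, IsMarkovKernel (γ t)
  measurable_x0 : Measurable (x 0)
  measurable_w : ∀ t, Measurable (w t)
  measurable_v : ∀ t, Measurable (v t)
  state : ∀ t ω, x (t + 1) ω = D.A *ᵥ x t ω + D.B *ᵥ u t ω + w t ω
  output : ∀ t ω, y t ω = D.C *ᵥ x t ω + v t ω
  control : ∀ t ω, u t ω = pol t (infoProc y u t ω)
  initial : HasMoments (μ.map (x 0)) D.m0 D.M0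
  noise_gaussian : ∀ t, IsGaussian (μ.map (v t))
  noise_moments : ∀ t, HasMoments (μ.map (v t)) 0 D.M
  noise_indep : ∀ t, IndepFun (v t) (pastV x w v t) μ
  disturbance : ∀ t, ∀ S : Set (Fin nx → ℝ), MeasurableSet S →
    μ⟦w t ⁻¹' S | MeasurableSpace.comap (pastW x w v t) inferInstance⟧
      =ᵐ[μ] fun ω => (γ t (infoProc y u t ω)).real S

/-- Stage cost `x_tᵀ Q x_t + u_tᵀ R u_t`. -/
def stageCost (D : Data nx nu ny) (x : ℕ → Ω → Fin nx → ℝ) (u : ℕ → Ω → Fin nu → ℝ)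
    (t : ℕ) (ω : Ω) : ℝ :=
  x t ω ⬝ᵥ (D.Q *ᵥ x t ω) + u t ω ⬝ᵥ (D.R *ᵥ u t ω)

/-- Expected penalized cost over the first `T` stages,
`E_y[∑_{t < T} (E[x_tᵀ Q x_t + u_tᵀ R u_t | I_t, u_t] - λ G(P_t, Q_t)²)]` with `P_t = γ_t(I_t)`. -/
noncomputable def horizonCost (D : Data nx nu ny) (Qnom : ℕ → Measure (Fin nx → ℝ))
    (μ : Measure Ω) (γ : ∀ t, Kernel (Info ny nu t) (Fin nx → ℝ))
    (x : ℕ → Ω → Fin nx → ℝ) (y : ℕ → Ω → Fin ny → ℝ) (u : ℕ → Ω → Fin nu → ℝ) (T : ℕ) : ℝ :=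
  ∫ ω, ∑ t ∈ Finset.range T,
    ((μ[stageCost D x u t |
        MeasurableSpace.comap (fun ω' => (infoProc y u t ω', u t ω')) inferInstance]) ω
      - D.lam * gelbrich (γ t (infoProc y u t ω)) (Qnom t) ^ 2) ∂μ

/-- The average cost `limsup_{T → ∞} (1/T) E[…]`, as an extended real number. -/
noncomputable def avgCost (D : Data nx nu ny) (Qnom : ℕ → Measure (Fin nx → ℝ))
    (μ : Measure Ω) (γ : ∀ t, Kernel (Info ny nu t) (Fin nx → ℝ))
    (x : ℕ → Ω → Fin nx → ℝ) (y : ℕ → Ω → Fin ny → ℝ) (u : ℕ → Ω → Fin nu → ℝ) : EReal :=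
  limsup (fun T : ℕ => ((1 / (T : ℝ) * horizonCost D Qnom μ γ x y u T : ℝ) : EReal)) atTop

end ControlledSystem

/-! ### State estimation and the stationary policy pair -/

section Estimation

variable {nx nu ny : ℕ} (D : Data nx nu ny) (P : Matrix (Fin nx) (Fin nx) ℝ)

/-- Kalman filter covariances `X̄_t` for the disturbance covariance `S`. -/
noncomputable def Data.filterCov (S : Matrix (Fin nx) (Fin nx) ℝ) :
    ℕ → Matrix (Fin nx) (Fin nx) ℝ
  | 0 => D.covUpdate D.M0
  | t + 1 => D.covUpdate (D.A * Data.filterCov S t * D.Aᵀ + S)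

/-- The state estimate, as a function of the information vector, produced by the recursion
`x̄_t = x̄_t⁻ + X_t Cᵀ M⁻¹ (y_t - C x̄_t⁻)`, `x̄_0⁻ = m_0`,
`x̄_{t+1}⁻ = A x̄_t + B u_t + (H_ss x̄_t + G_ss)`, for a given sequence `X_t` of covariances. -/
noncomputable def Data.filterEst (X : ℕ → Matrix (Fin nx) (Fin nx) ℝ) :
    ∀ t, Info ny nu t → Fin nx → ℝ
  | 0, I => D.m0 + (X 0 * D.Cᵀ * D.M⁻¹) *ᵥ (I.1 0 - D.C *ᵥ D.m0)
  | t + 1, I =>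
    let e := Data.filterEst X t I.prev
    let em := D.A *ᵥ e + D.B *ᵥ I.2 (Fin.last t) + (D.Hss P *ᵥ e + D.Gss P)
    em + (X (t + 1) * D.Cᵀ * D.M⁻¹) *ᵥ (I.1 (Fin.last (t + 1)) - D.C *ᵥ em)

/-- `(pol, γ)` is the stationary policy pair driven by the estimate `xbar`: `π_t(I_t)` equals
`K_ss x̄_t + L_ss`, and `γ_t(I_t)` has mean `H_ss x̄_t + G_ss` and covariance `S`. -/
structure Data.IsStationaryPair (S : Matrix (Fin nx) (Fin nx) ℝ)
    (xbar : ∀ t, Info ny nu t → Fin nx → ℝ)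
    (pol : ∀ t, Info ny nu t → Fin nu → ℝ) (γ : ∀ t, Kernel (Info ny nu t) (Fin nx → ℝ)) :
    Prop where
  control : ∀ t I, pol t I = D.Kss P *ᵥ xbar t I + D.Lss P
  moments : ∀ t I, HasMoments (γ t I) (D.Hss P *ᵥ xbar t I + D.Gss P) S

/-- `xbar t` is the state estimate at time `t`, in one of the following senses:
* the Kalman filter with its time-varying covariances `X̄_t`;
* the steady-state Kalman filter with the stationary covariance `X`;
* the conditional expectation `E[x_t | I_t]`, for a Gaussian initial state and Gaussian
  disturbance distributions. -/
def Data.IsStateEstimate {Ω : Type*} [MeasurableSpace Ω]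
    (μ : Measure Ω) (γ : ∀ t, Kernel (Info ny nu t) (Fin nx → ℝ))
    (x : ℕ → Ω → Fin nx → ℝ) (y : ℕ → Ω → Fin ny → ℝ) (u : ℕ → Ω → Fin nu → ℝ)
    (X S : Matrix (Fin nx) (Fin nx) ℝ) (xbar : ∀ t, Info ny nu t → Fin nx → ℝ) : Prop :=
  (xbar = D.filterEst P (D.filterCov S)) ∨
  (xbar = D.filterEst P (fun _ => X)) ∨
  (IsGaussian (μ.map (x 0)) ∧ (∀ t I, IsGaussian (γ t I)) ∧
    ∀ t, Measurable (xbar t) ∧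
      (fun ω => xbar t (infoProc y u t ω))
        =ᵐ[μ] μ[x t | MeasurableSpace.comap (infoProc y u t) inferInstance])

end Estimation

end WDRC

open scoped Topology

namespace WDRC

/-! ### Square roots -/

section SquareRoot

variable {n : ℕ}

/-! Put V(x) = xᵀPx + 2rᵀx and let p(x) = (1+PΦ)⁻¹(P(Ax+ŵ)+r) be the costate. The gains of the
stationary pair are the first-order conditions of a saddle point at the estimate x: Ru = -Bᵀp and
λ(w̄-ŵ) = p. The predicted successor is then x⁺ = Ax+ŵ-Φp = Fx+g, with p = Px⁺+r. Together with the
envelope relation Px+r = Qx+Aᵀp this yields a pathwise dynamic programming identity,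
`Data.saddle_identity`: when the true state is x+e, all terms linear in e cancel, and the error
contributes only eᵀS_ss e.

The actual disturbance differs from its conditional mean by a vector d that is uncorrelated with the
past and has covariance Σ*. It adds Tr(PΣ*) to the expected next value, while the covariance part of
the Gelbrich penalty is deterministic. So (`IsClosedLoop.integral_cost_eq`) the expected cost of
stage t is E V(x_t) - E V(x_{t+1}) plus constants plus Tr(S_ss E_t), where E_t is the second moment
of the estimation error. Only second moments enter, so for the two filters neither Gaussian
disturbances nor optimality of the estimate is needed.

Two facts give the limit of the averages. First, E V(x_t) is bounded: F is stable, by a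
Popov-Belevitch-Hautus argument on the Lyapunov form of the Riccati equation
(`Data.SolvesARE.isStable_Fss`), and it is driven by inputs with bounded second moments. Second, E_t
tends to X_ss: the Riccati recursion is squeezed between its iterates from zero and the error
covariance under the frozen stationary gain (`Data.tendsto_filterCov`). The value terms telescope
away, and by `Data.objective_eq` the limiting covariance terms are z_ss - λ Tr Σ̂.

When the estimate is the conditional expectation, induction on time identifies it with the Kalman
filter (`IsClosedLoop.condExp_eq_filterEst`): the updated error is uncorrelated with the innovation,
hence independent of it by joint Gaussianity, hence independent of the whole information vector. -/

open scoped MatrixOrder in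
theorem msqrt_posSemidef (A : Matrix (Fin n) (Fin n) ℝ) : (msqrt A).PosSemidef :=
  Matrix.nonneg_iff_posSemidef.mp (CFC.sqrt_nonneg A)

open scoped MatrixOrder in
theorem msqrt_mul_self {A : Matrix (Fin n) (Fin n) ℝ} (hA : A.PosSemidef) :
    msqrt A * msqrt A = A :=
  CFC.sqrt_mul_sqrt_self A (Matrix.nonneg_iff_posSemidef.mpr hA)

theorem PosSemidef.transpose_eq {A : Matrix (Fin n) (Fin n) ℝ} (hA : A.PosSemidef) : Aᵀ = A := by
  rw [← Matrix.conjTranspose_eq_transpose_of_trivial]; exact hA.isHermitian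

theorem msqrt_transpose (A : Matrix (Fin n) (Fin n) ℝ) : (msqrt A)ᵀ = msqrt A :=
  PosSemidef.transpose_eq (msqrt_posSemidef A)

end SquareRoot

/-! ### Schur stability -/

section Stability

variable {n : ℕ}

-- Gelfand's formula: ‖F^k‖^(1/k) tends to the spectral radius, which is below 1, so the powers are
-- eventually dominated by a geometric sequence.
open scoped Matrix.Norms.Operator in
theorem tendsto_pow_of_spectrum {F : Matrix (Fin n) (Fin n) ℂ}
    (hF : ∀ z ∈ spectrum ℂ F, ‖z‖ < 1) : Tendsto (fun k : ℕ => F ^ k) atTop (𝓝 0) := by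
  -- In size zero the matrix algebra is trivial and the spectrum empty, so this case is treated
  -- apart.
  rcases Nat.eq_zero_or_pos n with rfl | hn
  · have : (fun k : ℕ => F ^ k) = fun _ => 0 := by
      funext k; exact Subsingleton.elim _ _
    rw [this]; exact tendsto_const_nhds
  · have : Nonempty (Fin n) := ⟨⟨0, hn⟩⟩
    have h1 : spectralRadius ℂ F < (1 : NNReal) :=
      spectrum.spectralRadius_lt_of_forall_lt F fun z hz => by
        have := hF z hz
        exact_mod_cast this
    obtain ⟨r, hr1, hr2⟩ := exists_between h1
    lift r to NNReal using (hr2.trans ENNReal.coe_lt_top).ne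
    have h2 := spectrum.pow_nnnorm_pow_one_div_tendsto_nhds_spectralRadius F
    have h3 : ∀ᶠ k : ℕ in atTop, ‖F ^ k‖ ≤ (r : ℝ) ^ k := by
      filter_upwards [h2.eventually_lt_const hr1, eventually_gt_atTop 0] with k hk hk0
      have hk' : (‖F ^ k‖₊ : ENNReal) ≤ (r : ENNReal) ^ (k : ℝ) := by
        have := ENNReal.rpow_le_rpow hk.le (z := (k : ℝ)) (by positivity)
        rwa [← ENNReal.rpow_mul, one_div_mul_cancel (by positivity), ENNReal.rpow_one] at this
      rw [ENNReal.rpow_natCast] at hk'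
      exact_mod_cast hk'
    have hr : (r : ℝ) < 1 := by exact_mod_cast hr2
    exact squeeze_zero_norm' h3 (tendsto_pow_atTop_nhds_zero_of_lt_one r.2 hr)

theorem IsStable.tendsto_pow {F : Matrix (Fin n) (Fin n) ℝ} (hF : IsStable F) :
    Tendsto (fun k : ℕ => F ^ k) atTop (𝓝 0) := by
  have h := tendsto_pow_of_spectrum hF
  have hre : Continuous fun N : Matrix (Fin n) (Fin n) ℂ => N.map Complex.re :=
    Continuous.matrix_map continuous_id Complex.continuous_re
  have h2 := (hre.tendsto 0).comp h
  have h3 : ((fun N : Matrix (Fin n) (Fin n) ℂ => N.map Complex.re) ∘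
      fun k : ℕ => F.map (algebraMap ℝ ℂ) ^ k) = fun k => F ^ k := by
    funext k
    simp only [Function.comp_apply]
    rw [← Matrix.map_pow]
    ext i j
    simp
  rw [h3] at h2
  convert h2
  ext i j; simp

theorem isStable_iff_det {F : Matrix (Fin n) (Fin n) ℝ} :
    IsStable F ↔ ∀ z : ℂ, (z • (1 : Matrix (Fin n) (Fin n) ℂ) - F.map (algebraMap ℝ ℂ)).det = 0 →
      ‖z‖ < 1 := by
  refine forall_congr' fun z => imp_congr_left ?_
  rw [spectrum.mem_iff, Matrix.isUnit_iff_isUnit_det, isUnit_iff_ne_zero, not_not,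
    Algebra.algebraMap_eq_smul_one]

theorem isStable_transpose {F : Matrix (Fin n) (Fin n) ℝ} : IsStable Fᵀ ↔ IsStable F := by
  rw [isStable_iff_det, isStable_iff_det]
  refine forall_congr' fun z => ?_
  rw [← Matrix.det_transpose (z • (1 : Matrix (Fin n) (Fin n) ℂ) - F.map (algebraMap ℝ ℂ))]
  simp [Matrix.transpose_sub, Matrix.transpose_map]

/-- Stability in terms of eigenvectors. -/
theorem isStable_iff_eigenvector {F : Matrix (Fin n) (Fin n) ℝ} :
    IsStable F ↔ ∀ (z : ℂ) (v : Fin n → ℂ), v ≠ 0 → F.map (algebraMap ℝ ℂ) *ᵥ v = z • v →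
      ‖z‖ < 1 := by
  rw [isStable_iff_det]
  refine forall_congr' fun z => ?_
  rw [← Matrix.exists_mulVec_eq_zero_iff]
  simp only [forall_exists_index, and_imp, Matrix.sub_mulVec, Matrix.smul_mulVec,
    Matrix.one_mulVec, sub_eq_zero]
  exact forall_congr' fun v => imp_congr_right fun _ => imp_congr_left eq_comm

/-- The complexification of a real matrix. -/
noncomputable abbrev cplx {m k : ℕ} (A : Matrix (Fin m) (Fin k) ℝ) : Matrix (Fin m) (Fin k) ℂ :=
  A.map (algebraMap ℝ ℂ)

theorem cplx_mul {m k l : ℕ} (A : Matrix (Fin m) (Fin k) ℝ) (B : Matrix (Fin k) (Fin l) ℝ) :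
    cplx (A * B) = cplx A * cplx B := Matrix.map_mul

theorem cplx_add {m k : ℕ} (A B : Matrix (Fin m) (Fin k) ℝ) :
    cplx (A + B) = cplx A + cplx B := by ext; simp [cplx]

theorem cplx_sub {m k : ℕ} (A B : Matrix (Fin m) (Fin k) ℝ) :
    cplx (A - B) = cplx A - cplx B := by ext; simp [cplx]

theorem cplx_one : cplx (1 : Matrix (Fin n) (Fin n) ℝ) = 1 := by
  simp [cplx, Matrix.map_one]

theorem cplx_transpose {m k : ℕ} (A : Matrix (Fin m) (Fin k) ℝ) : cplx Aᵀ = (cplx A)ᴴ := by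
  ext; simp [cplx]

open scoped ComplexOrder in
theorem posSemidef_cplx {A : Matrix (Fin n) (Fin n) ℝ} (hA : A.PosSemidef) :
    (cplx A).PosSemidef := by
  rw [← msqrt_mul_self hA]
  nth_rewrite 1 [← msqrt_transpose A]
  rw [cplx_mul, cplx_transpose]
  exact Matrix.posSemidef_conjTranspose_mul_self _

-- Since A is the Gram matrix of its square root, v*Av is the squared norm of √A v.
open scoped ComplexOrder in
theorem cplx_msqrt_mulVec_eq_zero {A : Matrix (Fin n) (Fin n) ℝ} (hA : A.PosSemidef)
    {v : Fin n → ℂ} (h : cplx A *ᵥ v = 0) : cplx (msqrt A) *ᵥ v = 0 := by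
  rw [← msqrt_mul_self hA] at h
  nth_rewrite 1 [← msqrt_transpose A] at h
  rw [cplx_mul, cplx_transpose, ← Matrix.mulVec_mulVec] at h
  have h2 : star v ⬝ᵥ ((cplx (msqrt A))ᴴ *ᵥ (cplx (msqrt A) *ᵥ v)) = star v ⬝ᵥ 0 := by rw [h]
  rw [dotProduct_zero] at h2
  rw [Matrix.dotProduct_mulVec, ← Matrix.star_mulVec] at h2
  exact dotProduct_star_self_eq_zero.mp h2

open scoped ComplexOrder in
/-- A Lyapunov argument in the manner of Popov, Belevitch and Hautus: along an unstable mode, the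
dissipation terms vanish. -/
theorem dissipation_eq_zero {m₁ m₂ : ℕ} {F P : Matrix (Fin n) (Fin n) ℝ} (hP : P.PosSemidef)
    {N₁ : Matrix (Fin m₁) (Fin m₁) ℝ} {N₂ : Matrix (Fin m₂) (Fin m₂) ℝ}
    (h₁ : N₁.PosSemidef) (h₂ : N₂.PosSemidef)
    {W₁ : Matrix (Fin m₁) (Fin n) ℝ} {W₂ : Matrix (Fin m₂) (Fin n) ℝ}
    (h : P = Fᵀ * P * F + W₁ᵀ * N₁ * W₁ + W₂ᵀ * N₂ * W₂)
    {z : ℂ} {v : Fin n → ℂ} (hv : cplx F *ᵥ v = z • v) (hz : 1 ≤ ‖z‖) :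
    cplx N₁ *ᵥ (cplx W₁ *ᵥ v) = 0 ∧ cplx N₂ *ᵥ (cplx W₂ *ᵥ v) = 0 := by
  have hc : cplx P = (cplx F)ᴴ * cplx P * cplx F + (cplx W₁)ᴴ * cplx N₁ * cplx W₁
      + (cplx W₂)ᴴ * cplx N₂ * cplx W₂ := by
    conv_lhs => rw [h]
    simp only [cplx_add, cplx_mul, cplx_transpose]
  have key : ∀ {m : ℕ} (N : Matrix (Fin m) (Fin m) ℂ) (W : Matrix (Fin m) (Fin n) ℂ),
      star v ⬝ᵥ ((Wᴴ * N * W) *ᵥ v) = star (W *ᵥ v) ⬝ᵥ (N *ᵥ (W *ᵥ v)) := by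
    intro m N W
    rw [← Matrix.mulVec_mulVec, ← Matrix.mulVec_mulVec, Matrix.dotProduct_mulVec,
      Matrix.star_mulVec]
  -- Tested on the eigenvector, the equation reads v*Pv = |z|² v*Pv + (two nonnegative terms); as
  -- |z| ≥ 1 and v*Pv ≥ 0, both terms vanish.
  have e := congrArg (fun N => star v ⬝ᵥ (N *ᵥ v)) hc
  simp only [Matrix.add_mulVec, dotProduct_add, key] at e
  rw [hv] at e
  have p1 := (posSemidef_cplx h₁).dotProduct_mulVec_nonneg (cplx W₁ *ᵥ v)
  have p2 := (posSemidef_cplx h₂).dotProduct_mulVec_nonneg (cplx W₂ *ᵥ v)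
  have p0 := (posSemidef_cplx hP).dotProduct_mulVec_nonneg v
  have e0 : star (z • v) ⬝ᵥ (cplx P *ᵥ (z • v)) = ((‖z‖ ^ 2 : ℝ) : ℂ) * (star v ⬝ᵥ (cplx P *ᵥ v)) := by
    rw [Matrix.mulVec_smul, star_smul, smul_dotProduct, dotProduct_smul, smul_eq_mul, smul_eq_mul,
      ← mul_assoc, Complex.star_def, Complex.conj_mul', Complex.ofReal_pow]
  rw [e0] at e
  rw [Complex.nonneg_iff] at p0 p1 p2
  have er := congrArg Complex.re e
  simp only [Complex.add_re, Complex.re_ofReal_mul] at er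
  have hz2 : 1 ≤ ‖z‖ ^ 2 := one_le_pow₀ hz
  have q := mul_le_mul_of_nonneg_right hz2 p0.1
  constructor
  · refine ((posSemidef_cplx h₁).dotProduct_mulVec_zero_iff _).mp (Complex.ext ?_ p1.2.symm)
    simp only [Complex.zero_re]; linarith [p1.1, p2.1]
  · refine ((posSemidef_cplx h₂).dotProduct_mulVec_zero_iff _).mp (Complex.ext ?_ p2.2.symm)
    simp only [Complex.zero_re]; linarith [p1.1, p2.1]

end Stability

/-! ### The closed loop of the control Riccati equation -/

section Control

theorem posSemidef_iff_real {n : ℕ} {A : Matrix (Fin n) (Fin n) ℝ} :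
    A.PosSemidef ↔ Aᵀ = A ∧ ∀ v : Fin n → ℝ, 0 ≤ v ⬝ᵥ (A *ᵥ v) := by
  rw [Matrix.posSemidef_iff_dotProduct_mulVec]
  simp [Matrix.IsHermitian, Matrix.conjTranspose_eq_transpose_of_trivial]

theorem PosSemidef.dotProduct_nonneg {n : ℕ} {A : Matrix (Fin n) (Fin n) ℝ} (hA : A.PosSemidef)
    (v : Fin n → ℝ) : 0 ≤ v ⬝ᵥ (A *ᵥ v) :=
  (posSemidef_iff_real.mp hA).2 v

theorem dotProduct_mulVec_transpose {m n : ℕ} (A : Matrix (Fin m) (Fin n) ℝ) (v : Fin m → ℝ)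
    (w : Fin n → ℝ) : v ⬝ᵥ (A *ᵥ w) = (Aᵀ *ᵥ v) ⬝ᵥ w := by
  rw [Matrix.dotProduct_mulVec, Matrix.mulVec_transpose]

/-- An unobservable mode cannot exist for an observable pair. -/
theorem Observable.eq_zero_of_eigenvector {n p : ℕ} {A : Matrix (Fin n) (Fin n) ℝ}
    {C : Matrix (Fin p) (Fin n) ℝ} (h : Observable A C) {z : ℂ} {v : Fin n → ℂ}
    (hA : cplx A *ᵥ v = z • v) (hC : cplx C *ᵥ v = 0) : v = 0 := by
  have hk : ∀ k : ℕ, cplx (C * A ^ k) *ᵥ v = 0 := by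
    intro k
    induction k with
    | zero => simpa using hC
    | succ k ih =>
      rw [pow_succ, ← Matrix.mul_assoc, cplx_mul, ← Matrix.mulVec_mulVec, hA, Matrix.mulVec_smul, ih,
        smul_zero]
  -- Observability speaks of real vectors: a real matrix that kills v kills its real and imaginary
  -- parts separately.
  have hre : ∀ (N : Matrix (Fin p) (Fin n) ℝ), cplx N *ᵥ v = 0 →
      N *ᵥ (fun i => (v i).re) = 0 ∧ N *ᵥ (fun i => (v i).im) = 0 := by
    intro N hN
    constructor
    · funext i
      have := congrArg Complex.re (congrFun hN i)
      simpa [Matrix.mulVec, dotProduct] using this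
    · funext i
      have := congrArg Complex.im (congrFun hN i)
      simpa [Matrix.mulVec, dotProduct] using this
  have h1 := h _ fun k _ => (hre _ (hk k)).1
  have h2 := h _ fun k _ => (hre _ (hk k)).2
  funext i
  exact Complex.ext (congrFun h1 i) (congrFun h2 i)

variable {nx nu ny : ℕ} (D : Data nx nu ny) (P : Matrix (Fin nx) (Fin nx) ℝ)

/-- If v + PΦv = 0, pairing with Φv gives vᵀΦv + (Φv)ᵀP(Φv) = 0. Both terms are nonnegative, so Φv =
0 and then v = 0. -/
theorem isUnit_one_add_mul {n : ℕ} {P Φ : Matrix (Fin n) (Fin n) ℝ} (hP : P.PosSemidef)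
    (hΦ : Φ.PosSemidef) : IsUnit (1 + P * Φ).det := by
  rw [isUnit_iff_ne_zero]
  intro h0
  obtain ⟨v, hv0, hv⟩ := Matrix.exists_mulVec_eq_zero_iff.mpr h0
  rw [Matrix.add_mulVec, Matrix.one_mulVec, ← Matrix.mulVec_mulVec] at hv
  have e := congrArg (fun t => (Φ *ᵥ v) ⬝ᵥ t) hv
  simp only [dotProduct_add, dotProduct_zero] at e
  have h1 := PosSemidef.dotProduct_nonneg hΦ v
  have h2 := PosSemidef.dotProduct_nonneg hP (Φ *ᵥ v)
  rw [dotProduct_comm] at e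
  have h3 : v ⬝ᵥ (Φ *ᵥ v) = 0 := by linarith
  have h4 : Φ *ᵥ v = 0 := (hΦ.dotProduct_mulVec_zero_iff v).mp (by simpa using h3)
  rw [h4, Matrix.mulVec_zero, add_zero] at hv
  exact hv0 hv

/-- The closed-loop matrix `A + B K_ss + H_ss`. -/
noncomputable def Data.Fss : Matrix (Fin nx) (Fin nx) ℝ :=
  D.A - D.Phi * (1 + P * D.Phi)⁻¹ * P * D.A

/-- The costate `P x⁺ + r`, where `x⁺` is the predicted successor of the state `x`. -/
noncomputable def Data.costate (x : Fin nx → ℝ) : Fin nx → ℝ :=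
  (1 + P * D.Phi)⁻¹ *ᵥ (P *ᵥ (D.A *ᵥ x + D.wHat) + D.rss P)

/-- The constant part of the closed-loop dynamics. -/
noncomputable def Data.gss : Fin nx → ℝ :=
  D.wHat - D.Phi *ᵥ D.costate P 0

/-- The average cost at perfect state information, without the covariance terms. -/
noncomputable def Data.meanCost : ℝ :=
  D.wHat ⬝ᵥ D.costate P 0 + D.rss P ⬝ᵥ D.gss P

/-! ### Saddle point relations and the dynamic programming identity. -/

variable {D P}

/-- The push-through identity (1+PΦ)P = P(1+ΦP). -/
theorem Data.SolvesARE.inv_mul_symm (hP : D.SolvesARE P) (hΦ : D.Phi.PosSemidef) :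
    ((1 + P * D.Phi)⁻¹ * P)ᵀ = (1 + P * D.Phi)⁻¹ * P := by
  have hu := isUnit_one_add_mul hP.1 hΦ
  have hPt := PosSemidef.transpose_eq hP.1
  have hΦt := PosSemidef.transpose_eq hΦ
  have hu' : IsUnit (1 + D.Phi * P).det := isUnit_one_add_mul hΦ hP.1
  rw [Matrix.transpose_mul, Matrix.transpose_nonsing_inv, hPt]
  simp only [Matrix.transpose_add, Matrix.transpose_one, Matrix.transpose_mul, hPt, hΦt]
  have : (1 + P * D.Phi) * P = P * (1 + D.Phi * P) := by noncomm_ring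
  calc P * (1 + D.Phi * P)⁻¹
      = (1 + P * D.Phi)⁻¹ * ((1 + P * D.Phi) * P) * (1 + D.Phi * P)⁻¹ := by
        rw [Matrix.nonsing_inv_mul_cancel_left _ _ hu]
    _ = (1 + P * D.Phi)⁻¹ * P := by
        rw [this, ← Matrix.mul_assoc, Matrix.mul_nonsing_inv_cancel_right _ _ hu']

/-- Follows from PΦN = 1 - N with N = (1+PΦ)⁻¹. It puts the Riccati equation into the form P = Q +
AᵀPF. -/
theorem Data.SolvesARE.mul_Fss (hP : D.SolvesARE P) (hΦ : D.Phi.PosSemidef) :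
    P * D.Fss P = (1 + P * D.Phi)⁻¹ * P * D.A := by
  have hu := isUnit_one_add_mul hP.1 hΦ
  have h := Matrix.mul_nonsing_inv _ hu
  set N := (1 + P * D.Phi)⁻¹
  have h' : P * D.Phi * N = 1 - N := by rw [← h]; noncomm_ring
  calc P * D.Fss P = P * D.A - (P * D.Phi * N) * P * D.A := by
        rw [Data.Fss]; noncomm_ring
    _ = N * P * D.A := by rw [h']; noncomm_ring

theorem Data.SolvesARE.Fss_transpose (hP : D.SolvesARE P) (hΦ : D.Phi.PosSemidef) :
    (D.Fss P)ᵀ = D.Aᵀ * (1 + P * D.Phi)⁻¹ := by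
  have hu := isUnit_one_add_mul hP.1 hΦ
  have h := Matrix.nonsing_inv_mul _ hu
  have hs := hP.inv_mul_symm hΦ
  rw [Data.Fss]
  set N := (1 + P * D.Phi)⁻¹
  have h' : N * P * D.Phi = 1 - N := by rw [← h]; noncomm_ring
  rw [Matrix.transpose_sub, Matrix.mul_assoc D.Phi, Matrix.transpose_mul, Matrix.transpose_mul, hs,
    PosSemidef.transpose_eq hΦ, h']
  noncomm_ring

/-- Substituting A = F + ΦPF into P = Q + AᵀPF. The factor `1` around `D.Q` only matches the shape
of `dissipation_eq_zero`. -/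
theorem Data.SolvesARE.lyapunov (hP : D.SolvesARE P) (hΦ : D.Phi.PosSemidef) :
    P = (D.Fss P)ᵀ * P * D.Fss P + (1 : Matrix (Fin nx) (Fin nx) ℝ)ᵀ * D.Q * 1
      + (P * D.Fss P)ᵀ * D.Phi * (P * D.Fss P) := by
  have hA : D.A = D.Fss P + D.Phi * (P * D.Fss P) := by
    rw [hP.mul_Fss hΦ, Data.Fss]; noncomm_ring
  have h2 : D.Aᵀ = (D.Fss P)ᵀ + (P * D.Fss P)ᵀ * D.Phi := by
    conv_lhs => rw [hA]
    rw [Matrix.transpose_add, Matrix.transpose_mul D.Phi, PosSemidef.transpose_eq hΦ]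
  conv_lhs => rw [hP.2]
  rw [Matrix.mul_assoc D.Aᵀ, Matrix.mul_assoc D.Aᵀ, ← hP.mul_Fss hΦ, h2]
  simp only [Matrix.transpose_one]
  noncomm_ring

/-- For an eigenvector v of F with |z| ≥ 1 the dissipation vanishes: Qv = 0 and ΦPFv = 0. Then Av =
Fv = zv and √Q v = 0, which makes v an unobservable mode. -/
theorem Data.SolvesARE.isStable_Fss (hP : D.SolvesARE P) (hΦ : D.Phi.PosSemidef)
    (hQ : D.Q.PosSemidef) (hobs : Observable D.A (msqrt D.Q)) : IsStable (D.Fss P) := by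
  rw [isStable_iff_eigenvector]
  intro z v hv0 hv
  by_contra hz
  obtain ⟨h1, h2⟩ := dissipation_eq_zero hP.1 hQ hΦ (hP.lyapunov hΦ) hv (not_lt.mp hz)
  rw [cplx_one, Matrix.one_mulVec] at h1
  have hA : D.A = D.Fss P + D.Phi * (P * D.Fss P) := by
    rw [hP.mul_Fss hΦ, Data.Fss]; noncomm_ring
  refine hv0 (hobs.eq_zero_of_eigenvector (z := z) ?_ ?_)
  · rw [hA, cplx_add, Matrix.add_mulVec, cplx_mul, ← Matrix.mulVec_mulVec, h2, add_zero]
    exact hv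
  · exact cplx_msqrt_mulVec_eq_zero hQ h1

/-- Stability excludes the eigenvalue 1 of Fᵀ, so the inverse in `Data.rss` is a genuine one and the
definition can be read as a fixed point equation. -/
theorem Data.SolvesARE.rss_eq (hP : D.SolvesARE P) (hΦ : D.Phi.PosSemidef)
    (hF : IsStable (D.Fss P)) :
    D.rss P = (D.Fss P)ᵀ *ᵥ (P *ᵥ D.wHat + D.rss P) := by
  have hu : IsUnit (1 - (D.Fss P)ᵀ).det := by
    rw [isUnit_iff_ne_zero]
    intro h0
    have := isStable_iff_det.mp (isStable_transpose.mpr hF) 1 (by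
      have : (1 : ℂ) • (1 : Matrix (Fin nx) (Fin nx) ℂ) - ((D.Fss P)ᵀ).map (algebraMap ℝ ℂ)
          = cplx (1 - (D.Fss P)ᵀ) := by rw [cplx_sub, cplx_one, one_smul]
      rw [this]
      have h3 := (RingHom.map_det (algebraMap ℝ ℂ) (1 - (D.Fss P)ᵀ)).symm
      rw [h0, map_zero] at h3
      exact h3)
    simp at this
  have hr : D.rss P = (1 - (D.Fss P)ᵀ)⁻¹ *ᵥ ((D.Fss P)ᵀ *ᵥ (P *ᵥ D.wHat)) := by
    rw [Data.rss, hP.Fss_transpose hΦ]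
    simp only [Matrix.mulVec_mulVec, Matrix.mul_assoc]
  have h : (1 - (D.Fss P)ᵀ) *ᵥ D.rss P = (D.Fss P)ᵀ *ᵥ (P *ᵥ D.wHat) := by
    rw [hr, Matrix.mulVec_mulVec, Matrix.mul_nonsing_inv _ hu, Matrix.one_mulVec]
  rw [Matrix.sub_mulVec, Matrix.one_mulVec, sub_eq_iff_eq_add] at h
  rw [Matrix.mulVec_add, ← h]

theorem Data.costate_eq_add (hP : D.SolvesARE P) (hΦ : D.Phi.PosSemidef) (x : Fin nx → ℝ) :
    D.costate P x = P *ᵥ (D.Fss P *ᵥ x) + D.costate P 0 := by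
  rw [Matrix.mulVec_mulVec, hP.mul_Fss hΦ, Data.costate, Data.costate]
  simp only [Matrix.mulVec_add, Matrix.mulVec_mulVec, Matrix.mulVec_zero, zero_add, Matrix.mul_assoc]
  abel

theorem Data.next_eq (x : Fin nx → ℝ) :
    D.A *ᵥ x + D.wHat - D.Phi *ᵥ D.costate P x = D.Fss P *ᵥ x + D.gss P := by
  rw [Data.costate, Data.gss, Data.Fss, Data.costate]
  simp only [Matrix.mulVec_add, Matrix.mulVec_mulVec, Matrix.mulVec_zero, zero_add, Matrix.mul_assoc,
    Matrix.sub_mulVec]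
  abel

/-- The defining equation (1+PΦ)p = P(Ax+ŵ)+r rearranges to p = P(Ax+ŵ-Φp)+r, and the bracket is the
successor. -/
theorem Data.costate_eq_next (hP : D.SolvesARE P) (hΦ : D.Phi.PosSemidef) (x : Fin nx → ℝ) :
    D.costate P x = P *ᵥ (D.Fss P *ᵥ x + D.gss P) + D.rss P := by
  have hu := isUnit_one_add_mul hP.1 hΦ
  have h : (1 + P * D.Phi) *ᵥ D.costate P x = P *ᵥ (D.A *ᵥ x + D.wHat) + D.rss P := by
    rw [Data.costate, Matrix.mulVec_mulVec, Matrix.mul_nonsing_inv _ hu, Matrix.one_mulVec]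
  rw [Matrix.add_mulVec, Matrix.one_mulVec, ← Matrix.mulVec_mulVec] at h
  rw [← Data.next_eq, Matrix.mulVec_sub]
  nth_rewrite 1 [eq_sub_of_add_eq h]
  abel

/-- The first-order condition Ru = -Bᵀp of the minimizing player, solved for u. -/
theorem Data.control_eq (x : Fin nx → ℝ) :
    D.Kss P *ᵥ x + D.Lss P = -(D.R⁻¹ *ᵥ (D.Bᵀ *ᵥ D.costate P x)) := by
  rw [Data.Kss, Data.Lss, Data.costate]
  simp only [Matrix.neg_mulVec, Matrix.mulVec_add, Matrix.mulVec_mulVec, Matrix.mul_assoc]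
  abel

theorem Data.B_control_eq (x : Fin nx → ℝ) :
    D.B *ᵥ (D.Kss P *ᵥ x + D.Lss P) =
      -(D.Phi *ᵥ D.costate P x) - (1 / D.lam) • D.costate P x := by
  rw [Data.control_eq, Data.Phi]
  simp only [Matrix.mulVec_neg, Matrix.mulVec_mulVec, Matrix.sub_mulVec, Matrix.smul_mulVec,
    Matrix.one_mulVec, Matrix.mul_assoc]
  abel

/-- The first-order condition λ(w̄-ŵ) = p of the maximizing player. The right-hand side is checked
to solve the linear system with matrix λI - P that defines `Data.Hss` and `Data.Gss`. -/
theorem Data.disturbance_eq (hP : D.SolvesARE P) (hΦ : D.Phi.PosSemidef) (hlam : 0 < D.lam)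
    (hpen : (D.lam • (1 : Matrix (Fin nx) (Fin nx) ℝ) - P).PosDef) (x : Fin nx → ℝ) :
    D.Hss P *ᵥ x + D.Gss P = D.wHat + (1 / D.lam) • D.costate P x := by
  have hu : IsUnit (D.lam • (1 : Matrix (Fin nx) (Fin nx) ℝ) - P).det :=
    (Matrix.isUnit_iff_isUnit_det _).mp hpen.isUnit
  have h1 : D.Hss P *ᵥ x + D.Gss P = (D.lam • (1 : Matrix (Fin nx) (Fin nx) ℝ) - P)⁻¹ *ᵥ
      (P *ᵥ (D.A *ᵥ x + D.B *ᵥ (D.Kss P *ᵥ x + D.Lss P)) + D.rss P + D.lam • D.wHat) := by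
    rw [Data.Hss, Data.Gss]
    simp only [Matrix.mulVec_add, Matrix.mulVec_mulVec, Matrix.mul_assoc, Matrix.mul_add,
      Matrix.add_mulVec]
    abel
  have h2 : (D.lam • (1 : Matrix (Fin nx) (Fin nx) ℝ) - P) *ᵥ
      (D.wHat + (1 / D.lam) • D.costate P x) =
      P *ᵥ (D.A *ᵥ x + D.B *ᵥ (D.Kss P *ᵥ x + D.Lss P)) + D.rss P + D.lam • D.wHat := by
    have h3 := Data.costate_eq_next hP hΦ x
    rw [← Data.next_eq] at h3
    rw [Data.B_control_eq, Matrix.sub_mulVec, Matrix.smul_mulVec, Matrix.one_mulVec, smul_add,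
      smul_smul, mul_one_div_cancel hlam.ne', one_smul]
    simp only [Matrix.mulVec_add, Matrix.mulVec_sub, Matrix.mulVec_neg] at h3 ⊢
    nth_rewrite 1 [h3]
    abel
  rw [h1, ← h2, Matrix.mulVec_mulVec, Matrix.nonsing_inv_mul _ hu, Matrix.one_mulVec]

/-- The term -p/λ in Bu cancels the term p/λ in the disturbance mean, leaving Ax+ŵ-Φp. -/
theorem Data.next_mean_eq (hP : D.SolvesARE P) (hΦ : D.Phi.PosSemidef) (hlam : 0 < D.lam)
    (hpen : (D.lam • (1 : Matrix (Fin nx) (Fin nx) ℝ) - P).PosDef) (x : Fin nx → ℝ) :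
    D.A *ᵥ x + D.B *ᵥ (D.Kss P *ᵥ x + D.Lss P) + (D.Hss P *ᵥ x + D.Gss P)
      = D.Fss P *ᵥ x + D.gss P := by
  rw [Data.B_control_eq, Data.disturbance_eq hP hΦ hlam hpen, ← Data.next_eq]
  abel

/-- The envelope theorem for V: half its gradient is that of the state cost plus the costate pulled
back by Aᵀ. It rests on the Riccati equation for the part in x and on `rss_eq` for the constant
part. -/
theorem Data.envelope_eq (hP : D.SolvesARE P) (hΦ : D.Phi.PosSemidef) (hF : IsStable (D.Fss P))
    (x : Fin nx → ℝ) :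
    P *ᵥ x + D.rss P = D.Q *ᵥ x + D.Aᵀ *ᵥ D.costate P x := by
  have hr : D.rss P = (D.Aᵀ * (1 + P * D.Phi)⁻¹) *ᵥ (P *ᵥ D.wHat + D.rss P) := by
    rw [← hP.Fss_transpose hΦ]; exact hP.rss_eq hΦ hF
  have hx : P *ᵥ x = D.Q *ᵥ x + (D.Aᵀ * (1 + P * D.Phi)⁻¹ * P * D.A) *ᵥ x := by
    rw [← Matrix.add_mulVec, ← hP.2]
  rw [hx, Data.costate]
  nth_rewrite 1 [hr]
  simp only [Matrix.mulVec_add, Matrix.mulVec_mulVec, Matrix.mul_assoc]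
  abel

/-- The coefficient of x on the left is Fᵀ(Pŵ+r) - r, which is zero by `rss_eq`. -/
theorem Data.constant_eq (hP : D.SolvesARE P) (hΦ : D.Phi.PosSemidef) (hF : IsStable (D.Fss P))
    (x : Fin nx → ℝ) :
    D.wHat ⬝ᵥ D.costate P x + D.rss P ⬝ᵥ (D.Fss P *ᵥ x + D.gss P) - D.rss P ⬝ᵥ x
      = D.meanCost P := by
  have h := congrArg (fun t => t ⬝ᵥ x) (hP.rss_eq hΦ hF)
  simp only [← dotProduct_mulVec_transpose] at h
  rw [add_dotProduct] at h
  have h2 : (P *ᵥ D.wHat) ⬝ᵥ (D.Fss P *ᵥ x) = D.wHat ⬝ᵥ (P *ᵥ (D.Fss P *ᵥ x)) := by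
    rw [dotProduct_mulVec_transpose P, PosSemidef.transpose_eq hP.1]
  rw [Data.costate_eq_add hP hΦ, Data.meanCost]
  simp only [dotProduct_add]
  linarith

/-- With N = (1+PΦ)⁻¹, the relation Nr = r - NPΦr and the symmetry of NP and Φ turn r·ŵ - r·ΦNPŵ
into a second copy of ŵ·Nr, whence the factor 2. -/
theorem Data.meanCost_eq (hP : D.SolvesARE P) (hΦ : D.Phi.PosSemidef) :
    D.meanCost P = ((2 : ℝ) • D.wHat - D.Phi *ᵥ D.rss P) ⬝ᵥ ((1 + P * D.Phi)⁻¹ *ᵥ D.rss P)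
        + D.wHat ⬝ᵥ (((1 + P * D.Phi)⁻¹ * P) *ᵥ D.wHat) := by
  have hu := isUnit_one_add_mul hP.1 hΦ
  have hN := Matrix.nonsing_inv_mul _ hu
  have hs := hP.inv_mul_symm hΦ
  rw [Data.meanCost, Data.gss, Data.costate]
  set N := (1 + P * D.Phi)⁻¹
  set r := D.rss P
  have h1 : N *ᵥ r = r - (N * P) *ᵥ (D.Phi *ᵥ r) := by
    rw [Matrix.mulVec_mulVec, eq_sub_iff_add_eq, ← Matrix.add_mulVec]
    have : N + N * P * D.Phi = 1 := by rw [← hN]; noncomm_ring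
    rw [this, Matrix.one_mulVec]
  have h2 : D.wHat ⬝ᵥ ((N * P) *ᵥ (D.Phi *ᵥ r)) = r ⬝ᵥ (D.Phi *ᵥ ((N * P) *ᵥ D.wHat)) := by
    rw [dotProduct_mulVec_transpose, hs, dotProduct_mulVec_transpose, PosSemidef.transpose_eq hΦ,
      dotProduct_comm]
  have h3 : (D.Phi *ᵥ r) ⬝ᵥ (N *ᵥ r) = r ⬝ᵥ (D.Phi *ᵥ (N *ᵥ r)) := by
    rw [dotProduct_mulVec_transpose D.Phi r, PosSemidef.transpose_eq hΦ]
  have h4 := congrArg (fun t => D.wHat ⬝ᵥ t) h1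
  simp only [dotProduct_sub] at h4
  simp only [Matrix.mulVec_zero, zero_add, Matrix.mulVec_add, dotProduct_add, dotProduct_sub,
    sub_dotProduct, smul_dotProduct, smul_eq_mul, Matrix.mulVec_mulVec] at h2 h3 h4 ⊢
  have h5 := dotProduct_comm r D.wHat
  linarith

/-- The value function `xᵀ P x + 2 rᵀ x`. -/
noncomputable def Data.value (D : Data nx nu ny) (P : Matrix (Fin nx) (Fin nx) ℝ)
    (x : Fin nx → ℝ) : ℝ :=
  x ⬝ᵥ (P *ᵥ x) + 2 * (D.rss P ⬝ᵥ x)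

/-- The dynamic programming identity at the saddle point of the estimate `x`, for the true state
`x + e`. -/
theorem Data.saddle_identity (hP : D.SolvesARE P) (hΦ : D.Phi.PosSemidef) (hlam : 0 < D.lam)
    (hpen : (D.lam • (1 : Matrix (Fin nx) (Fin nx) ℝ) - P).PosDef) (hF : IsStable (D.Fss P))
    (hQ : D.Q.PosSemidef) (hR : D.R.PosDef) (x e : Fin nx → ℝ) {u : Fin nu → ℝ} {w : Fin nx → ℝ}
    (hu : u = D.Kss P *ᵥ x + D.Lss P) (hw : w = D.Hss P *ᵥ x + D.Gss P) :
    (x + e) ⬝ᵥ (D.Q *ᵥ (x + e)) + u ⬝ᵥ (D.R *ᵥ u) - D.lam * ((w - D.wHat) ⬝ᵥ (w - D.wHat))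
      + D.value P (D.A *ᵥ (x + e) + D.B *ᵥ u + w)
      = D.value P (x + e) + D.meanCost P + e ⬝ᵥ (D.Sss P *ᵥ e) := by
  have hnext := Data.next_mean_eq hP hΦ hlam hpen x
  rw [← hu, ← hw] at hnext
  have hp := Data.costate_eq_next hP hΦ x
  have hc := Data.constant_eq hP hΦ hF x
  have henv := Data.envelope_eq hP hΦ hF x
  have hRu : IsUnit D.R.det := (Matrix.isUnit_iff_isUnit_det _).mp hR.isUnit
  have hu1 : D.R *ᵥ u = -(D.Bᵀ *ᵥ D.costate P x) := by
    rw [hu, Data.control_eq, Matrix.mulVec_neg, Matrix.mulVec_mulVec, Matrix.mul_nonsing_inv _ hRu,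
      Matrix.one_mulVec]
  have hw1 : D.lam • (w - D.wHat) = D.costate P x := by
    rw [hw, Data.disturbance_eq hP hΦ hlam hpen, add_sub_cancel_left, smul_smul,
      mul_one_div_cancel hlam.ne', one_smul]
  set p := D.costate P x
  set X := D.Fss P *ᵥ x + D.gss P
  set r := D.rss P
  have hPs : ∀ a b : Fin nx → ℝ, a ⬝ᵥ (P *ᵥ b) = b ⬝ᵥ (P *ᵥ a) := fun a b => by
    rw [dotProduct_mulVec_transpose, PosSemidef.transpose_eq hP.1, dotProduct_comm]
  have hQs : ∀ a b : Fin nx → ℝ, a ⬝ᵥ (D.Q *ᵥ b) = b ⬝ᵥ (D.Q *ᵥ a) := fun a b => by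
    rw [dotProduct_mulVec_transpose, PosSemidef.transpose_eq hQ, dotProduct_comm]
  -- The first-order conditions replace both quadratic costs by pairings with the costate p.
  have a1 : u ⬝ᵥ (D.R *ᵥ u) = -((D.B *ᵥ u) ⬝ᵥ p) := by
    rw [hu1, dotProduct_neg, dotProduct_mulVec_transpose, Matrix.transpose_transpose]
  have a2 : D.lam * ((w - D.wHat) ⬝ᵥ (w - D.wHat)) = w ⬝ᵥ p - D.wHat ⬝ᵥ p := by
    rw [← smul_eq_mul, ← dotProduct_smul, hw1, sub_dotProduct]
  have a3 : X ⬝ᵥ p = X ⬝ᵥ (P *ᵥ X) + r ⬝ᵥ X := by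
    rw [hp, dotProduct_add, dotProduct_comm X r]
  have a4 : ∀ a : Fin nx → ℝ, a ⬝ᵥ (P *ᵥ x) + r ⬝ᵥ a = a ⬝ᵥ (D.Q *ᵥ x) + (D.A *ᵥ a) ⬝ᵥ p := by
    intro a
    have := congrArg (fun t => a ⬝ᵥ t) henv
    simp only [dotProduct_add] at this
    rw [dotProduct_mulVec_transpose D.Aᵀ, Matrix.transpose_transpose, dotProduct_comm a r] at this
    exact this
  have a5 : (D.A *ᵥ e) ⬝ᵥ p = X ⬝ᵥ (P *ᵥ (D.A *ᵥ e)) + r ⬝ᵥ (D.A *ᵥ e) := by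
    rw [hp, dotProduct_add, hPs, dotProduct_comm _ r]
  have a6 : X ⬝ᵥ p = (D.A *ᵥ x) ⬝ᵥ p + (D.B *ᵥ u) ⬝ᵥ p + w ⬝ᵥ p := by
    rw [← hnext, add_dotProduct, add_dotProduct]
  have a7 : D.A *ᵥ (x + e) + D.B *ᵥ u + w = X + D.A *ᵥ e := by
    rw [← hnext, Matrix.mulVec_add]; abel
  have a8 : e ⬝ᵥ (D.Sss P *ᵥ e) = e ⬝ᵥ (D.Q *ᵥ e) + (D.A *ᵥ e) ⬝ᵥ (P *ᵥ (D.A *ᵥ e))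
      - e ⬝ᵥ (P *ᵥ e) := by
    rw [Data.Sss, Matrix.sub_mulVec, Matrix.add_mulVec, dotProduct_sub, dotProduct_add,
      ← Matrix.mulVec_mulVec, ← Matrix.mulVec_mulVec, dotProduct_mulVec_transpose D.Aᵀ,
      Matrix.transpose_transpose]
  rw [a7, Data.value, Data.value, a8]
  -- The envelope relation tested at x settles the part without error; tested at e it cancels every
  -- term linear in e.
  have b1 := a4 x
  have b2 := a4 e
  have c1 := hPs (D.A *ᵥ e) X
  have c2 := hPs x e
  have c3 := hQs x e
  have hc' : D.wHat ⬝ᵥ p + r ⬝ᵥ X - r ⬝ᵥ x = D.meanCost P := hc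
  simp only [Matrix.mulVec_add, dotProduct_add, add_dotProduct]
  linarith

end Control

/-! ### Convergence of matrices through quadratic forms -/

section QuadraticForms

variable {n : ℕ}

theorem apply_eq_polarization {X : Matrix (Fin n) (Fin n) ℝ} (hX : Xᵀ = X) (i j : Fin n) :
    X i j = ((Pi.single i 1 + Pi.single j 1) ⬝ᵥ (X *ᵥ (Pi.single i 1 + Pi.single j 1))
      - Pi.single i 1 ⬝ᵥ (X *ᵥ Pi.single i 1) - Pi.single j 1 ⬝ᵥ (X *ᵥ Pi.single j 1)) / 2 := by
  have h : X j i = X i j := congrFun (congrFun hX i) j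
  simp only [Matrix.mulVec_add, dotProduct_add, add_dotProduct, Matrix.mulVec_single_one,
    single_one_dotProduct, Matrix.col_apply]
  rw [h]; ring

/-- Polarization expresses each entry by three values of the quadratic form. This lets squeeze
arguments in the Loewner order be carried out on scalars. -/
theorem tendsto_of_quadratic {X : ℕ → Matrix (Fin n) (Fin n) ℝ} {Y : Matrix (Fin n) (Fin n) ℝ}
    (hX : ∀ t, (X t)ᵀ = X t) (hY : Yᵀ = Y)
    (h : ∀ v : Fin n → ℝ, Tendsto (fun t => v ⬝ᵥ (X t *ᵥ v)) atTop (𝓝 (v ⬝ᵥ (Y *ᵥ v)))) :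
    Tendsto X atTop (𝓝 Y) := by
  refine tendsto_pi_nhds.mpr fun i => tendsto_pi_nhds.mpr fun j => ?_
  rw [apply_eq_polarization hY i j]
  simp_rw [fun t => apply_eq_polarization (hX t) i j]
  exact (((h _).sub (h _)).sub (h _)).div_const 2

theorem tendsto_quadratic {X : ℕ → Matrix (Fin n) (Fin n) ℝ} {Y : Matrix (Fin n) (Fin n) ℝ}
    (h : Tendsto X atTop (𝓝 Y)) (v : Fin n → ℝ) :
    Tendsto (fun t => v ⬝ᵥ (X t *ᵥ v)) atTop (𝓝 (v ⬝ᵥ (Y *ᵥ v))) := by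
  have hc : Continuous fun N : Matrix (Fin n) (Fin n) ℝ => v ⬝ᵥ (N *ᵥ v) :=
    Continuous.dotProduct continuous_const (Continuous.matrix_mulVec continuous_id continuous_const)
  exact (hc.tendsto Y).comp h

open scoped MatrixOrder in
theorem le_iff_quadratic {X Y : Matrix (Fin n) (Fin n) ℝ} (hX : Xᵀ = X) (hY : Yᵀ = Y) :
    X ≤ Y ↔ ∀ v : Fin n → ℝ, v ⬝ᵥ (X *ᵥ v) ≤ v ⬝ᵥ (Y *ᵥ v) := by
  rw [Matrix.le_iff, posSemidef_iff_real]
  simp only [Matrix.transpose_sub, hX, hY, true_and, Matrix.sub_mulVec, dotProduct_sub, sub_nonneg]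

open scoped MatrixOrder in
theorem quadratic_mono {X Y : Matrix (Fin n) (Fin n) ℝ} (h : X ≤ Y) (v : Fin n → ℝ) :
    v ⬝ᵥ (X *ᵥ v) ≤ v ⬝ᵥ (Y *ᵥ v) := by
  have := PosSemidef.dotProduct_nonneg (Matrix.le_iff.mp h) v
  simpa [Matrix.sub_mulVec, dotProduct_sub] using this

theorem posSemidef_of_tendsto {X : ℕ → Matrix (Fin n) (Fin n) ℝ} {Y : Matrix (Fin n) (Fin n) ℝ}
    (hX : ∀ t, (X t).PosSemidef) (h : Tendsto X atTop (𝓝 Y)) : Y.PosSemidef := by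
  rw [posSemidef_iff_real]
  refine ⟨?_, fun v => ge_of_tendsto' (tendsto_quadratic h v) fun t =>
    PosSemidef.dotProduct_nonneg (hX t) v⟩
  have h2 : Tendsto (fun t => (X t)ᵀ) atTop (𝓝 Yᵀ) :=
    ((Continuous.matrix_transpose continuous_id).tendsto Y).comp h
  exact tendsto_nhds_unique (h2.congr fun t => PosSemidef.transpose_eq (hX t)) h

open scoped MatrixOrder in
/-- A bounded monotone sequence of symmetric matrices converges. -/
theorem exists_tendsto_of_monotone {X : ℕ → Matrix (Fin n) (Fin n) ℝ}
    {Y : Matrix (Fin n) (Fin n) ℝ} (hX : ∀ t, (X t)ᵀ = X t) (hm : Monotone X)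
    (hb : ∀ t, X t ≤ Y) : ∃ Z, Tendsto X atTop (𝓝 Z) := by
  have h : ∀ v : Fin n → ℝ, ∃ l, Tendsto (fun t => v ⬝ᵥ (X t *ᵥ v)) atTop (𝓝 l) := fun v =>
    ⟨_, tendsto_atTop_ciSup (fun s t hst => quadratic_mono (hm hst) v)
      ⟨v ⬝ᵥ (Y *ᵥ v), by rintro _ ⟨t, rfl⟩; exact quadratic_mono (hb t) v⟩⟩
  choose l hl using h
  refine ⟨Matrix.of fun i j => (l (Pi.single i 1 + Pi.single j 1) - l (Pi.single i 1)
    - l (Pi.single j 1)) / 2, tendsto_pi_nhds.mpr fun i => tendsto_pi_nhds.mpr fun j => ?_⟩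
  simp_rw [fun t => apply_eq_polarization (hX t) i j]
  exact (((hl _).sub (hl _)).sub (hl _)).div_const 2

theorem PosSemidef.conj {m : ℕ} {X : Matrix (Fin n) (Fin n) ℝ} (h : X.PosSemidef)
    (N : Matrix (Fin m) (Fin n) ℝ) : (N * X * Nᵀ).PosSemidef := by
  rw [← Matrix.conjTranspose_eq_transpose_of_trivial N]
  exact h.mul_mul_conjTranspose_same N

open scoped MatrixOrder in
theorem conj_mono {m : ℕ} {X Y : Matrix (Fin n) (Fin n) ℝ} (h : X ≤ Y)
    (N : Matrix (Fin m) (Fin n) ℝ) : N * X * Nᵀ ≤ N * Y * Nᵀ := by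
  rw [Matrix.le_iff] at h ⊢
  have : N * Y * Nᵀ - N * X * Nᵀ = N * (Y - X) * Nᵀ := by rw [Matrix.mul_sub, Matrix.sub_mul]
  rw [this]
  exact PosSemidef.conj h N

theorem tendsto_conj_pow {F : Matrix (Fin n) (Fin n) ℝ} (hF : IsStable F)
    (X : Matrix (Fin n) (Fin n) ℝ) :
    Tendsto (fun t : ℕ => F ^ t * X * (F ^ t)ᵀ) atTop (𝓝 0) := by
  have hc : Continuous fun N : Matrix (Fin n) (Fin n) ℝ => N * X * Nᵀ := by fun_prop
  have := (hc.tendsto 0).comp hF.tendsto_pow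
  simp only [Matrix.zero_mul] at this
  exact this

open scoped MatrixOrder in
/-- The only solution `X ≥ 0` of `X ≤ F X Fᵀ` with `F` stable is zero. -/
theorem eq_zero_of_le_conj {F X : Matrix (Fin n) (Fin n) ℝ} (hF : IsStable F)
    (hX : X.PosSemidef) (h : X ≤ F * X * Fᵀ) : X = 0 := by
  -- Iterating the inequality bounds X by a sequence that tends to zero.
  have hk : ∀ t : ℕ, X ≤ F ^ t * X * (F ^ t)ᵀ := by
    intro t
    induction t with
    | zero => simp
    | succ t ih =>
      refine h.trans ((conj_mono ih F).trans (le_of_eq ?_))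
      rw [pow_succ', Matrix.transpose_mul]
      noncomm_ring
  refine le_antisymm ?_ (Matrix.nonneg_iff_posSemidef.mpr hX)
  rw [le_iff_quadratic (PosSemidef.transpose_eq hX) Matrix.transpose_zero]
  exact fun v => ge_of_tendsto' (tendsto_quadratic (tendsto_conj_pow hF X) v)
    fun t => quadratic_mono (hk t) v

end QuadraticForms

/-! ### The filter Riccati equation -/

section FilterRiccati

variable {nx nu ny : ℕ} (D : Data nx nu ny)

/-- Covariance of the estimation error after a measurement update with gain `K`. -/
def Data.joseph (K : Matrix (Fin nx) (Fin ny) ℝ) (X : Matrix (Fin nx) (Fin nx) ℝ) :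
    Matrix (Fin nx) (Fin nx) ℝ :=
  (1 - K * D.C) * X * (1 - K * D.C)ᵀ + K * D.M * Kᵀ

/-- The Kalman gain. -/
noncomputable def Data.gain (X : Matrix (Fin nx) (Fin nx) ℝ) : Matrix (Fin nx) (Fin ny) ℝ :=
  X * D.Cᵀ * (D.C * X * D.Cᵀ + D.M)⁻¹

/-- One step of the filter Riccati recursion. -/
noncomputable def Data.riccati (S X : Matrix (Fin nx) (Fin nx) ℝ) : Matrix (Fin nx) (Fin nx) ℝ :=
  D.covUpdate (D.A * X * D.Aᵀ + S)

variable {D}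

theorem Data.innovation_posDef (hM : D.M.PosDef) {X : Matrix (Fin nx) (Fin nx) ℝ}
    (hX : X.PosSemidef) : (D.C * X * D.Cᵀ + D.M).PosDef :=
  Matrix.PosDef.posSemidef_add (PosSemidef.conj hX D.C) hM

theorem Data.innovation_isUnit (hM : D.M.PosDef) {X : Matrix (Fin nx) (Fin nx) ℝ}
    (hX : X.PosSemidef) : IsUnit (D.C * X * D.Cᵀ + D.M).det :=
  (Matrix.isUnit_iff_isUnit_det _).mp (Data.innovation_posDef hM hX).isUnit

/-- Completing the square in K. It follows that the Kalman gain minimizes the error covariance in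
the Loewner order, with minimum `D.covUpdate X`. -/
theorem Data.joseph_eq (hM : D.M.PosDef) {X : Matrix (Fin nx) (Fin nx) ℝ} (hX : X.PosSemidef)
    (K : Matrix (Fin nx) (Fin ny) ℝ) :
    D.joseph K X = D.covUpdate X
      + (K - D.gain X) * (D.C * X * D.Cᵀ + D.M) * (K - D.gain X)ᵀ := by
  have hu := Data.innovation_isUnit hM hX
  have hst := PosSemidef.transpose_eq (Data.innovation_posDef hM hX).posSemidef
  have hG : D.gain X * (D.C * X * D.Cᵀ + D.M) = X * D.Cᵀ :=
    Matrix.nonsing_inv_mul_cancel_right _ _ hu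
  have hGt : (D.gain X)ᵀ = (D.C * X * D.Cᵀ + D.M)⁻¹ * (D.C * X) := by
    rw [Data.gain, Matrix.transpose_mul, Matrix.transpose_nonsing_inv, hst, Matrix.transpose_mul,
      Matrix.transpose_transpose, PosSemidef.transpose_eq hX]
  have hG2 : (D.C * X * D.Cᵀ + D.M) * (D.gain X)ᵀ = D.C * X := by
    rw [hGt, Matrix.mul_nonsing_inv_cancel_left _ _ hu]
  have hG3 : D.covUpdate X = X - X * D.Cᵀ * (D.gain X)ᵀ := by
    rw [hGt, Data.covUpdate]; simp only [Matrix.mul_assoc]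
  have e1 : (K - D.gain X) * (D.C * X * D.Cᵀ + D.M) * (K - D.gain X)ᵀ =
      K * (D.C * X * D.Cᵀ + D.M) * Kᵀ - K * ((D.C * X * D.Cᵀ + D.M) * (D.gain X)ᵀ)
      - D.gain X * (D.C * X * D.Cᵀ + D.M) * Kᵀ
      + D.gain X * (D.C * X * D.Cᵀ + D.M) * (D.gain X)ᵀ := by
    rw [Matrix.transpose_sub]
    simp only [Matrix.sub_mul, Matrix.mul_sub, Matrix.mul_assoc]
    abel
  rw [e1, hG, hG2, hG3, Data.joseph, Matrix.transpose_sub, Matrix.transpose_mul,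
    Matrix.transpose_one]
  simp only [Matrix.sub_mul, Matrix.mul_sub, Matrix.mul_assoc, Matrix.add_mul, Matrix.mul_add,
    Matrix.one_mul, Matrix.mul_one]
  abel

theorem Data.joseph_gain (hM : D.M.PosDef) {X : Matrix (Fin nx) (Fin nx) ℝ} (hX : X.PosSemidef) :
    D.joseph (D.gain X) X = D.covUpdate X := by
  rw [Data.joseph_eq hM hX, sub_self, Matrix.zero_mul, Matrix.zero_mul, add_zero]

/-- Identifies the gain X_t Cᵀ M⁻¹ of the filter recursion, written with the updated covariance,
with the usual Kalman gain at the predicted covariance. -/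
theorem Data.covUpdate_gain (hM : D.M.PosDef) {X : Matrix (Fin nx) (Fin nx) ℝ}
    (hX : X.PosSemidef) : D.covUpdate X * D.Cᵀ * D.M⁻¹ = D.gain X := by
  have hu := Data.innovation_isUnit hM hX
  have hMu : IsUnit D.M.det := (Matrix.isUnit_iff_isUnit_det _).mp hM.isUnit
  have hG : D.gain X * (D.C * X * D.Cᵀ + D.M) = X * D.Cᵀ :=
    Matrix.nonsing_inv_mul_cancel_right _ _ hu
  have h2 : D.covUpdate X * D.Cᵀ = D.gain X * D.M := by
    have : D.covUpdate X * D.Cᵀ = X * D.Cᵀ - D.gain X * (D.C * X * D.Cᵀ) := by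
      rw [Data.covUpdate, Data.gain]; simp only [Matrix.sub_mul, Matrix.mul_assoc]
    rw [this, ← hG, Matrix.mul_add]; abel
  rw [h2, Matrix.mul_nonsing_inv_cancel_right _ _ hMu]

theorem Data.joseph_posSemidef (hM : D.M.PosDef) {X : Matrix (Fin nx) (Fin nx) ℝ}
    (hX : X.PosSemidef) (K : Matrix (Fin nx) (Fin ny) ℝ) : (D.joseph K X).PosSemidef :=
  (PosSemidef.conj hX _).add (PosSemidef.conj hM.posSemidef _)

theorem Data.covUpdate_posSemidef (hM : D.M.PosDef) {X : Matrix (Fin nx) (Fin nx) ℝ}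
    (hX : X.PosSemidef) : (D.covUpdate X).PosSemidef := by
  rw [← Data.joseph_gain hM hX]; exact Data.joseph_posSemidef hM hX _

open scoped MatrixOrder in
theorem Data.covUpdate_le_joseph (hM : D.M.PosDef) {X : Matrix (Fin nx) (Fin nx) ℝ}
    (hX : X.PosSemidef) (K : Matrix (Fin nx) (Fin ny) ℝ) : D.covUpdate X ≤ D.joseph K X := by
  rw [Matrix.le_iff, Data.joseph_eq hM hX, add_sub_cancel_left]
  exact PosSemidef.conj (Data.innovation_posDef hM hX).posSemidef _

open scoped MatrixOrder in
theorem Data.joseph_mono {X Y : Matrix (Fin nx) (Fin nx) ℝ} (h : X ≤ Y)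
    (K : Matrix (Fin nx) (Fin ny) ℝ) : D.joseph K X ≤ D.joseph K Y :=
  add_le_add_left (conj_mono h _) _

-- The update is a minimum over K of maps each monotone in the covariance: apply the gain that is
-- optimal for Y to both arguments.
open scoped MatrixOrder in
theorem Data.covUpdate_mono (hM : D.M.PosDef) {X Y : Matrix (Fin nx) (Fin nx) ℝ}
    (hX : X.PosSemidef) (hY : Y.PosSemidef) (h : X ≤ Y) : D.covUpdate X ≤ D.covUpdate Y := by
  rw [← Data.joseph_gain hM hY]
  exact (Data.covUpdate_le_joseph hM hX _).trans (Data.joseph_mono h _)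

/-! ### The Riccati recursion and the convergence to its fixed point. -/

variable {S : Matrix (Fin nx) (Fin nx) ℝ}

theorem Data.predict_posSemidef (hS : S.PosSemidef) {X : Matrix (Fin nx) (Fin nx) ℝ}
    (hX : X.PosSemidef) : (D.A * X * D.Aᵀ + S).PosSemidef :=
  (PosSemidef.conj hX _).add hS

open scoped MatrixOrder in
theorem Data.predict_mono {X Y : Matrix (Fin nx) (Fin nx) ℝ} (h : X ≤ Y) :
    D.A * X * D.Aᵀ + S ≤ D.A * Y * D.Aᵀ + S :=
  add_le_add_left (conj_mono h _) _

theorem Data.riccati_posSemidef (hM : D.M.PosDef) (hS : S.PosSemidef)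
    {X : Matrix (Fin nx) (Fin nx) ℝ} (hX : X.PosSemidef) : (D.riccati S X).PosSemidef :=
  Data.covUpdate_posSemidef hM (Data.predict_posSemidef hS hX)

open scoped MatrixOrder in
theorem Data.riccati_mono (hM : D.M.PosDef) (hS : S.PosSemidef)
    {X Y : Matrix (Fin nx) (Fin nx) ℝ} (hX : X.PosSemidef) (hY : Y.PosSemidef) (h : X ≤ Y) :
    D.riccati S X ≤ D.riccati S Y :=
  Data.covUpdate_mono hM (Data.predict_posSemidef hS hX) (Data.predict_posSemidef hS hY)
    (Data.predict_mono h)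

theorem Data.joseph_predict_sub (K : Matrix (Fin nx) (Fin ny) ℝ)
    (X Y : Matrix (Fin nx) (Fin nx) ℝ) :
    D.joseph K (D.A * X * D.Aᵀ + S) - D.joseph K (D.A * Y * D.Aᵀ + S) =
      ((1 - K * D.C) * D.A) * (X - Y) * ((1 - K * D.C) * D.A)ᵀ := by
  rw [Data.joseph, Data.joseph, Matrix.transpose_mul]
  simp only [Matrix.sub_mul, Matrix.mul_sub, Matrix.add_mul, Matrix.mul_add, Matrix.mul_assoc]
  abel

/-- The error dynamics of a filter whose error covariance is stationary are stable. -/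
theorem Data.isStable_filter (hM : D.M.PosDef) (hS : S.PosSemidef)
    (hstab : Stabilizable D.A (msqrt S)) {X : Matrix (Fin nx) (Fin nx) ℝ} (hX : X.PosSemidef)
    {K : Matrix (Fin nx) (Fin ny) ℝ} (h : X = D.joseph K (D.A * X * D.Aᵀ + S)) :
    IsStable ((1 - K * D.C) * D.A) := by
  rw [← isStable_transpose, isStable_iff_eigenvector]
  intro z v hv0 hv
  by_contra hz
  have hlyap : X = (((1 - K * D.C) * D.A)ᵀ)ᵀ * X * ((1 - K * D.C) * D.A)ᵀ
      + ((1 - K * D.C)ᵀ)ᵀ * S * (1 - K * D.C)ᵀ + (Kᵀ)ᵀ * D.M * Kᵀ := by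
    conv_lhs => rw [h, Data.joseph]
    simp only [Matrix.transpose_transpose, Matrix.transpose_mul, Matrix.mul_add, Matrix.add_mul,
      Matrix.mul_assoc]
  obtain ⟨h1, h2⟩ := dissipation_eq_zero hX hS hM.posSemidef hlyap hv (not_lt.mp hz)
  have hMu : IsUnit D.M.det := (Matrix.isUnit_iff_isUnit_det _).mp hM.isUnit
  -- M is invertible, so vanishing of the noise term forces Kᵀv = 0 and (1-KC)ᵀ acts on v as the
  -- identity. Hence Aᵀv = zv and √S v = 0.
  have hK : cplx Kᵀ *ᵥ v = 0 := by
    have := congrArg (fun t => cplx D.M⁻¹ *ᵥ t) h2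
    simp only [Matrix.mulVec_zero] at this
    rwa [Matrix.mulVec_mulVec, ← cplx_mul, Matrix.nonsing_inv_mul _ hMu, cplx_one,
      Matrix.one_mulVec] at this
  have hKC : cplx (1 - K * D.C)ᵀ *ᵥ v = v := by
    rw [Matrix.transpose_sub, Matrix.transpose_one, Matrix.transpose_mul, cplx_sub, cplx_one,
      cplx_mul, Matrix.sub_mulVec, Matrix.one_mulVec, ← Matrix.mulVec_mulVec, hK,
      Matrix.mulVec_zero, sub_zero]
  rw [hKC] at h1
  have h3 := cplx_msqrt_mulVec_eq_zero hS h1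
  obtain ⟨L, hL⟩ := hstab
  -- No feedback through √S moves the mode v, against stabilizability.
  refine hz (isStable_iff_eigenvector.mp (isStable_transpose.mpr hL) z v hv0 ?_)
  change cplx ((1 - K * D.C) * D.A)ᵀ *ᵥ v = z • v at hv
  rw [Matrix.transpose_mul, cplx_mul, ← Matrix.mulVec_mulVec, hKC] at hv
  change cplx (D.A + msqrt S * L)ᵀ *ᵥ v = z • v
  rw [Matrix.transpose_add, Matrix.transpose_mul, msqrt_transpose, cplx_add, cplx_mul,
    Matrix.add_mulVec, ← Matrix.mulVec_mulVec, h3, Matrix.mulVec_zero, add_zero, hv]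

/-- Convergence of the error covariance of a filter with constant gain. -/
theorem Data.tendsto_of_constant_gain {K : Matrix (Fin nx) (Fin ny) ℝ}
    (hK : IsStable ((1 - K * D.C) * D.A)) {X : Matrix (Fin nx) (Fin nx) ℝ}
    (hX : X = D.joseph K (D.A * X * D.Aᵀ + S)) {U : ℕ → Matrix (Fin nx) (Fin nx) ℝ}
    (hU : ∀ t, U (t + 1) = D.joseph K (D.A * U t * D.Aᵀ + S)) : Tendsto U atTop (𝓝 X) := by
  set F := (1 - K * D.C) * D.A
  -- For a fixed gain the recursion is affine in the covariance; the noise terms cancel in the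
  -- difference from the fixed point.
  have h : ∀ t, U t = F ^ t * (U 0 - X) * (F ^ t)ᵀ + X := by
    intro t
    induction t with
    | zero => simp
    | succ t ih =>
      rw [← sub_eq_iff_eq_add]
      conv_lhs => rw [hU, hX, Data.joseph_predict_sub]
      change F * (U t - X) * Fᵀ = _
      rw [sub_eq_of_eq_add ih, pow_succ', Matrix.transpose_mul F]
      simp only [Matrix.mul_assoc]
  have h2 := (tendsto_conj_pow hK (U 0 - X)).add_const X
  rw [zero_add] at h2
  exact h2.congr fun t => (h t).symm

theorem Data.tendsto_covUpdate (hM : D.M.PosDef) {X : ℕ → Matrix (Fin nx) (Fin nx) ℝ}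
    {Y : Matrix (Fin nx) (Fin nx) ℝ} (hY : Y.PosSemidef) (h : Tendsto X atTop (𝓝 Y)) :
    Tendsto (fun t => D.covUpdate (X t)) atTop (𝓝 (D.covUpdate Y)) := by
  have hs : Tendsto (fun t => D.C * X t * D.Cᵀ + D.M) atTop (𝓝 (D.C * Y * D.Cᵀ + D.M)) := by
    have hc : Continuous fun N : Matrix (Fin nx) (Fin nx) ℝ => D.C * N * D.Cᵀ + D.M := by fun_prop
    exact (hc.tendsto Y).comp h
  have hinv : Tendsto (fun t => (D.C * X t * D.Cᵀ + D.M)⁻¹) atTop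
      (𝓝 (D.C * Y * D.Cᵀ + D.M)⁻¹) := by
    simp only [Matrix.inv_def, Ring.inverse_eq_inv']
    have hd : Continuous fun N : Matrix (Fin ny) (Fin ny) ℝ => N.det :=
      Continuous.matrix_det continuous_id
    have ha : Continuous fun N : Matrix (Fin ny) (Fin ny) ℝ => N.adjugate :=
      Continuous.matrix_adjugate continuous_id
    exact (((hd.tendsto _).comp hs).inv₀ (Data.innovation_isUnit hM hY).ne_zero).smul
      ((ha.tendsto _).comp hs)
  have hc : Continuous fun p : Matrix (Fin nx) (Fin nx) ℝ × Matrix (Fin ny) (Fin ny) ℝ =>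
      p.1 - p.1 * D.Cᵀ * p.2 * D.C * p.1 := by fun_prop
  exact (hc.tendsto (Y, _)).comp (h.prodMk_nhds hinv)

open scoped MatrixOrder in
/-- The Kalman filter covariances converge to any stationary one. -/
theorem Data.tendsto_filterCov (hM : D.M.PosDef) (hS : S.PosSemidef)
    (hstab : Stabilizable D.A (msqrt S)) (hM0 : D.M0.PosSemidef)
    {X : Matrix (Fin nx) (Fin nx) ℝ} (hX : X.PosSemidef) (hfix : X = D.riccati S X) :
    Tendsto (D.filterCov S) atTop (𝓝 X) := by
  have hpos : ∀ t, (D.filterCov S t).PosSemidef := by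
    intro t
    induction t with
    | zero => exact Data.covUpdate_posSemidef hM hM0
    | succ t ih => exact Data.riccati_posSemidef hM hS ih
  -- the recursion started at zero
  let Z : ℕ → Matrix (Fin nx) (Fin nx) ℝ := fun t => (D.riccati S)^[t] 0
  have hZs : ∀ t, Z (t + 1) = D.riccati S (Z t) := fun t => Function.iterate_succ_apply' _ _ _
  have hZpos : ∀ t, (Z t).PosSemidef := by
    intro t
    induction t with
    | zero => exact Matrix.PosSemidef.zero
    | succ t ih => rw [hZs]; exact Data.riccati_posSemidef hM hS ih
  have hZmono : Monotone Z := by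
    refine monotone_nat_of_le_succ fun t => ?_
    induction t with
    | zero => exact Matrix.nonneg_iff_posSemidef.mpr (hZpos 1)
    | succ t ih =>
      rw [hZs t, hZs (t + 1)]
      exact Data.riccati_mono hM hS (hZpos t) (hZpos (t + 1)) ih
  have hZX : ∀ t, Z t ≤ X := by
    intro t
    induction t with
    | zero => exact Matrix.nonneg_iff_posSemidef.mpr hX
    | succ t ih =>
      rw [hZs t, hfix]
      exact Data.riccati_mono hM hS (hZpos t) hX ih
  have hZf : ∀ t, Z t ≤ D.filterCov S t := by
    intro t
    induction t with
    | zero => exact Matrix.nonneg_iff_posSemidef.mpr (hpos 0)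
    | succ t ih =>
      rw [hZs t]
      exact Data.riccati_mono hM hS (hZpos t) (hpos t) ih
  -- The given stationary covariance X is the upper bound for the increasing iterates.
  obtain ⟨Y, hY⟩ := exists_tendsto_of_monotone
    (fun t => PosSemidef.transpose_eq (hZpos t)) hZmono hZX
  have hYpos := posSemidef_of_tendsto hZpos hY
  have hYfix : Y = D.riccati S Y := by
    have hp : Tendsto (fun t => D.A * Z t * D.Aᵀ + S) atTop (𝓝 (D.A * Y * D.Aᵀ + S)) := by
      have hc : Continuous fun N : Matrix (Fin nx) (Fin nx) ℝ => D.A * N * D.Aᵀ + S := by fun_prop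
      exact (hc.tendsto Y).comp hY
    refine tendsto_nhds_unique ((tendsto_add_atTop_iff_nat 1).mpr hY) ?_
    simp_rw [hZs]
    exact Data.tendsto_covUpdate hM (Data.predict_posSemidef hS hYpos) hp
  -- The gain optimal for Y is suboptimal for X, so the difference satisfies X - Y ≤ F(X-Y)Fᵀ with
  -- the stable filter matrix F at Y; as X - Y ≥ 0, it vanishes.
  have hYX : Y = X := by
    have hYj := hYfix.trans (Data.joseph_gain hM (Data.predict_posSemidef hS hYpos)).symm
    have hst := Data.isStable_filter hM hS hstab hYpos hYj
    set K := D.gain (D.A * Y * D.Aᵀ + S)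
    have hYle : Y ≤ X := by
      rw [le_iff_quadratic (PosSemidef.transpose_eq hYpos) (PosSemidef.transpose_eq hX)]
      exact fun v => le_of_tendsto' (tendsto_quadratic hY v) fun t => quadratic_mono (hZX t) v
    have h0 : X - Y ≤ ((1 - K * D.C) * D.A) * (X - Y) * ((1 - K * D.C) * D.A)ᵀ := by
      rw [← Data.joseph_predict_sub (S := S), ← hYj]
      refine sub_le_sub_right ?_ Y
      conv_lhs => rw [hfix]
      exact Data.covUpdate_le_joseph hM (Data.predict_posSemidef hS hX) K
    exact (sub_eq_zero.mp (eq_zero_of_le_conj hst (Matrix.le_iff.mp hYle) h0)).symm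
  -- the filter with the stationary gain
  have hXj := hfix.trans (Data.joseph_gain hM (Data.predict_posSemidef hS hX)).symm
  have hst := Data.isStable_filter hM hS hstab hX hXj
  set K := D.gain (D.A * X * D.Aᵀ + S)
  let U : ℕ → Matrix (Fin nx) (Fin nx) ℝ := fun t =>
    (fun N => D.joseph K (D.A * N * D.Aᵀ + S))^[t] (D.filterCov S 0)
  have hUs : ∀ t, U (t + 1) = D.joseph K (D.A * U t * D.Aᵀ + S) := fun t =>
    Function.iterate_succ_apply' _ _ _
  -- Freezing the gain can only enlarge the covariance. The filter covariances now lie between `Z`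
  -- and `U`, which both tend to X.
  have hfU : ∀ t, D.filterCov S t ≤ U t := by
    intro t
    induction t with
    | zero => exact le_rfl
    | succ t ih =>
      rw [hUs]
      exact (Data.covUpdate_le_joseph hM (Data.predict_posSemidef hS (hpos t)) K).trans
        (Data.joseph_mono (Data.predict_mono ih) K)
  have hU := Data.tendsto_of_constant_gain hst hXj hUs
  rw [hYX] at hY
  exact tendsto_of_quadratic (fun t => PosSemidef.transpose_eq (hpos t))
    (PosSemidef.transpose_eq hX) fun v =>
      tendsto_of_tendsto_of_tendsto_of_le_of_le (tendsto_quadratic hY v) (tendsto_quadratic hU v)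
        (fun t => quadratic_mono (hZf t) v) fun t => quadratic_mono (hfU t) v

end FilterRiccati

/-! ### Second moments of random vectors -/

section Moments

variable {Ω : Type*} [MeasurableSpace Ω] {μ : Measure Ω} {n m k : ℕ}

/-- Square-integrable random vectors. -/
def MemL2 (μ : Measure Ω) (X : Ω → Fin n → ℝ) : Prop :=
  ∀ i, MemLp (fun ω => X ω i) 2 μ

/-- The matrix `E[X Zᵀ]`. -/
noncomputable def crossMoment (μ : Measure Ω) (X : Ω → Fin n → ℝ) (Z : Ω → Fin m → ℝ) :
    Matrix (Fin n) (Fin m) ℝ :=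
  Matrix.of fun i j => ∫ ω, X ω i * Z ω j ∂μ

theorem MemL2.add {X Z : Ω → Fin n → ℝ} (hX : MemL2 μ X) (hZ : MemL2 μ Z) :
    MemL2 μ fun ω => X ω + Z ω := fun i => (hX i).add (hZ i)

theorem MemL2.sub {X Z : Ω → Fin n → ℝ} (hX : MemL2 μ X) (hZ : MemL2 μ Z) :
    MemL2 μ fun ω => X ω - Z ω := fun i => (hX i).sub (hZ i)

theorem MemL2.const [IsFiniteMeasure μ] (c : Fin n → ℝ) : MemL2 μ fun _ => c :=
  fun _ => memLp_const _

theorem MemL2.mulVec {X : Ω → Fin n → ℝ} (hX : MemL2 μ X) (A : Matrix (Fin m) (Fin n) ℝ) :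
    MemL2 μ fun ω => A *ᵥ X ω := fun i => by
  simp only [Matrix.mulVec, dotProduct]
  exact memLp_finsetSum _ fun j _ => (hX j).const_mul (A i j)

theorem MemL2.congr {X Z : Ω → Fin n → ℝ} (hX : MemL2 μ X) (h : X =ᵐ[μ] Z) : MemL2 μ Z :=
  fun i => (hX i).ae_eq (h.mono fun _ hω => congrFun hω i)

theorem MemL2.integrable_mul {X : Ω → Fin n → ℝ} {Z : Ω → Fin m → ℝ} (hX : MemL2 μ X)
    (hZ : MemL2 μ Z) (i : Fin n) (j : Fin m) : Integrable (fun ω => X ω i * Z ω j) μ :=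
  (hX i).integrable_mul (hZ j)

theorem MemL2.integrable_dotProduct {X Z : Ω → Fin n → ℝ} (hX : MemL2 μ X) (hZ : MemL2 μ Z) :
    Integrable (fun ω => X ω ⬝ᵥ Z ω) μ :=
  integrable_finsetSum _ fun i _ => hX.integrable_mul hZ i i

theorem MemL2.integrable_dotProduct_const [IsFiniteMeasure μ] {X : Ω → Fin n → ℝ}
    (hX : MemL2 μ X) (c : Fin n → ℝ) : Integrable (fun ω => c ⬝ᵥ X ω) μ :=
  (MemL2.const c).integrable_dotProduct hX

theorem crossMoment_congr {X X' : Ω → Fin n → ℝ} {Z Z' : Ω → Fin m → ℝ} (hX : X =ᵐ[μ] X')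
    (hZ : Z =ᵐ[μ] Z') : crossMoment μ X Z = crossMoment μ X' Z' := by
  ext i j
  refine integral_congr_ae ?_
  filter_upwards [hX, hZ] with ω h1 h2
  rw [h1, h2]

theorem crossMoment_transpose (X : Ω → Fin n → ℝ) (Z : Ω → Fin m → ℝ) :
    (crossMoment μ X Z)ᵀ = crossMoment μ Z X := by
  ext i j; simp [crossMoment, mul_comm]

theorem crossMoment_add_left {X X' : Ω → Fin n → ℝ} {Z : Ω → Fin m → ℝ} (hX : MemL2 μ X)
    (hX' : MemL2 μ X') (hZ : MemL2 μ Z) :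
    crossMoment μ (fun ω => X ω + X' ω) Z = crossMoment μ X Z + crossMoment μ X' Z := by
  ext i j
  simp only [crossMoment, Matrix.of_apply, Matrix.add_apply, Pi.add_apply, add_mul]
  exact integral_add (hX.integrable_mul hZ i j) (hX'.integrable_mul hZ i j)

theorem crossMoment_mulVec_left {X : Ω → Fin n → ℝ} {Z : Ω → Fin m → ℝ} (hX : MemL2 μ X)
    (hZ : MemL2 μ Z) (A : Matrix (Fin k) (Fin n) ℝ) :
    crossMoment μ (fun ω => A *ᵥ X ω) Z = A * crossMoment μ X Z := by
  ext i j
  simp only [crossMoment, Matrix.of_apply, Matrix.mul_apply, Matrix.mulVec, dotProduct,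
    Finset.sum_mul, mul_assoc]
  rw [integral_finsetSum _ fun l _ => (hX.integrable_mul hZ l j).const_mul (A i l)]
  exact Finset.sum_congr rfl fun l _ => integral_const_mul _ _

theorem crossMoment_add_right {X : Ω → Fin n → ℝ} {Z Z' : Ω → Fin m → ℝ} (hX : MemL2 μ X)
    (hZ : MemL2 μ Z) (hZ' : MemL2 μ Z') :
    crossMoment μ X (fun ω => Z ω + Z' ω) = crossMoment μ X Z + crossMoment μ X Z' := by
  rw [← crossMoment_transpose, crossMoment_add_left hZ hZ' hX, Matrix.transpose_add,
    crossMoment_transpose, crossMoment_transpose]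

theorem crossMoment_mulVec_right {X : Ω → Fin n → ℝ} {Z : Ω → Fin m → ℝ} (hX : MemL2 μ X)
    (hZ : MemL2 μ Z) (A : Matrix (Fin k) (Fin m) ℝ) :
    crossMoment μ X (fun ω => A *ᵥ Z ω) = crossMoment μ X Z * Aᵀ := by
  rw [← crossMoment_transpose, crossMoment_mulVec_left hZ hX, Matrix.transpose_mul,
    crossMoment_transpose]

/-- Cross moments of linear combinations of uncorrelated vectors. -/
theorem crossMoment_linear {k' : ℕ} {X : Ω → Fin n → ℝ} {Z : Ω → Fin m → ℝ} (hX : MemL2 μ X)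
    (hZ : MemL2 μ Z) (h : crossMoment μ X Z = 0) (A : Matrix (Fin k) (Fin n) ℝ)
    (B : Matrix (Fin k) (Fin m) ℝ) (A' : Matrix (Fin k') (Fin n) ℝ)
    (B' : Matrix (Fin k') (Fin m) ℝ) :
    crossMoment μ (fun ω => A *ᵥ X ω + B *ᵥ Z ω) (fun ω => A' *ᵥ X ω + B' *ᵥ Z ω)
      = A * crossMoment μ X X * A'ᵀ + B * crossMoment μ Z Z * B'ᵀ := by
  have h' : crossMoment μ Z X = 0 := by
    rw [← crossMoment_transpose, h, Matrix.transpose_zero]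
  have hX' := hX.mulVec A'
  have hZ' := hZ.mulVec B'
  rw [crossMoment_add_left (hX.mulVec A) (hZ.mulVec B) (hX'.add hZ'),
    crossMoment_mulVec_left hX (hX'.add hZ'), crossMoment_mulVec_left hZ (hX'.add hZ'),
    crossMoment_add_right hX hX' hZ', crossMoment_add_right hZ hX' hZ',
    crossMoment_mulVec_right hX hX, crossMoment_mulVec_right hX hZ, crossMoment_mulVec_right hZ hX,
    crossMoment_mulVec_right hZ hZ, h, h']
  simp [Matrix.mul_assoc]

theorem integral_dotProduct_mulVec {X : Ω → Fin n → ℝ} {Z : Ω → Fin m → ℝ} (hX : MemL2 μ X)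
    (hZ : MemL2 μ Z) (A : Matrix (Fin n) (Fin m) ℝ) :
    ∫ ω, X ω ⬝ᵥ (A *ᵥ Z ω) ∂μ = (A * crossMoment μ Z X).trace := by
  rw [← crossMoment_mulVec_left hZ hX]
  simp only [dotProduct, Matrix.trace, Matrix.diag_apply, crossMoment, Matrix.of_apply]
  rw [integral_finsetSum _ fun i _ => hX.integrable_mul (hZ.mulVec A) i i]
  simp only [mul_comm]

theorem crossMoment_self_posSemidef {X : Ω → Fin n → ℝ} (hX : MemL2 μ X) :
    (crossMoment μ X X).PosSemidef := by
  rw [posSemidef_iff_real]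
  refine ⟨crossMoment_transpose X X, fun v => ?_⟩
  have h : v ⬝ᵥ (crossMoment μ X X *ᵥ v) = ∫ ω, (v ⬝ᵥ X ω) * (v ⬝ᵥ X ω) ∂μ := by
    simp only [dotProduct, Matrix.mulVec, crossMoment, Matrix.of_apply, Finset.mul_sum,
      Finset.sum_mul]
    rw [integral_finsetSum _ fun i _ => integrable_finsetSum _ fun j _ => by
      simpa only [mul_mul_mul_comm] using (hX.integrable_mul hX j i).const_mul (v j * v i)]
    refine Finset.sum_congr rfl fun i _ => ?_
    rw [integral_finsetSum _ fun j _ => by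
      simpa only [mul_mul_mul_comm] using (hX.integrable_mul hX j i).const_mul (v j * v i)]
    refine Finset.sum_congr rfl fun j _ => ?_
    rw [← integral_mul_const, ← integral_const_mul]
    exact integral_congr_ae (ae_of_all _ fun ω => by ring)
  rw [h]
  exact integral_nonneg fun ω => mul_self_nonneg _

end Moments

/-! ### Conditional laws -/

section ConditionalLaw

variable {Ω E : Type*} [MeasurableSpace Ω] [MeasurableSpace E] {μ : Measure Ω}
  [IsProbabilityMeasure μ] {n : ℕ}

/-- The joint law, from a regular version of the conditional law. -/
theorem map_prodMk_eq_compProd {F : Type*} [MeasurableSpace F] {Z : Ω → E} {W : Ω → F}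
    {κ : Kernel E F} [IsMarkovKernel κ] (hZ : Measurable Z) (hW : Measurable W)
    (h : ∀ S : Set F, MeasurableSet S →
      μ⟦W ⁻¹' S | MeasurableSpace.comap Z inferInstance⟧ =ᵐ[μ] fun ω => (κ (Z ω)).real S) :
    μ.map (fun ω => (Z ω, W ω)) = μ.map Z ⊗ₘ κ := by
  have : IsProbabilityMeasure (μ.map Z) := Measure.isProbabilityMeasure_map hZ.aemeasurable
  have : IsProbabilityMeasure (μ.map fun ω => (Z ω, W ω)) :=
    Measure.isProbabilityMeasure_map (hZ.prodMk hW).aemeasurable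
  refine Measure.ext_prod fun {s t} hs ht => ?_
  rw [Measure.map_apply (hZ.prodMk hW) (hs.prod ht), Measure.compProd_apply_prod hs ht,
    setLIntegral_map hs (Kernel.measurable_coe κ ht) hZ]
  have hle : MeasurableSpace.comap Z inferInstance ≤ ‹MeasurableSpace Ω› := hZ.comap_le
  have hWt := hW ht
  -- Agreement on rectangles: the defining property of the conditional probability, integrated over
  -- an event of the σ-algebra of Z.
  have h1 : ∫ ω in Z ⁻¹' s, (κ (Z ω)).real t ∂μ = μ.real (Z ⁻¹' s ∩ W ⁻¹' t) := by
    rw [← setIntegral_congr_ae (hZ hs) ((h t ht).mono fun ω hω _ => hω),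
      setIntegral_condExp hle ((integrable_const 1).indicator hWt) ⟨s, hs, rfl⟩,
      setIntegral_indicator hWt, setIntegral_const, smul_eq_mul, mul_one]
  have h2 : ∫⁻ ω in Z ⁻¹' s, κ (Z ω) t ∂μ = ENNReal.ofReal (∫ ω in Z ⁻¹' s, (κ (Z ω)).real t ∂μ) := by
    have hm : Measurable fun ω => (κ (Z ω)).real t :=
      ((Kernel.measurable_coe κ ht).comp hZ).ennreal_toReal
    rw [ofReal_integral_eq_lintegral_ofReal]
    · simp [measureReal_def]
    · exact Integrable.of_bound hm.aestronglyMeasurable 1 (ae_of_all _ fun ω => by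
        rw [Real.norm_of_nonneg measureReal_nonneg]; exact measureReal_le_one)
    · exact ae_of_all _ fun ω => measureReal_nonneg
  rw [h2, h1, ofReal_measureReal]
  rfl

theorem HasMoments.memLp_apply {P : Measure (Fin n → ℝ)} {m : Fin n → ℝ}
    {S : Matrix (Fin n) (Fin n) ℝ} (h : HasMoments P m S) (i : Fin n) :
    MemLp (fun w => w i) 2 P := by
  have := h.memLp
  exact memLp_pi_iff.mp this i

theorem HasMoments.memL2 {P : Measure (Fin n → ℝ)} {m : Fin n → ℝ}
    {S : Matrix (Fin n) (Fin n) ℝ} (h : HasMoments P m S) :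
    MemL2 P fun w => w - m := by
  have := h.isProb
  exact MemL2.sub (fun i => h.memLp_apply i) (MemL2.const m)

theorem HasMoments.integral_apply {P : Measure (Fin n → ℝ)} {m : Fin n → ℝ}
    {S : Matrix (Fin n) (Fin n) ℝ} (h : HasMoments P m S) (i : Fin n) :
    ∫ w, w i ∂P = m i := congrFun h.mean_eq i

theorem HasMoments.integral_sub {P : Measure (Fin n → ℝ)} {m : Fin n → ℝ}
    {S : Matrix (Fin n) (Fin n) ℝ} (h : HasMoments P m S) (i : Fin n) :
    ∫ w, (w i - m i) ∂P = 0 := by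
  have := h.isProb
  rw [MeasureTheory.integral_sub ((h.memLp_apply i).integrable one_le_two) (integrable_const _),
    h.integral_apply]
  simp

theorem HasMoments.crossMoment_eq {P : Measure (Fin n → ℝ)} {m : Fin n → ℝ}
    {S : Matrix (Fin n) (Fin n) ℝ} (h : HasMoments P m S) :
    crossMoment P (fun w => w - m) (fun w => w - m) = S := by
  rw [← h.cov_eq, ← h.mean_eq]; rfl

theorem HasMoments.posSemidef {P : Measure (Fin n → ℝ)} {m : Fin n → ℝ}
    {S : Matrix (Fin n) (Fin n) ℝ} (h : HasMoments P m S) : S.PosSemidef := by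
  rw [← h.crossMoment_eq]; exact crossMoment_self_posSemidef h.memL2

variable {Z : Ω → E} {W : Ω → Fin n → ℝ} {κ : Kernel E (Fin n → ℝ)} [IsMarkovKernel κ]
  {m : E → Fin n → ℝ} {S : Matrix (Fin n) (Fin n) ℝ}

/-- Given Z, the centred entries have the constant second moments S i i, so the iterated integral is
finite. No integrability of `m ∘ Z` is required, which matters because that of the state is only
derived from this. -/
theorem memL2_of_conditional (hZ : Measurable Z) (hW : Measurable W) (hm : Measurable m)
    (hlaw : μ.map (fun ω => (Z ω, W ω)) = μ.map Z ⊗ₘ κ) (hκ : ∀ z, HasMoments (κ z) (m z) S) :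
    MemL2 μ fun ω => W ω - m (Z ω) := by
  have : IsProbabilityMeasure (μ.map Z) := Measure.isProbabilityMeasure_map hZ.aemeasurable
  intro i
  have hmeas : Measurable fun p : E × (Fin n → ℝ) => (p.2 - m p.1) i := by fun_prop
  have hs : AEStronglyMeasurable (fun ω => (W ω - m (Z ω)) i) μ :=
    (hmeas.comp (hZ.prodMk hW)).aestronglyMeasurable
  refine (memLp_two_iff_integrable_sq hs).mpr ?_
  have hint : Integrable (fun p : E × (Fin n → ℝ) => ((p.2 - m p.1) i) ^ 2) (μ.map Z ⊗ₘ κ) := by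
    rw [Measure.integrable_compProd_iff (hmeas.pow_const 2).aestronglyMeasurable]
    refine ⟨ae_of_all _ fun z => ((hκ z).memL2 i).integrable_sq, ?_⟩
    have : (fun z => ∫ w, ‖((w - m z) i) ^ 2‖ ∂κ z) = fun _ => S i i := by
      funext z
      rw [← (hκ z).crossMoment_eq]
      simp only [crossMoment, Matrix.of_apply]
      refine integral_congr_ae (ae_of_all _ fun w => ?_)
      change ‖((w - m z) i) ^ 2‖ = (w - m z) i * (w - m z) i
      rw [Real.norm_of_nonneg (sq_nonneg _), sq]
    rw [this]
    exact integrable_const _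
  rw [← hlaw] at hint
  exact hint.comp_measurable (hZ.prodMk hW)

theorem crossMoment_of_conditional (hZ : Measurable Z) (hW : Measurable W) (hm : Measurable m)
    (hlaw : μ.map (fun ω => (Z ω, W ω)) = μ.map Z ⊗ₘ κ) (hκ : ∀ z, HasMoments (κ z) (m z) S) :
    crossMoment μ (fun ω => W ω - m (Z ω)) (fun ω => W ω - m (Z ω)) = S := by
  have : IsProbabilityMeasure (μ.map Z) := Measure.isProbabilityMeasure_map hZ.aemeasurable
  have hL := memL2_of_conditional hZ hW hm hlaw hκ
  ext i j
  have hmeas : Measurable fun p : E × (Fin n → ℝ) => (p.2 - m p.1) i * (p.2 - m p.1) j := by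
    fun_prop
  have hmap : ∫ p, (p.2 - m p.1) i * (p.2 - m p.1) j ∂(μ.map fun ω => (Z ω, W ω)) =
      ∫ ω, (W ω - m (Z ω)) i * (W ω - m (Z ω)) j ∂μ :=
    integral_map (hZ.prodMk hW).aemeasurable hmeas.aestronglyMeasurable
  have hint : Integrable (fun p : E × (Fin n → ℝ) => (p.2 - m p.1) i * (p.2 - m p.1) j)
      (μ.map Z ⊗ₘ κ) := by
    rw [← hlaw, integrable_map_measure hmeas.aestronglyMeasurable (hZ.prodMk hW).aemeasurable]
    exact hL.integrable_mul hL i j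
  simp only [crossMoment, Matrix.of_apply]
  rw [← hmap, hlaw, Measure.integral_compProd hint]
  have : ∀ z, ∫ w, (w - m z) i * (w - m z) j ∂κ z = S i j := fun z => by
    rw [← (hκ z).crossMoment_eq]; rfl
  simp only [this]
  simp

/-- A vector measurable with respect to Z factors as f(Z) and leaves the inner integral; what
remains is the conditional mean of the centred vector, zero. -/
theorem crossMoment_past_of_conditional (hZ : Measurable Z) (hW : Measurable W)
    (hm : Measurable m) (hlaw : μ.map (fun ω => (Z ω, W ω)) = μ.map Z ⊗ₘ κ)
    (hκ : ∀ z, HasMoments (κ z) (m z) S) {k : ℕ} {X : Ω → Fin k → ℝ}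
    (hX : Measurable[MeasurableSpace.comap Z inferInstance] X) (hX2 : MemL2 μ X) :
    crossMoment μ X (fun ω => W ω - m (Z ω)) = 0 := by
  have : IsProbabilityMeasure (μ.map Z) := Measure.isProbabilityMeasure_map hZ.aemeasurable
  have hL := memL2_of_conditional hZ hW hm hlaw hκ
  obtain ⟨f, hf, rfl⟩ := hX.exists_eq_measurable_comp
  ext i j
  have hmeas : Measurable fun p : E × (Fin n → ℝ) => f p.1 i * (p.2 - m p.1) j := by fun_prop
  have hmap : ∫ p, f p.1 i * (p.2 - m p.1) j ∂(μ.map fun ω => (Z ω, W ω)) =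
      ∫ ω, (f ∘ Z) ω i * (W ω - m (Z ω)) j ∂μ :=
    integral_map (hZ.prodMk hW).aemeasurable hmeas.aestronglyMeasurable
  have hint : Integrable (fun p : E × (Fin n → ℝ) => f p.1 i * (p.2 - m p.1) j)
      (μ.map Z ⊗ₘ κ) := by
    rw [← hlaw, integrable_map_measure hmeas.aestronglyMeasurable (hZ.prodMk hW).aemeasurable]
    exact hX2.integrable_mul hL i j
  simp only [crossMoment, Matrix.of_apply]
  rw [← hmap, hlaw, Measure.integral_compProd hint]
  have : ∀ z, ∫ w, f z i * (w - m z) j ∂κ z = 0 := fun z => by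
    rw [integral_const_mul]
    have := (hκ z).integral_sub j
    simp only [Pi.sub_apply, this, mul_zero]
  simp only [this]
  simp

end ConditionalLaw

/-! ### The closed loop -/

section ClosedLoop

variable {nx nu ny : ℕ} {Ω : Type*}

/-- The σ-algebra of everything realized before `w_t` is drawn. -/
abbrev sigW (x w : ℕ → Ω → Fin nx → ℝ) (v : ℕ → Ω → Fin ny → ℝ) (t : ℕ) : MeasurableSpace Ω :=
  MeasurableSpace.comap (pastW x w v t) inferInstance

/-- The σ-algebra of everything realized before `v_t` is drawn. -/
abbrev sigV (x w : ℕ → Ω → Fin nx → ℝ) (v : ℕ → Ω → Fin ny → ℝ) (t : ℕ) : MeasurableSpace Ω :=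
  MeasurableSpace.comap (pastV x w v t) inferInstance

theorem measurable_mulVec {E : Type*} {mE : MeasurableSpace E} {n m : ℕ} {f : E → Fin n → ℝ}
    (hf : Measurable f) (A : Matrix (Fin m) (Fin n) ℝ) : Measurable fun e => A *ᵥ f e :=
  (Continuous.matrix_mulVec continuous_const continuous_id).measurable.comp hf

/-! ### The interlaced σ-algebras before the draws of v_t and of w_t. -/

section SigmaAlgebras

variable {x w : ℕ → Ω → Fin nx → ℝ} {v : ℕ → Ω → Fin ny → ℝ}

theorem sigV_le_sigW (t : ℕ) : sigV x w v t ≤ sigW x w v t := by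
  have hg : Measurable fun p : (Fin nx → ℝ) × (Fin t → Fin nx → ℝ) × (Fin (t + 1) → Fin ny → ℝ) =>
      (p.1, p.2.1, fun i : Fin t => p.2.2 i.castSucc) := by fun_prop
  exact (hg.comp (comap_measurable (pastW x w v t))).comap_le

theorem sigW_le_sigV_succ (t : ℕ) : sigW x w v t ≤ sigV x w v (t + 1) := by
  have hg : Measurable fun p : (Fin nx → ℝ) × (Fin (t + 1) → Fin nx → ℝ) ×
      (Fin (t + 1) → Fin ny → ℝ) => (p.1, (fun i : Fin t => p.2.1 i.castSucc), p.2.2) := by fun_prop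
  exact (hg.comp (comap_measurable (pastV x w v (t + 1)))).comap_le

theorem measurable_sigV_zero : Measurable[sigV x w v 0] (x 0) :=
  measurable_fst.comp (comap_measurable (pastV x w v 0))

theorem measurable_sigW_v (t : ℕ) : Measurable[sigW x w v t] (v t) := by
  have hg : Measurable fun p : (Fin nx → ℝ) × (Fin t → Fin nx → ℝ) × (Fin (t + 1) → Fin ny → ℝ) =>
      p.2.2 (Fin.last t) := by fun_prop
  exact hg.comp (comap_measurable (pastW x w v t))

theorem measurable_sigV_w (t : ℕ) : Measurable[sigV x w v (t + 1)] (w t) := by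
  have hg : Measurable fun p : (Fin nx → ℝ) × (Fin (t + 1) → Fin nx → ℝ) ×
      (Fin (t + 1) → Fin ny → ℝ) => p.2.1 (Fin.last t) := by fun_prop
  exact hg.comp (comap_measurable (pastV x w v (t + 1)))

end SigmaAlgebras

theorem measurable_infoProc_zero {m : MeasurableSpace Ω} {y : ℕ → Ω → Fin ny → ℝ}
    {u : ℕ → Ω → Fin nu → ℝ} (hy : Measurable (y 0)) : Measurable (infoProc y u 0) := by
  refine Measurable.prodMk (measurable_pi_lambda _ fun i => ?_)
    (measurable_pi_lambda _ fun i => i.elim0)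
  rw [Fin.fin_one_eq_zero i]
  exact hy

theorem measurable_infoProc_succ {m : MeasurableSpace Ω} {y : ℕ → Ω → Fin ny → ℝ}
    {u : ℕ → Ω → Fin nu → ℝ} {t : ℕ} (h : Measurable (infoProc y u t))
    (hy : Measurable (y (t + 1))) (hu : Measurable (u t)) :
    Measurable (infoProc y u (t + 1)) := by
  refine Measurable.prodMk (measurable_pi_lambda _ fun i => ?_)
    (measurable_pi_lambda _ fun i => ?_)
  · refine Fin.lastCases ?_ (fun i => ?_) i
    · exact hy
    · exact (measurable_pi_apply i).comp (measurable_fst.comp h)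
  · refine Fin.lastCases ?_ (fun i => ?_) i
    · exact hu
    · exact (measurable_pi_apply i).comp (measurable_snd.comp h)

theorem measurable_info_prev (t : ℕ) :
    Measurable (Info.prev : Info ny nu (t + 1) → Info ny nu t) := by
  unfold Info.prev
  fun_prop

theorem Data.measurable_filterEst (D : Data nx nu ny) (P : Matrix (Fin nx) (Fin nx) ℝ)
    (X : ℕ → Matrix (Fin nx) (Fin nx) ℝ) : ∀ t, Measurable (D.filterEst P X t) := by
  intro t
  induction t with
  | zero =>
    refine measurable_const.add (measurable_mulVec (Measurable.sub ?_ measurable_const) _)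
    exact (measurable_pi_apply 0).comp measurable_fst
  | succ t ih =>
    have h1 : Measurable fun I : Info ny nu (t + 1) => D.filterEst P X t I.prev :=
      ih.comp (measurable_info_prev t)
    have h2 : Measurable fun I : Info ny nu (t + 1) => I.2 (Fin.last t) := by fun_prop
    have h3 : Measurable fun I : Info ny nu (t + 1) => I.1 (Fin.last (t + 1)) := by fun_prop
    have h4 := ((measurable_mulVec h1 D.A).add (measurable_mulVec h2 D.B)).add
      ((measurable_mulVec h1 (D.Hss P)).add (measurable_const (a := D.Gss P)))
    exact h4.add (measurable_mulVec (h3.sub (measurable_mulVec h4 D.C)) _)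

variable [MeasurableSpace Ω] {D : Data nx nu ny} {μ : Measure Ω}
  {pol : ∀ t, Info ny nu t → Fin nu → ℝ} {γ : ∀ t, Kernel (Info ny nu t) (Fin nx → ℝ)}
  {x w : ℕ → Ω → Fin nx → ℝ} {y v : ℕ → Ω → Fin ny → ℝ} {u : ℕ → Ω → Fin nu → ℝ}

theorem IsClosedLoop.measurable_pastW (h : IsClosedLoop D μ pol γ x y u w v) (t : ℕ) :
    Measurable (pastW x w v t) :=
  h.measurable_x0.prodMk ((measurable_pi_lambda _ fun _ => h.measurable_w _).prodMk
    (measurable_pi_lambda _ fun _ => h.measurable_v _))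

theorem IsClosedLoop.measurable_pastV (h : IsClosedLoop D μ pol γ x y u w v) (t : ℕ) :
    Measurable (pastV x w v t) :=
  h.measurable_x0.prodMk ((measurable_pi_lambda _ fun _ => h.measurable_w _).prodMk
    (measurable_pi_lambda _ fun _ => h.measurable_v _))

/-- The state is fixed before v_t is drawn, the information vector only afterwards, since it
contains y_t. The feedback makes the two claims depend on each other, so they share one induction.
-/
theorem IsClosedLoop.adapted (h : IsClosedLoop D μ pol γ x y u w v) (t : ℕ) :
    Measurable[sigV x w v t] (x t) ∧ Measurable[sigW x w v t] (infoProc y u t) := by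
  have hy : ∀ t, Measurable[sigV x w v t] (x t) → Measurable[sigW x w v t] (y t) := by
    intro t hx
    have : y t = fun ω => D.C *ᵥ x t ω + v t ω := funext (h.output t)
    rw [this]
    exact (measurable_mulVec (hx.mono (sigV_le_sigW t) le_rfl) D.C).add (measurable_sigW_v t)
  induction t with
  | zero =>
    exact ⟨measurable_sigV_zero, measurable_infoProc_zero (hy 0 measurable_sigV_zero)⟩
  | succ t ih =>
    obtain ⟨hx, hI⟩ := ih
    have hu : Measurable[sigW x w v t] (u t) := by
      have : u t = fun ω => pol t (infoProc y u t ω) := funext (h.control t)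
      rw [this]
      exact (h.measurable_pol t).comp hI
    have hx' : Measurable[sigV x w v (t + 1)] (x (t + 1)) := by
      have : x (t + 1) = fun ω => D.A *ᵥ x t ω + D.B *ᵥ u t ω + w t ω := funext (h.state t)
      rw [this]
      have hle := sigW_le_sigV_succ (x := x) (w := w) (v := v) t
      exact ((measurable_mulVec (hx.mono ((sigV_le_sigW t).trans hle) le_rfl) D.A).add
        (measurable_mulVec (hu.mono hle le_rfl) D.B)).add (measurable_sigV_w t)
    have hle : sigW x w v t ≤ sigW x w v (t + 1) :=
      (sigW_le_sigV_succ t).trans (sigV_le_sigW (t + 1))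
    exact ⟨hx', measurable_infoProc_succ (hI.mono hle le_rfl) (hy (t + 1) hx') (hu.mono hle le_rfl)⟩

theorem IsClosedLoop.measurable_infoProc (h : IsClosedLoop D μ pol γ x y u w v) (t : ℕ) :
    Measurable (infoProc y u t) :=
  (h.adapted t).2.mono (h.measurable_pastW t).comap_le le_rfl

theorem IsClosedLoop.measurable_control (h : IsClosedLoop D μ pol γ x y u w v) (t : ℕ) :
    Measurable[sigW x w v t] (u t) := by
  have : u t = fun ω => pol t (infoProc y u t ω) := funext (h.control t)
  rw [this]
  exact (h.measurable_pol t).comp (h.adapted t).2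

/-- The observation noise is square-integrable with second moment `M`, and uncorrelated with the
past. -/
theorem IsClosedLoop.noise_memL2 (h : IsClosedLoop D μ pol γ x y u w v) (t : ℕ) :
    MemL2 μ (v t) := fun i =>
  ((h.noise_moments t).memLp_apply i).comp_measurePreserving
    ⟨h.measurable_v t, rfl⟩

theorem IsClosedLoop.noise_crossMoment (h : IsClosedLoop D μ pol γ x y u w v) (t : ℕ) :
    crossMoment μ (v t) (v t) = D.M := by
  rw [← (h.noise_moments t).crossMoment_eq]
  ext i j
  simp only [crossMoment, Matrix.of_apply, sub_zero]
  rw [integral_map (h.measurable_v t).aemeasurable]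
  exact Measurable.aestronglyMeasurable (by fun_prop)

theorem IsClosedLoop.noise_uncorrelated (h : IsClosedLoop D μ pol γ x y u w v) (t : ℕ) {k : ℕ}
    {X : Ω → Fin k → ℝ} (hX : Measurable[sigV x w v t] X) (hX2 : MemL2 μ X) :
    crossMoment μ X (v t) = 0 := by
  obtain ⟨f, hf, rfl⟩ := hX.exists_eq_measurable_comp
  ext i j
  have hind : IndepFun (fun ω => f (pastV x w v t ω) i) (fun ω => v t ω j) μ :=
    (h.noise_indep t).symm.comp ((measurable_pi_apply i).comp hf) (measurable_pi_apply j)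
  have h0 : ∫ ω, v t ω j ∂μ = 0 := by
    have := (h.noise_moments t).integral_apply j
    rwa [integral_map (h.measurable_v t).aemeasurable
      (measurable_pi_apply j).aestronglyMeasurable] at this
  simp only [crossMoment, Matrix.of_apply, Function.comp_apply]
  rw [hind.integral_fun_mul_eq_mul_integral (hX2 i).aestronglyMeasurable
    (h.noise_memL2 t j).aestronglyMeasurable, h0, mul_zero]
  rfl

variable [IsProbabilityMeasure μ]

/-- The joint law of the past and of the disturbance. -/
theorem IsClosedLoop.exists_joint_law (h : IsClosedLoop D μ pol γ x y u w v) (t : ℕ) :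
    ∃ φ : (Fin nx → ℝ) × (Fin t → Fin nx → ℝ) × (Fin (t + 1) → Fin ny → ℝ) → Info ny nu t,
      ∃ hφ : Measurable φ, infoProc y u t = φ ∘ pastW x w v t ∧
        μ.map (fun ω => (pastW x w v t ω, w t ω)) =
          μ.map (pastW x w v t) ⊗ₘ ((γ t).comap φ hφ) := by
  obtain ⟨φ, hφ, hI⟩ := (h.adapted t).2.exists_eq_measurable_comp
  have := h.markov t
  refine ⟨φ, hφ, hI, map_prodMk_eq_compProd (h.measurable_pastW t) (h.measurable_w t)
    fun S hS => ?_⟩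
  refine (h.disturbance t S hS).trans (ae_of_all _ fun ω => ?_)
  beta_reduce
  rw [Kernel.comap_apply, hI]
  rfl

variable {P S : Matrix (Fin nx) (Fin nx) ℝ} {xbar : ∀ t, Info ny nu t → Fin nx → ℝ}

/-- The centred disturbance, for a version `xh` of the state estimate. -/
theorem IsClosedLoop.disturbance_moments (h : IsClosedLoop D μ pol γ x y u w v)
    (hpair : D.IsStationaryPair P S xbar pol γ) (t : ℕ) (hxm : Measurable (xbar t))
    {xh : Ω → Fin nx → ℝ} (hae : (fun ω => xbar t (infoProc y u t ω)) =ᵐ[μ] xh) :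
    MemL2 μ (fun ω => w t ω - (D.Hss P *ᵥ xh ω + D.Gss P)) ∧
    crossMoment μ (fun ω => w t ω - (D.Hss P *ᵥ xh ω + D.Gss P))
      (fun ω => w t ω - (D.Hss P *ᵥ xh ω + D.Gss P)) = S ∧
    ∀ {k : ℕ} {X : Ω → Fin k → ℝ}, Measurable[sigW x w v t] X → MemL2 μ X →
      crossMoment μ X (fun ω => w t ω - (D.Hss P *ᵥ xh ω + D.Gss P)) = 0 := by
  obtain ⟨φ, hφ, hI, hlaw⟩ := h.exists_joint_law t
  have := h.markov t
  have hm : Measurable fun z => D.Hss P *ᵥ xbar t (φ z) + D.Gss P :=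
    (measurable_mulVec (hxm.comp hφ) _).add measurable_const
  have hκ : ∀ z, HasMoments ((γ t).comap φ hφ z) (D.Hss P *ᵥ xbar t (φ z) + D.Gss P) S :=
    fun z => by rw [Kernel.comap_apply]; exact hpair.moments t (φ z)
  have hcongr : (fun ω => w t ω - (D.Hss P *ᵥ xbar t (φ (pastW x w v t ω)) + D.Gss P)) =ᵐ[μ]
      fun ω => w t ω - (D.Hss P *ᵥ xh ω + D.Gss P) := by
    filter_upwards [hae] with ω hω
    rw [← hω, hI]
    rfl
  have hZ := h.measurable_pastW t
  have hW := h.measurable_w t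
  refine ⟨(memL2_of_conditional hZ hW hm hlaw hκ).congr hcongr, ?_, fun hX hX2 => ?_⟩
  · rw [← crossMoment_congr hcongr hcongr]
    exact crossMoment_of_conditional hZ hW hm hlaw hκ
  · rw [← crossMoment_congr (ae_eq_refl _) hcongr]
    exact crossMoment_past_of_conditional hZ hW hm hlaw hκ hX hX2

end ClosedLoop

/-! ### Estimation errors -/

section EstimationError

variable {nx nu ny : ℕ}

/-- Error covariances, before the measurement update, of the filter with the gains
`X_t Cᵀ M⁻¹`. -/
noncomputable def Data.predCov (D : Data nx nu ny) (X : ℕ → Matrix (Fin nx) (Fin nx) ℝ)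
    (S : Matrix (Fin nx) (Fin nx) ℝ) : ℕ → Matrix (Fin nx) (Fin nx) ℝ
  | 0 => D.M0
  | t + 1 => D.A * D.joseph (X t * D.Cᵀ * D.M⁻¹) (Data.predCov D X S t) * D.Aᵀ + S

/-- Error covariances, after the measurement update, of the filter with the gains
`X_t Cᵀ M⁻¹`. -/
noncomputable def Data.errCov (D : Data nx nu ny) (X : ℕ → Matrix (Fin nx) (Fin nx) ℝ)
    (S : Matrix (Fin nx) (Fin nx) ℝ) (t : ℕ) : Matrix (Fin nx) (Fin nx) ℝ :=
  D.joseph (X t * D.Cᵀ * D.M⁻¹) (D.predCov X S t)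

variable {Ω : Type*}

/-- The state estimate along the process. -/
noncomputable def estProc (D : Data nx nu ny) (P : Matrix (Fin nx) (Fin nx) ℝ)
    (X : ℕ → Matrix (Fin nx) (Fin nx) ℝ) (y : ℕ → Ω → Fin ny → ℝ) (u : ℕ → Ω → Fin nu → ℝ)
    (t : ℕ) (ω : Ω) : Fin nx → ℝ :=
  D.filterEst P X t (infoProc y u t ω)

/-- The disturbance, centred at the mean that belongs to the state estimate. -/
noncomputable def distErr (D : Data nx nu ny) (P : Matrix (Fin nx) (Fin nx) ℝ)
    (X : ℕ → Matrix (Fin nx) (Fin nx) ℝ) (y : ℕ → Ω → Fin ny → ℝ) (u : ℕ → Ω → Fin nu → ℝ)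
    (w : ℕ → Ω → Fin nx → ℝ) (t : ℕ) (ω : Ω) : Fin nx → ℝ :=
  w t ω - (D.Hss P *ᵥ estProc D P X y u t ω + D.Gss P)

/-- The estimation error before the measurement update. -/
noncomputable def predErr (D : Data nx nu ny) (P : Matrix (Fin nx) (Fin nx) ℝ)
    (X : ℕ → Matrix (Fin nx) (Fin nx) ℝ) (x : ℕ → Ω → Fin nx → ℝ) (y : ℕ → Ω → Fin ny → ℝ)
    (u : ℕ → Ω → Fin nu → ℝ) (w : ℕ → Ω → Fin nx → ℝ) : ℕ → Ω → Fin nx → ℝ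
  | 0, ω => x 0 ω - D.m0
  | t + 1, ω => D.A *ᵥ (x t ω - estProc D P X y u t ω) + distErr D P X y u w t ω

variable [MeasurableSpace Ω] {D : Data nx nu ny} {μ : Measure Ω}
  {pol : ∀ t, Info ny nu t → Fin nu → ℝ} {γ : ∀ t, Kernel (Info ny nu t) (Fin nx → ℝ)}
  {x w : ℕ → Ω → Fin nx → ℝ} {y v : ℕ → Ω → Fin ny → ℝ} {u : ℕ → Ω → Fin nu → ℝ}
  {P S : Matrix (Fin nx) (Fin nx) ℝ} {X : ℕ → Matrix (Fin nx) (Fin nx) ℝ}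
  {xbar : ∀ t, Info ny nu t → Fin nx → ℝ}

theorem IsClosedLoop.estProc_zero (h : IsClosedLoop D μ pol γ x y u w v) (ω : Ω) :
    estProc D P X y u 0 ω = D.m0 + (X 0 * D.Cᵀ * D.M⁻¹) *ᵥ
      (D.C *ᵥ predErr D P X x y u w 0 ω + v 0 ω) := by
  change D.m0 + (X 0 * D.Cᵀ * D.M⁻¹) *ᵥ (y 0 ω - D.C *ᵥ D.m0) = _
  rw [h.output, predErr]
  congr 2
  rw [Matrix.mulVec_sub]
  abel

/-- The input Bu is common to the state and its prediction and drops out, so the innovation is Cε +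
v with ε the prediction error. -/
theorem IsClosedLoop.estProc_succ (h : IsClosedLoop D μ pol γ x y u w v) (t : ℕ) (ω : Ω) :
    estProc D P X y u (t + 1) ω =
      D.A *ᵥ estProc D P X y u t ω + D.B *ᵥ u t ω + (D.Hss P *ᵥ estProc D P X y u t ω + D.Gss P)
      + (X (t + 1) * D.Cᵀ * D.M⁻¹) *ᵥ
        (D.C *ᵥ predErr D P X x y u w (t + 1) ω + v (t + 1) ω) := by
  change D.A *ᵥ estProc D P X y u t ω + D.B *ᵥ u t ω
      + (D.Hss P *ᵥ estProc D P X y u t ω + D.Gss P) + (X (t + 1) * D.Cᵀ * D.M⁻¹) *ᵥ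
        (y (t + 1) ω - D.C *ᵥ (D.A *ᵥ estProc D P X y u t ω + D.B *ᵥ u t ω
          + (D.Hss P *ᵥ estProc D P X y u t ω + D.Gss P))) = _
  rw [h.output, h.state, predErr, distErr]
  congr 2
  simp only [Matrix.mulVec_add, Matrix.mulVec_sub]
  abel

theorem IsClosedLoop.state_sub_estProc (h : IsClosedLoop D μ pol γ x y u w v) (t : ℕ) (ω : Ω) :
    x t ω - estProc D P X y u t ω =
      (1 - X t * D.Cᵀ * D.M⁻¹ * D.C) *ᵥ predErr D P X x y u w t ω
        + (-(X t * D.Cᵀ * D.M⁻¹)) *ᵥ v t ω := by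
  rw [Matrix.sub_mulVec, Matrix.one_mulVec, Matrix.neg_mulVec, ← Matrix.mulVec_mulVec]
  cases t with
  | zero =>
    rw [h.estProc_zero, Matrix.mulVec_add, predErr]
    abel
  | succ t =>
    rw [h.estProc_succ, Matrix.mulVec_add, h.state]
    nth_rewrite 2 [predErr]
    rw [distErr, Matrix.mulVec_sub D.A]
    abel

theorem IsClosedLoop.measurable_estProc (h : IsClosedLoop D μ pol γ x y u w v) (t : ℕ) :
    Measurable[sigW x w v t] (estProc D P X y u t) :=
  (D.measurable_filterEst P X t).comp (h.adapted t).2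

theorem IsClosedLoop.measurable_estErr (h : IsClosedLoop D μ pol γ x y u w v) (t : ℕ) :
    Measurable[sigW x w v t] fun ω => x t ω - estProc D P X y u t ω :=
  ((h.adapted t).1.mono (sigV_le_sigW t) le_rfl).sub (h.measurable_estProc t)

theorem IsClosedLoop.measurable_distErr (h : IsClosedLoop D μ pol γ x y u w v) (t : ℕ) :
    Measurable[sigV x w v (t + 1)] (distErr D P X y u w t) :=
  (measurable_sigV_w t).sub ((measurable_mulVec
    ((h.measurable_estProc t).mono (sigW_le_sigV_succ t) le_rfl) _).add measurable_const)

theorem IsClosedLoop.measurable_predErr (h : IsClosedLoop D μ pol γ x y u w v) (t : ℕ) :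
    Measurable[sigV x w v t] (predErr D P X x y u w t) := by
  cases t with
  | zero => exact measurable_sigV_zero.sub measurable_const
  | succ t =>
    exact (measurable_mulVec ((h.measurable_estErr t).mono (sigW_le_sigV_succ t) le_rfl) _).add
      (h.measurable_distErr t)

/-- The estimation error after a measurement update. -/
theorem IsClosedLoop.estErr_moments_of_predErr
    (h : IsClosedLoop D μ pol γ x y u w v) {t : ℕ} {Y : Matrix (Fin nx) (Fin nx) ℝ}
    (h1 : MemL2 μ (predErr D P X x y u w t))
    (h2 : crossMoment μ (predErr D P X x y u w t) (predErr D P X x y u w t) = Y) :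
    MemL2 μ (fun ω => x t ω - estProc D P X y u t ω) ∧
    crossMoment μ (fun ω => x t ω - estProc D P X y u t ω)
      (fun ω => x t ω - estProc D P X y u t ω) = D.joseph (X t * D.Cᵀ * D.M⁻¹) Y := by
  have hv := h.noise_memL2 t
  have hc := h.noise_uncorrelated t (h.measurable_predErr (P := P) (X := X) t) h1
  simp only [h.state_sub_estProc]
  refine ⟨(h1.mulVec _).add (hv.mulVec _), ?_⟩
  rw [crossMoment_linear h1 hv hc, h2, h.noise_crossMoment, Data.joseph]
  simp

variable [IsProbabilityMeasure μ]

theorem IsClosedLoop.distErr_moments (h : IsClosedLoop D μ pol γ x y u w v)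
    (hpair : D.IsStationaryPair P S xbar pol γ) (t : ℕ) (hxm : Measurable (xbar t))
    (hae : (fun ω => xbar t (infoProc y u t ω)) =ᵐ[μ] estProc D P X y u t) :
    MemL2 μ (distErr D P X y u w t) ∧
    crossMoment μ (distErr D P X y u w t) (distErr D P X y u w t) = S ∧
    ∀ {k : ℕ} {X' : Ω → Fin k → ℝ}, Measurable[sigW x w v t] X' → MemL2 μ X' →
      crossMoment μ X' (distErr D P X y u w t) = 0 :=
  h.disturbance_moments hpair t hxm hae

/-- At each step the noise or disturbance is uncorrelated with the current error, so covariances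
simply add. The hypotheses are limited to s < t because in the Gaussian case the estimate is
identified with the filter by an induction that uses this result at time t. -/
theorem IsClosedLoop.predErr_moments (h : IsClosedLoop D μ pol γ x y u w v)
    (hpair : D.IsStationaryPair P S xbar pol γ) (t : ℕ) (hxm : ∀ s < t, Measurable (xbar s))
    (hae : ∀ s < t, (fun ω => xbar s (infoProc y u s ω)) =ᵐ[μ] estProc D P X y u s) :
    MemL2 μ (predErr D P X x y u w t) ∧
    crossMoment μ (predErr D P X x y u w t) (predErr D P X x y u w t) = D.predCov X S t := by
  induction t with
  | zero =>
    have hm := h.initial.memL2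
    constructor
    · exact fun i => (hm i).comp_measurePreserving ⟨h.measurable_x0, rfl⟩
    · rw [Data.predCov, ← h.initial.crossMoment_eq]
      ext i j
      simp only [crossMoment, Matrix.of_apply, predErr]
      rw [integral_map h.measurable_x0.aemeasurable]
      exact Measurable.aestronglyMeasurable (by fun_prop)
  | succ t ih =>
    obtain ⟨i1, i2⟩ := ih (fun s hs => hxm s (hs.trans t.lt_succ_self))
      (fun s hs => hae s (hs.trans t.lt_succ_self))
    obtain ⟨e1, e2⟩ := h.estErr_moments_of_predErr i1 i2
    obtain ⟨d1, d2, d3⟩ := h.distErr_moments hpair t (hxm t t.lt_succ_self) (hae t t.lt_succ_self)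
    have hc := d3 (h.measurable_estErr t) e1
    have hrw : predErr D P X x y u w (t + 1) = fun ω =>
        D.A *ᵥ (x t ω - estProc D P X y u t ω)
          + (1 : Matrix (Fin nx) (Fin nx) ℝ) *ᵥ distErr D P X y u w t ω := by
      funext ω; rw [Matrix.one_mulVec, predErr]
    rw [hrw]
    refine ⟨(e1.mulVec _).add (d1.mulVec _), ?_⟩
    rw [crossMoment_linear e1 d1 hc, e2, d2, Data.predCov]
    simp

theorem IsClosedLoop.estErr_moments (h : IsClosedLoop D μ pol γ x y u w v)
    (hpair : D.IsStationaryPair P S xbar pol γ) (t : ℕ) (hxm : ∀ s < t, Measurable (xbar s))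
    (hae : ∀ s < t, (fun ω => xbar s (infoProc y u s ω)) =ᵐ[μ] estProc D P X y u s) :
    MemL2 μ (fun ω => x t ω - estProc D P X y u t ω) ∧
    crossMoment μ (fun ω => x t ω - estProc D P X y u t ω)
      (fun ω => x t ω - estProc D P X y u t ω) = D.errCov X S t := by
  obtain ⟨h1, h2⟩ := h.predErr_moments hpair t hxm hae
  exact h.estErr_moments_of_predErr h1 h2

end EstimationError

/-! ### The Gaussian case -/

section Gaussian

/-- Associativity of product measures: the joint law of the three is the product of their laws. -/
theorem indepFun_prodMk_of_prodMk {Ω E₁ E₂ E₃ : Type*} [MeasurableSpace Ω] [MeasurableSpace E₁]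
    [MeasurableSpace E₂] [MeasurableSpace E₃] {μ : Measure Ω} [IsProbabilityMeasure μ]
    {X : Ω → E₁} {Y : Ω → E₂} {Z : Ω → E₃} (hX : Measurable X) (hY : Measurable Y)
    (hZ : Measurable Z) (hXY : IndepFun X Y μ) (hXYZ : IndepFun (fun ω => (X ω, Y ω)) Z μ) :
    IndepFun X (fun ω => (Y ω, Z ω)) μ := by
  have hYZ : IndepFun Y Z μ := hXYZ.comp measurable_snd measurable_id
  have : IsProbabilityMeasure (μ.map X) := Measure.isProbabilityMeasure_map hX.aemeasurable
  have : IsProbabilityMeasure (μ.map Y) := Measure.isProbabilityMeasure_map hY.aemeasurable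
  have : IsProbabilityMeasure (μ.map Z) := Measure.isProbabilityMeasure_map hZ.aemeasurable
  rw [indepFun_iff_map_prod_eq_prod_map_map hX.aemeasurable (hY.prodMk hZ).aemeasurable,
    (indepFun_iff_map_prod_eq_prod_map_map hY.aemeasurable hZ.aemeasurable).mp hYZ]
  have h1 := (indepFun_iff_map_prod_eq_prod_map_map (hX.prodMk hY).aemeasurable
    hZ.aemeasurable).mp hXYZ
  rw [(indepFun_iff_map_prod_eq_prod_map_map hX.aemeasurable hY.aemeasurable).mp hXY] at h1
  rw [← Measure.prodAssoc_prod, ← h1, Measure.map_map (by fun_prop) (by fun_prop)]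
  rfl

variable {n : ℕ}

theorem strongDual_apply (L : StrongDual ℝ (Fin n → ℝ)) (w : Fin n → ℝ) :
    L w = (fun i => L (Pi.single i 1)) ⬝ᵥ w := by
  conv_lhs => rw [pi_eq_sum_univ' w]
  simp only [map_sum, map_smul, smul_eq_mul, dotProduct]
  exact Finset.sum_congr rfl fun i _ => by rw [mul_comm]

/-- A Gaussian measure is determined by its mean and covariance. -/
theorem IsGaussian.eq_of_hasMoments {P P' : Measure (Fin n → ℝ)} [IsGaussian P] [IsGaussian P']
    {m : Fin n → ℝ} {S : Matrix (Fin n) (Fin n) ℝ} (h : HasMoments P m S)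
    (h' : HasMoments P' m S) : P = P' := by
  have key : ∀ (P : Measure (Fin n → ℝ)) [IsGaussian P], HasMoments P m S →
      ∀ L : StrongDual ℝ (Fin n → ℝ), P[L] = (fun i => L (Pi.single i 1)) ⬝ᵥ m ∧
        Var[L; P] = (fun i => L (Pi.single i 1)) ⬝ᵥ (S *ᵥ fun i => L (Pi.single i 1)) := by
    intro P _ h L
    set l : Fin n → ℝ := fun i => L (Pi.single i 1) with hl
    have hmean : P[L] = l ⬝ᵥ m := by
      rw [integral_congr_ae (ae_of_all _ (strongDual_apply L))]
      simp only [dotProduct]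
      rw [integral_finsetSum _ fun i _ =>
        ((h.memLp_apply i).integrable one_le_two).const_mul _]
      exact Finset.sum_congr rfl fun i _ => by rw [integral_const_mul, h.integral_apply]
    refine ⟨hmean, ?_⟩
    rw [variance_eq_integral L.continuous.measurable.aemeasurable, hmean]
    -- The functional is written as a matrix with one row, so that its variance is a 1×1 cross
    -- moment lᵀSl.
    have e1 : ∀ w, (L w - l ⬝ᵥ m) ^ 2 =
        ((Matrix.of fun (_ : Fin 1) i => l i) *ᵥ (w - m)) 0
          * ((Matrix.of fun (_ : Fin 1) i => l i) *ᵥ (w - m)) 0 := by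
      intro w
      have : ((Matrix.of fun (_ : Fin 1) i => l i) *ᵥ (w - m)) 0 = L w - l ⬝ᵥ m := by
        rw [strongDual_apply L w, ← hl, ← dotProduct_sub]; rfl
      rw [this, sq]
    simp only [e1]
    have e2 := congrFun (congrFun (crossMoment_mulVec_left h.memL2
      (h.memL2.mulVec (Matrix.of fun (_ : Fin 1) i => l i))
      (Matrix.of fun (_ : Fin 1) i => l i)) 0) 0
    rw [crossMoment_mulVec_right h.memL2 h.memL2, h.crossMoment_eq] at e2
    refine e2.trans ?_
    rw [← Matrix.mul_assoc, Matrix.mul_apply]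
    simp only [dotProduct, Matrix.mulVec, Matrix.mul_apply, Matrix.of_apply,
      Matrix.transpose_apply, Finset.sum_mul, Finset.mul_sum]
    rw [Finset.sum_comm]
    exact Finset.sum_congr rfl fun i _ => Finset.sum_congr rfl fun j _ => by ring
  refine Measure.ext_of_charFunDual ?_
  funext L
  obtain ⟨a, b⟩ := key P h L
  obtain ⟨a', b'⟩ := key P' h' L
  rw [IsGaussian.charFunDual_eq, IsGaussian.charFunDual_eq, b, b', integral_complex_ofReal,
    integral_complex_ofReal, a, a']

theorem HasMoments.map_sub {P : Measure (Fin n → ℝ)} {m : Fin n → ℝ}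
    {S : Matrix (Fin n) (Fin n) ℝ} (h : HasMoments P m S) :
    HasMoments (P.map fun w => w - m) 0 S := by
  have := h.isProb
  have hm : Measurable fun w : Fin n → ℝ => w - m := by fun_prop
  have hmean : meanVec (P.map fun w => w - m) = 0 := by
    funext i
    rw [meanVec, integral_map hm.aemeasurable (measurable_pi_apply i).aestronglyMeasurable]
    exact h.integral_sub i
  refine ⟨Measure.isProbabilityMeasure_map hm.aemeasurable, ?_, hmean, ?_⟩
  · rw [memLp_map_measure_iff aestronglyMeasurable_id hm.aemeasurable]
    exact memLp_pi_iff.mpr h.memL2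
  · rw [← h.crossMoment_eq]
    ext i j
    simp only [covMat, hmean, crossMoment, Matrix.of_apply, Pi.zero_apply, sub_zero]
    rw [integral_map hm.aemeasurable]
    exact Measurable.aestronglyMeasurable (by fun_prop)

/-- The centred disturbance is Gaussian and independent of the past. -/
theorem indepFun_of_conditional_gaussian {Ω E : Type*} [MeasurableSpace Ω] [MeasurableSpace E]
    {μ : Measure Ω} [IsProbabilityMeasure μ] {Z : Ω → E} {W : Ω → Fin n → ℝ}
    {κ : Kernel E (Fin n → ℝ)} [IsMarkovKernel κ] {m : E → Fin n → ℝ}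
    {S : Matrix (Fin n) (Fin n) ℝ} (hZ : Measurable Z) (hW : Measurable W) (hm : Measurable m)
    (hlaw : μ.map (fun ω => (Z ω, W ω)) = μ.map Z ⊗ₘ κ) (hκ : ∀ z, HasMoments (κ z) (m z) S)
    (hG : ∀ z, IsGaussian (κ z)) :
    HasGaussianLaw (fun ω => W ω - m (Z ω)) μ ∧ IndepFun Z (fun ω => W ω - m (Z ω)) μ := by
  have : IsProbabilityMeasure (μ.map Z) := Measure.isProbabilityMeasure_map hZ.aemeasurable
  obtain ⟨ω₀⟩ : Nonempty Ω := μ.nonempty_of_neZero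
  let ν : Measure (Fin n → ℝ) := (κ (Z ω₀)).map fun w => w - m (Z ω₀)
  have hGs : ∀ z, IsGaussian ((κ z).map fun w => w - m z) := fun z => by
    have := hG z
    infer_instance
  -- All centred conditional laws are Gaussian with mean 0 and covariance S, hence equal; a
  -- conditional law that does not depend on z means independence.
  have hν : ∀ z, (κ z).map (fun w => w - m z) = ν := fun z => by
    have := hGs z
    have := hGs (Z ω₀)
    exact IsGaussian.eq_of_hasMoments (hκ z).map_sub (hκ (Z ω₀)).map_sub
  have hWm : Measurable fun ω => W ω - m (Z ω) := hW.sub (hm.comp hZ)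
  have hrect : ∀ (s : Set E) (t : Set (Fin n → ℝ)), MeasurableSet s → MeasurableSet t →
      μ (Z ⁻¹' s ∩ (fun ω => W ω - m (Z ω)) ⁻¹' t) = ν t * μ (Z ⁻¹' s) := by
    intro s t hs ht
    have hg : Measurable fun p : E × (Fin n → ℝ) => p.2 - m p.1 := by fun_prop
    have hset : MeasurableSet ((Prod.fst ⁻¹' s : Set (E × (Fin n → ℝ))) ∩
        (fun p : E × (Fin n → ℝ) => p.2 - m p.1) ⁻¹' t) := (measurable_fst hs).inter (hg ht)
    have e1 : μ (Z ⁻¹' s ∩ (fun ω => W ω - m (Z ω)) ⁻¹' t) =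
        μ.map (fun ω => (Z ω, W ω)) (Prod.fst ⁻¹' s ∩ (fun p => p.2 - m p.1) ⁻¹' t) := by
      rw [Measure.map_apply (hZ.prodMk hW) hset]; rfl
    rw [e1, hlaw, Measure.compProd_apply hset]
    have e2 : ∀ z, κ z (Prod.mk z ⁻¹' (Prod.fst ⁻¹' s ∩ (fun p => p.2 - m p.1) ⁻¹' t)) =
        s.indicator (fun _ => ν t) z := by
      intro z
      by_cases hz : z ∈ s
      · rw [Set.indicator_of_mem hz, ← hν z, Measure.map_apply (by fun_prop) ht]
        congr 1
        ext w; simp [hz]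
      · rw [Set.indicator_of_notMem hz]
        convert measure_empty (μ := κ z)
        ext w; simp [hz]
    simp only [e2]
    rw [lintegral_indicator_const hs, Measure.map_apply hZ hs]
  have hmap : μ.map (fun ω => W ω - m (Z ω)) = ν := by
    ext t ht
    have := hrect Set.univ t MeasurableSet.univ ht
    rw [Measure.map_apply hWm ht]
    simpa using this
  refine ⟨⟨hmap ▸ hGs (Z ω₀)⟩, ?_⟩
  rw [indepFun_iff_measure_inter_preimage_eq_mul]
  intro s t hs ht
  rw [hrect s t hs ht, mul_comm, ← hmap, Measure.map_apply hWm ht]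

/-- Random vectors of mean zero. -/
def MeanZero {Ω : Type*} [MeasurableSpace Ω] (μ : Measure Ω) (X : Ω → Fin n → ℝ) : Prop :=
  ∀ i, ∫ ω, X ω i ∂μ = 0

theorem MeanZero.linear {Ω : Type*} [MeasurableSpace Ω] {μ : Measure Ω} [IsProbabilityMeasure μ]
    {m k : ℕ} {X : Ω → Fin n → ℝ} {Z : Ω → Fin m → ℝ} (hX : MeanZero μ X) (hZ : MeanZero μ Z)
    (hX2 : MemL2 μ X) (hZ2 : MemL2 μ Z) (A : Matrix (Fin k) (Fin n) ℝ)
    (B : Matrix (Fin k) (Fin m) ℝ) : MeanZero μ fun ω => A *ᵥ X ω + B *ᵥ Z ω := by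
  -- The mean is the cross moment with the constant 1, so linearity of cross moments applies.
  have h1 : ∀ {m : ℕ} (Y : Ω → Fin m → ℝ), MeanZero μ Y ↔
      crossMoment μ (fun _ => (1 : Fin 1 → ℝ)) Y = 0 := by
    intro m Y
    constructor
    · intro h; ext i j; simpa [crossMoment] using h j
    · intro h i; simpa [crossMoment] using congrFun (congrFun h 0) i
  have hc : MemL2 μ fun _ => (1 : Fin 1 → ℝ) := MemL2.const _
  rw [h1] at hX hZ ⊢
  rw [crossMoment_add_right hc (hX2.mulVec A) (hZ2.mulVec B), crossMoment_mulVec_right hc hX2,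
    crossMoment_mulVec_right hc hZ2, hX, hZ, Matrix.zero_mul, Matrix.zero_mul, add_zero]

/-- Linear combinations of independent Gaussian vectors. -/
theorem hasGaussianLaw_linear {Ω : Type*} [MeasurableSpace Ω] {μ : Measure Ω}
    {m k l : ℕ} {X : Ω → Fin n → ℝ} {Z : Ω → Fin m → ℝ} (hX : HasGaussianLaw X μ)
    (hZ : HasGaussianLaw Z μ) (hXZ : IndepFun X Z μ) (A : Matrix (Fin k) (Fin n) ℝ)
    (B : Matrix (Fin k) (Fin m) ℝ) (A' : Matrix (Fin l) (Fin n) ℝ)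
    (B' : Matrix (Fin l) (Fin m) ℝ) :
    HasGaussianLaw (fun ω => (A *ᵥ X ω + B *ᵥ Z ω, A' *ᵥ X ω + B' *ᵥ Z ω)) μ := by
  let T : (Fin n → ℝ) × (Fin m → ℝ) →ₗ[ℝ] (Fin k → ℝ) × (Fin l → ℝ) :=
    ((A.mulVecLin ∘ₗ LinearMap.fst ℝ _ _) + (B.mulVecLin ∘ₗ LinearMap.snd ℝ _ _)).prod
      ((A'.mulVecLin ∘ₗ LinearMap.fst ℝ _ _) + (B'.mulVecLin ∘ₗ LinearMap.snd ℝ _ _))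
  exact (hXZ.hasGaussianLaw hX hZ).map_fun T.toContinuousLinearMap

/-! ### The Gaussian measurement update. -/

variable {nx nu ny : ℕ} {D : Data nx nu ny}

/-- The measurement update of a Gaussian error, independent of previous information `I`, with the
Kalman gain. -/
theorem gaussian_measurement_update {Ω E : Type*} [MeasurableSpace Ω] [MeasurableSpace E]
    {μ : Measure Ω} [IsProbabilityMeasure μ] {I : Ω → E} {ε : Ω → Fin nx → ℝ}
    {v : Ω → Fin ny → ℝ} (hI : Measurable I) (hε : Measurable ε) (hv : Measurable v)
    (hεG : HasGaussianLaw ε μ) (hvG : HasGaussianLaw v μ) (hεI : IndepFun I ε μ)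
    (hind : IndepFun (fun ω => (I ω, ε ω)) v μ) (hε2 : MemL2 μ ε) (hv2 : MemL2 μ v)
    (hε0 : MeanZero μ ε) (hv0 : MeanZero μ v) (hM : D.M.PosDef)
    (hvM : crossMoment μ v v = D.M) {K : Matrix (Fin nx) (Fin ny) ℝ}
    (hK : K = D.gain (crossMoment μ ε ε)) :
    HasGaussianLaw (fun ω => (1 - K * D.C) *ᵥ ε ω + (-K) *ᵥ v ω) μ ∧
    MeanZero μ (fun ω => (1 - K * D.C) *ᵥ ε ω + (-K) *ᵥ v ω) ∧
    IndepFun (fun ω => (1 - K * D.C) *ᵥ ε ω + (-K) *ᵥ v ω)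
      (fun ω => (D.C *ᵥ ε ω + v ω, I ω)) μ := by
  have hεv : IndepFun ε v μ := hind.comp measurable_snd measurable_id
  have hG := hasGaussianLaw_linear hεG hvG hεv (1 - K * D.C) (-K) D.C 1
  have hz := hε0.linear hv0 hε2 hv2 (1 - K * D.C) (-K)
  have he2 : MemL2 μ fun ω => (1 - K * D.C) *ᵥ ε ω + (-K) *ᵥ v ω := (hε2.mulVec _).add (hv2.mulVec _)
  have hn2 : MemL2 μ fun ω => D.C *ᵥ ε ω + (1 : Matrix (Fin ny) (Fin ny) ℝ) *ᵥ v ω :=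
    (hε2.mulVec _).add (hv2.mulVec _)
  have hunc : crossMoment μ ε v = 0 := by
    ext i j
    have h1 : IndepFun (fun ω => ε ω i) (fun ω => v ω j) μ :=
      hεv.comp (measurable_pi_apply i) (measurable_pi_apply j)
    simp only [crossMoment, Matrix.of_apply]
    rw [h1.integral_fun_mul_eq_mul_integral (hε2 i).aestronglyMeasurable
      (hv2 j).aestronglyMeasurable, hv0 j, mul_zero]
    rfl
  have hX := crossMoment_self_posSemidef hε2
  have hKs : K * (D.C * crossMoment μ ε ε * D.Cᵀ + D.M) = crossMoment μ ε ε * D.Cᵀ := by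
    rw [hK]
    exact Matrix.nonsing_inv_mul_cancel_right _ _ (Data.innovation_isUnit hM hX)
  have hcross := crossMoment_linear hε2 hv2 hunc (1 - K * D.C) (-K) D.C 1
  -- The orthogonality principle: K(CXCᵀ+M) = XCᵀ says exactly that the updated error is
  -- uncorrelated with the innovation.
  have hzero : (1 - K * D.C) * crossMoment μ ε ε * D.Cᵀ +
      -K * crossMoment μ v v * (1 : Matrix (Fin ny) (Fin ny) ℝ)ᵀ = 0 := by
    rw [hvM, Matrix.transpose_one, Matrix.mul_one, Matrix.sub_mul, Matrix.sub_mul, Matrix.one_mul,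
      ← hKs, Matrix.mul_add, Matrix.neg_mul]
    simp only [Matrix.mul_assoc]
    abel
  rw [hzero] at hcross
  have hiν : IndepFun (fun ω => (1 - K * D.C) *ᵥ ε ω + (-K) *ᵥ v ω)
      (fun ω => D.C *ᵥ ε ω + (1 : Matrix (Fin ny) (Fin ny) ℝ) *ᵥ v ω) μ := by
    refine HasGaussianLaw.indepFun_of_covariance_eval
      (X := fun i ω => ((1 - K * D.C) *ᵥ ε ω + (-K) *ᵥ v ω : Fin nx → ℝ) i)
      (Y := fun j ω => (D.C *ᵥ ε ω + (1 : Matrix (Fin ny) (Fin ny) ℝ) *ᵥ v ω : Fin ny → ℝ) j) hG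
      fun i j => ?_
    rw [covariance_eq_sub (he2 i) (hn2 j), hz i, zero_mul, sub_zero]
    exact congrFun (congrFun hcross i) j
  simp only [Matrix.one_mulVec] at hiν hG
  refine ⟨hG.fst, hz, ?_⟩
  have hme : Measurable fun ω => (1 - K * D.C) *ᵥ ε ω + (-K) *ᵥ v ω :=
    (measurable_mulVec hε _).add (measurable_mulVec hv _)
  have hmn : Measurable fun ω => D.C *ᵥ ε ω + v ω := (measurable_mulVec hε _).add hv
  have h3 : IndepFun I (fun ω => (ε ω, v ω)) μ := indepFun_prodMk_of_prodMk hI hε hv hεI hind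
  have hlin : Measurable fun p : (Fin nx → ℝ) × (Fin ny → ℝ) =>
      ((1 - K * D.C) *ᵥ p.1 + (-K) *ᵥ p.2, D.C *ᵥ p.1 + p.2) :=
    ((measurable_mulVec measurable_fst _).add (measurable_mulVec measurable_snd _)).prodMk
      ((measurable_mulVec measurable_fst _).add measurable_snd)
  -- The error is independent of the innovation, and the pair is independent of I; so the error is
  -- independent of innovation and I jointly.
  exact indepFun_prodMk_of_prodMk hme hmn hI hiν (h3.comp measurable_id hlin).symm

end Gaussian

/-! ### The state estimate is a filter -/

section Estimates

variable {nx nu ny : ℕ} {Ω : Type*} [MeasurableSpace Ω] {D : Data nx nu ny} {μ : Measure Ω}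
  {pol : ∀ t, Info ny nu t → Fin nu → ℝ} {γ : ∀ t, Kernel (Info ny nu t) (Fin nx → ℝ)}
  {x w : ℕ → Ω → Fin nx → ℝ} {y v : ℕ → Ω → Fin ny → ℝ} {u : ℕ → Ω → Fin nu → ℝ}
  {P S : Matrix (Fin nx) (Fin nx) ℝ} {X : ℕ → Matrix (Fin nx) (Fin nx) ℝ}
  {xbar : ∀ t, Info ny nu t → Fin nx → ℝ}

/-- With the Kalman gains the Joseph form collapses to the Riccati update, so the actual error
covariances are those that the filter computes. -/
theorem Data.filterCov_eq_covUpdate (hM : D.M.PosDef) (hM0 : D.M0.PosSemidef)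
    (hS : S.PosSemidef) (t : ℕ) :
    (D.predCov (D.filterCov S) S t).PosSemidef ∧
      D.filterCov S t = D.covUpdate (D.predCov (D.filterCov S) S t) := by
  induction t with
  | zero => exact ⟨hM0, rfl⟩
  | succ t ih =>
    obtain ⟨h1, h2⟩ := ih
    have h3 : D.joseph (D.filterCov S t * D.Cᵀ * D.M⁻¹) (D.predCov (D.filterCov S) S t) =
        D.filterCov S t := by
      rw [h2, Data.covUpdate_gain hM h1, Data.joseph_gain hM h1]
    have h4 : D.predCov (D.filterCov S) S (t + 1) = D.A * D.filterCov S t * D.Aᵀ + S := by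
      rw [Data.predCov, h3]
    rw [h4]
    exact ⟨Data.predict_posSemidef hS (h2 ▸ Data.covUpdate_posSemidef hM h1), rfl⟩

theorem Data.filterCov_gain (hM : D.M.PosDef) (hM0 : D.M0.PosSemidef) (hS : S.PosSemidef)
    (t : ℕ) : D.filterCov S t * D.Cᵀ * D.M⁻¹ = D.gain (D.predCov (D.filterCov S) S t) := by
  obtain ⟨h1, h2⟩ := Data.filterCov_eq_covUpdate hM hM0 hS t
  rw [h2, Data.covUpdate_gain hM h1]

theorem Data.errCov_filterCov (hM : D.M.PosDef) (hM0 : D.M0.PosSemidef) (hS : S.PosSemidef) :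
    D.errCov (D.filterCov S) S = D.filterCov S := by
  funext t
  obtain ⟨h1, h2⟩ := Data.filterCov_eq_covUpdate hM hM0 hS t
  rw [Data.errCov, Data.filterCov_gain hM hM0 hS, Data.joseph_gain hM h1, ← h2]

theorem control_ae_eq (h : IsClosedLoop D μ pol γ x y u w v)
    (hpair : D.IsStationaryPair P S xbar pol γ) (t : ℕ)
    (hae : (fun ω => xbar t (infoProc y u t ω)) =ᵐ[μ] estProc D P X y u t) :
    u t =ᵐ[μ] fun ω => D.Kss P *ᵥ estProc D P X y u t ω + D.Lss P := by
  filter_upwards [hae] with ω hω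
  rw [h.control, hpair.control, ← hω]

variable [IsProbabilityMeasure μ]

/-- The estimation error is already square-integrable; by induction so are the state, hence the
estimate, the control and the mean of the disturbance, hence the next state. -/
theorem IsClosedLoop.state_memL2 (h : IsClosedLoop D μ pol γ x y u w v)
    (hpair : D.IsStationaryPair P S xbar pol γ) (t : ℕ) (hxm : ∀ s < t, Measurable (xbar s))
    (hae : ∀ s < t, (fun ω => xbar s (infoProc y u s ω)) =ᵐ[μ] estProc D P X y u s) :
    MemL2 μ (x t) := by
  induction t with
  | zero =>
    have hm := h.initial
    exact fun i => (hm.memLp_apply i).comp_measurePreserving ⟨h.measurable_x0, rfl⟩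
  | succ t ih =>
    have hxm' : ∀ s < t, Measurable (xbar s) := fun s hs => hxm s (hs.trans t.lt_succ_self)
    have hae' : ∀ s < t, (fun ω => xbar s (infoProc y u s ω)) =ᵐ[μ] estProc D P X y u s :=
      fun s hs => hae s (hs.trans t.lt_succ_self)
    have hx := ih hxm' hae'
    have he := (h.estErr_moments hpair t hxm' hae').1
    have hd := (h.distErr_moments hpair t (hxm t t.lt_succ_self) (hae t t.lt_succ_self)).1
    have hest : MemL2 μ (estProc D P X y u t) :=
      (hx.sub he).congr (ae_of_all _ fun ω => sub_sub_cancel _ _)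
    have hu := ((hest.mulVec (D.Kss P)).add (MemL2.const (D.Lss P))).congr
      (control_ae_eq h hpair t (hae t t.lt_succ_self)).symm
    refine (((hx.mulVec D.A).add (hu.mulVec D.B)).add
      (hd.add ((hest.mulVec (D.Hss P)).add (MemL2.const (D.Gss P))))).congr
      (ae_of_all _ fun ω => ?_)
    simp only [h.state, distErr, sub_add_cancel]

theorem IsClosedLoop.distErr_gaussian (h : IsClosedLoop D μ pol γ x y u w v)
    (hpair : D.IsStationaryPair P S xbar pol γ) (hγ : ∀ t I, IsGaussian (γ t I)) (t : ℕ)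
    (hxm : Measurable (xbar t))
    (hae : (fun ω => xbar t (infoProc y u t ω)) =ᵐ[μ] estProc D P X y u t) :
    HasGaussianLaw (distErr D P X y u w t) μ ∧
      IndepFun (pastW x w v t) (distErr D P X y u w t) μ := by
  obtain ⟨φ, hφ, hI, hlaw⟩ := h.exists_joint_law t
  have := h.markov t
  have hm : Measurable fun z => D.Hss P *ᵥ xbar t (φ z) + D.Gss P :=
    (measurable_mulVec (hxm.comp hφ) _).add measurable_const
  have hκ : ∀ z, HasMoments ((γ t).comap φ hφ z) (D.Hss P *ᵥ xbar t (φ z) + D.Gss P) S :=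
    fun z => by rw [Kernel.comap_apply]; exact hpair.moments t (φ z)
  have hG : ∀ z, IsGaussian ((γ t).comap φ hφ z) := fun z => by
    rw [Kernel.comap_apply]; exact hγ t (φ z)
  have hcongr : (fun ω => w t ω - (D.Hss P *ᵥ xbar t (φ (pastW x w v t ω)) + D.Gss P)) =ᵐ[μ]
      distErr D P X y u w t := by
    filter_upwards [hae] with ω hω
    rw [distErr, ← hω, hI]
    rfl
  obtain ⟨h1, h2⟩ := indepFun_of_conditional_gaussian (h.measurable_pastW t) (h.measurable_w t)
    hm hlaw hκ hG
  exact ⟨h1.congr hcongr, h2.congr (ae_eq_refl _) hcongr⟩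

/-- One step of the Gaussian filter: if the prediction error is Gaussian and independent of the
earlier information `I`, and the information vector is a function of `I` and the innovation, then
the estimate is the conditional expectation. -/
theorem IsClosedLoop.gaussian_step (h : IsClosedLoop D μ pol γ x y u w v)
    (hM : D.M.PosDef) (t : ℕ) {E : Type*} [MeasurableSpace E] {I : Ω → E}
    (hI : Measurable[sigV x w v t] I)
    (hεG : HasGaussianLaw (predErr D P X x y u w t) μ)
    (hεI : IndepFun I (predErr D P X x y u w t) μ)
    (hε2 : MemL2 μ (predErr D P X x y u w t)) (hε0 : MeanZero μ (predErr D P X x y u w t))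
    (hK : X t * D.Cᵀ * D.M⁻¹ =
      D.gain (crossMoment μ (predErr D P X x y u w t) (predErr D P X x y u w t)))
    (hx : MemL2 μ (x t))
    (hinfo : Measurable[MeasurableSpace.comap
      (fun ω => (D.C *ᵥ predErr D P X x y u w t ω + v t ω, I ω)) inferInstance]
      (infoProc y u t)) :
    HasGaussianLaw (fun ω => x t ω - estProc D P X y u t ω) μ ∧
    MeanZero μ (fun ω => x t ω - estProc D P X y u t ω) ∧
    IndepFun (fun ω => x t ω - estProc D P X y u t ω) (infoProc y u t) μ ∧
    μ[x t | MeasurableSpace.comap (infoProc y u t) inferInstance] =ᵐ[μ] estProc D P X y u t := by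
  have hεm := h.measurable_predErr (P := P) (X := X) t
  have hle := (h.measurable_pastV t).comap_le
  have hpast : IndepFun (fun ω => (I ω, predErr D P X x y u w t ω)) (v t) μ :=
    indep_of_indep_of_le_left (h.noise_indep t).symm (hI.prodMk hεm).comap_le
  have hvG : HasGaussianLaw (v t) μ := ⟨h.noise_gaussian t⟩
  have hv0 : MeanZero μ (v t) := fun j => by
    have := (h.noise_moments t).integral_apply j
    rwa [integral_map (h.measurable_v t).aemeasurable
      (measurable_pi_apply j).aestronglyMeasurable] at this
  obtain ⟨g1, g2, g3⟩ := gaussian_measurement_update (D := D) (hI.mono hle le_rfl)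
    (hεm.mono hle le_rfl) (h.measurable_v t) hεG hvG hεI hpast hε2 (h.noise_memL2 t) hε0 hv0 hM
    (h.noise_crossMoment t) hK
  simp only [← h.state_sub_estProc] at g1 g2 g3
  have g4 : IndepFun (fun ω => x t ω - estProc D P X y u t ω) (infoProc y u t) μ :=
    indep_of_indep_of_le_right g3 hinfo.comap_le
  refine ⟨g1, g2, g4, ?_⟩
  have hem : Measurable fun ω => x t ω - estProc D P X y u t ω :=
    (h.measurable_estErr t).mono (h.measurable_pastW t).comap_le le_rfl
  have hIle : MeasurableSpace.comap (infoProc y u t) inferInstance ≤ ‹MeasurableSpace Ω› :=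
    (h.measurable_infoProc t).comap_le
  have hei := g1.integrable
  have hxi : Integrable (x t) μ :=
    Integrable.of_eval fun i => (hx i).integrable one_le_two
  have hesti : Integrable (estProc D P X y u t) μ := by
    have := hxi.sub hei
    refine this.congr (ae_of_all _ fun ω => ?_)
    simp
  have hdecomp : x t = (fun ω => x t ω - estProc D P X y u t ω) + estProc D P X y u t := by
    funext ω; simp
  have hestm : StronglyMeasurable[MeasurableSpace.comap (infoProc y u t) inferInstance]
      (estProc D P X y u t) :=
    ((D.measurable_filterEst P X t).comp (comap_measurable _)).stronglyMeasurable
  -- Split the state into error and estimate: the error is independent of the information with mean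
  -- zero, the estimate is a function of the information.
  have c1 := condExp_add hei hesti (MeasurableSpace.comap (infoProc y u t) inferInstance)
  rw [← hdecomp] at c1
  have c2 := condExp_indep_eq hem.comap_le hIle
    (comap_measurable fun ω => x t ω - estProc D P X y u t ω).stronglyMeasurable g4
  have c3 := condExp_of_stronglyMeasurable hIle hestm hesti
  have c0 : ∫ ω, (x t ω - estProc D P X y u t ω) ∂μ = 0 := by
    funext i
    rw [eval_integral fun j => (hei.eval j)]
    exact g2 i
  filter_upwards [c1, c2] with ω h1 h2
  rw [h1, Pi.add_apply, h2, c3, c0, zero_add]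

/-- The conditional expectation is the Kalman filter in the Gaussian case. -/
theorem IsClosedLoop.condExp_eq_filterEst (h : IsClosedLoop D μ pol γ x y u w v)
    (hpair : D.IsStationaryPair P S xbar pol γ) (hM : D.M.PosDef) (hM0 : D.M0.PosSemidef)
    (hS : S.PosSemidef) (hx0 : IsGaussian (μ.map (x 0))) (hγ : ∀ t I, IsGaussian (γ t I))
    (hxm : ∀ t, Measurable (xbar t))
    (hxbar : ∀ t, (fun ω => xbar t (infoProc y u t ω))
        =ᵐ[μ] μ[x t | MeasurableSpace.comap (infoProc y u t) inferInstance]) (t : ℕ) :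
    (fun ω => xbar t (infoProc y u t ω)) =ᵐ[μ] estProc D P (D.filterCov S) y u t := by
  -- The claim is strengthened for the induction: besides the formula, the error must remain
  -- Gaussian, centred and independent of the information.
  suffices H : ∀ t, HasGaussianLaw (fun ω => x t ω - estProc D P (D.filterCov S) y u t ω) μ ∧
      MeanZero μ (fun ω => x t ω - estProc D P (D.filterCov S) y u t ω) ∧
      IndepFun (fun ω => x t ω - estProc D P (D.filterCov S) y u t ω) (infoProc y u t) μ ∧
      μ[x t | MeasurableSpace.comap (infoProc y u t) inferInstance]
        =ᵐ[μ] estProc D P (D.filterCov S) y u t from (hxbar t).trans (H t).2.2.2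
  intro t
  induction t using Nat.strong_induction_on with
  | _ t ih =>
    have hae : ∀ s < t, (fun ω => xbar s (infoProc y u s ω)) =ᵐ[μ]
        estProc D P (D.filterCov S) y u s := fun s hs => (hxbar s).trans (ih s hs).2.2.2
    obtain ⟨hε2, hεc⟩ := h.predErr_moments hpair t (fun s _ => hxm s) hae
    have hx := h.state_memL2 hpair t (fun s _ => hxm s) hae
    have hK : D.filterCov S t * D.Cᵀ * D.M⁻¹ =
        D.gain (crossMoment μ (predErr D P (D.filterCov S) x y u w t)
          (predErr D P (D.filterCov S) x y u w t)) := by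
      rw [hεc, Data.filterCov_gain hM hM0 hS]
    cases t with
    | zero =>
      have hmeas : Measurable fun p : Fin nx → ℝ => p - D.m0 := by fun_prop
      have hεG : HasGaussianLaw (predErr D P (D.filterCov S) x y u w 0) μ := by
        refine ⟨?_⟩
        have : IsGaussian ((μ.map (x 0)).map fun p => p - D.m0) := inferInstance
        rwa [Measure.map_map hmeas h.measurable_x0] at this
      have hε0 : MeanZero μ (predErr D P (D.filterCov S) x y u w 0) := fun i => by
        have := h.initial.integral_sub i
        rwa [integral_map h.measurable_x0.aemeasurable
          (Measurable.aestronglyMeasurable (by fun_prop))] at this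
      -- At time zero there is no earlier information.
      refine h.gaussian_step hM 0 (I := fun _ => ()) measurable_const hεG
        (indepFun_const_left _ _) hε2 hε0 hK hx (measurable_infoProc_zero ?_)
      have hy : y 0 = fun ω => (D.C *ᵥ predErr D P (D.filterCov S) x y u w 0 ω + v 0 ω)
          + D.C *ᵥ D.m0 := by
        funext ω
        rw [h.output, predErr, Matrix.mulVec_sub]
        abel
      rw [hy]
      exact (measurable_fst.comp (comap_measurable fun ω =>
        (D.C *ᵥ predErr D P (D.filterCov S) x y u w 0 ω + v 0 ω, ()))).add_const _
    | succ t =>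
      obtain ⟨eG, e0, eI, -⟩ := ih t t.lt_succ_self
      have hxm' := hxm t
      have hae' := hae t t.lt_succ_self
      have hemoments := h.estErr_moments hpair t (fun s _ => hxm s)
        (fun s hs => hae s (hs.trans t.lt_succ_self))
      obtain ⟨d1, -, d3⟩ := h.distErr_moments hpair t hxm' hae'
      obtain ⟨dG, dI⟩ := h.distErr_gaussian hpair hγ t hxm' hae'
      have hd0 : MeanZero μ (distErr D P (D.filterCov S) y u w t) := fun i => by
        have := congrFun (congrFun (d3 (X' := fun _ => (1 : Fin 1 → ℝ)) measurable_const
          (MemL2.const _)) 0) i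
        simpa [crossMoment] using this
      have hrw : predErr D P (D.filterCov S) x y u w (t + 1) = fun ω =>
          D.A *ᵥ (x t ω - estProc D P (D.filterCov S) y u t ω)
            + (1 : Matrix (Fin nx) (Fin nx) ℝ) *ᵥ distErr D P (D.filterCov S) y u w t ω := by
        funext ω; rw [Matrix.one_mulVec, predErr]
      have hWle := (h.measurable_pastW t).comap_le
      have hIm := (h.adapted t).2
      have hem := h.measurable_estErr (P := P) (X := D.filterCov S) t
      -- The error is independent of the information, and the centred disturbance is independent of
      -- both, since both belong to the past of w_t.
      have hIe : IndepFun (infoProc y u t) (fun ω =>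
          (x t ω - estProc D P (D.filterCov S) y u t ω, distErr D P (D.filterCov S) y u w t ω)) μ :=
        indepFun_prodMk_of_prodMk (hIm.mono hWle le_rfl) (hem.mono hWle le_rfl)
          ((h.measurable_distErr t).mono (h.measurable_pastV (t + 1)).comap_le le_rfl) eI.symm
          (indep_of_indep_of_le_left dI (hIm.prodMk hem).comap_le)
      have hed : IndepFun (fun ω => x t ω - estProc D P (D.filterCov S) y u t ω)
          (distErr D P (D.filterCov S) y u w t) μ :=
        indep_of_indep_of_le_left dI hem.comap_le
      have hlin : Measurable fun p : (Fin nx → ℝ) × (Fin nx → ℝ) => D.A *ᵥ p.1 + p.2 :=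
        (measurable_mulVec measurable_fst _).add measurable_snd
      refine h.gaussian_step hM (t + 1) (hIm.mono (sigW_le_sigV_succ t) le_rfl) ?_ ?_ hε2 ?_ hK hx
        ?_
      · rw [hrw]
        exact (hasGaussianLaw_linear eG dG hed D.A 1 D.A 1).fst
      · exact hIe.comp measurable_id hlin
      · rw [hrw]
        exact e0.linear hd0 hemoments.1 d1 _ _
      -- The new information is recovered from the innovation and the old information: u_t is a
      -- function of I_t, and y_{t+1} is the innovation plus C times the prediction.
      · let ψ : Ω → (Fin ny → ℝ) × Info ny nu t := fun ω =>
          (D.C *ᵥ predErr D P (D.filterCov S) x y u w (t + 1) ω + v (t + 1) ω, infoProc y u t ω)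
        have hψ : Measurable[MeasurableSpace.comap ψ inferInstance] ψ := comap_measurable ψ
        have hI' : Measurable[MeasurableSpace.comap ψ inferInstance] (infoProc y u t) :=
          measurable_snd.comp hψ
        have hu' : Measurable[MeasurableSpace.comap ψ inferInstance] (u t) := by
          have : u t = fun ω => pol t (infoProc y u t ω) := funext (h.control t)
          rw [this]
          exact (h.measurable_pol t).comp hI'
        have hest' : Measurable[MeasurableSpace.comap ψ inferInstance]
            (estProc D P (D.filterCov S) y u t) :=
          (D.measurable_filterEst P (D.filterCov S) t).comp hI'
        refine measurable_infoProc_succ hI' ?_ hu'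
        have hy : y (t + 1) = fun ω => (ψ ω).1 + D.C *ᵥ (D.A *ᵥ estProc D P (D.filterCov S) y u t ω
            + D.B *ᵥ u t ω
            + (D.Hss P *ᵥ estProc D P (D.filterCov S) y u t ω + D.Gss P)) := by
          funext ω
          change _ = (D.C *ᵥ predErr D P (D.filterCov S) x y u w (t + 1) ω + v (t + 1) ω) + _
          rw [h.output, h.state, predErr, distErr]
          simp only [Matrix.mulVec_add, Matrix.mulVec_sub]
          abel
        rw [hy]
        exact (measurable_fst.comp hψ).add (measurable_mulVec
          (((measurable_mulVec hest' _).add (measurable_mulVec hu' _)).add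
            ((measurable_mulVec hest' _).add measurable_const)) _)

/-- In each of its senses, the state estimate is produced by a filter whose error covariance
converges to the stationary one. -/
theorem IsClosedLoop.exists_filter (h : IsClosedLoop D μ pol γ x y u w v)
    (hpair : D.IsStationaryPair P S xbar pol γ) (hM : D.M.PosDef) (hS : S.PosSemidef)
    (hstab : Stabilizable D.A (msqrt S)) {Xs : Matrix (Fin nx) (Fin nx) ℝ}
    (hXs : Xs.PosSemidef) (hfix : Xs = D.riccati S Xs)
    (hest : D.IsStateEstimate P μ γ x y u Xs S xbar) :
    (∀ t, Measurable (xbar t)) ∧ ∃ X : ℕ → Matrix (Fin nx) (Fin nx) ℝ,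
      (∀ t, (fun ω => xbar t (infoProc y u t ω)) =ᵐ[μ] estProc D P X y u t) ∧
      Tendsto (D.errCov X S) atTop (𝓝 Xs) := by
  have hM0 := h.initial.posSemidef
  have hlim := Data.tendsto_filterCov hM hS hstab hM0 hXs hfix
  rcases hest with rfl | rfl | ⟨hx0, hγ, hx⟩
  · refine ⟨D.measurable_filterEst P _, D.filterCov S, fun t => ae_eq_refl _, ?_⟩
    rwa [Data.errCov_filterCov hM hM0 hS]
  · refine ⟨D.measurable_filterEst P _, fun _ => Xs, fun t => ae_eq_refl _, ?_⟩
    have hp := Data.predict_posSemidef (D := D) hS hXs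
    have hgain : Xs * D.Cᵀ * D.M⁻¹ = D.gain (D.A * Xs * D.Aᵀ + S) := by
      conv_lhs => rw [hfix]
      exact Data.covUpdate_gain hM hp
    have hj : Xs = D.joseph (Xs * D.Cᵀ * D.M⁻¹) (D.A * Xs * D.Aᵀ + S) := by
      rw [hgain, Data.joseph_gain hM hp]; exact hfix
    -- With a constant gain, `Data.errCov` is the affine recursion itself, started from M0; it
    -- converges from any start.
    exact Data.tendsto_of_constant_gain (Data.isStable_filter hM hS hstab hXs hj) hj fun t => rfl
  · refine ⟨fun t => (hx t).1, D.filterCov S, fun t => ?_, ?_⟩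
    · exact h.condExp_eq_filterEst hpair hM hM0 hS hx0 hγ (fun t => (hx t).1)
        (fun t => (hx t).2) t
    · rwa [Data.errCov_filterCov hM hM0 hS]

end Estimates

/-! ### The Gelbrich distance -/

section Gelbrich

variable {n : ℕ}

/-- Here T = (ESE)^{1/2}. With R = √S, an approximate polar factor U = (T+δ)⁻¹ER is a contraction,
and ‖UR-E‖² ≥ 0 in the Frobenius norm gives 2 Tr(URE) ≤ Tr(USUᵀ) + Tr E² ≤ Tr S + Tr E², where
Tr(URE) ≥ Tr T - δn. Then δ → 0; the shift is there because T may be singular. -/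
theorem two_trace_le_of_mul_self_eq {E S T : Matrix (Fin n) (Fin n) ℝ} (hE : E.PosSemidef)
    (hS : S.PosSemidef) (hT : T.PosSemidef) (h : T * T = E * S * E) :
    2 * T.trace ≤ S.trace + (E * E).trace := by
  have key : ∀ δ : ℝ, 0 < δ → 2 * T.trace ≤ S.trace + (E * E).trace + δ * (2 * n) := by
    intro δ hδ
    have h1pd : (δ • (1 : Matrix (Fin n) (Fin n) ℝ)).PosDef := Matrix.PosDef.one.smul hδ
    set W := T + δ • (1 : Matrix (Fin n) (Fin n) ℝ) with hW
    have hWpd : W.PosDef := Matrix.PosDef.posSemidef_add hT h1pd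
    have hWu : IsUnit W.det := (Matrix.isUnit_iff_isUnit_det _).mp hWpd.isUnit
    have hWipd : W⁻¹.PosSemidef := hWpd.inv.posSemidef
    have hWit := PosSemidef.transpose_eq hWipd
    have hEt := PosSemidef.transpose_eq hE
    set R := msqrt S
    have hRt : Rᵀ = R := msqrt_transpose S
    have hRR : R * R = S := msqrt_mul_self hS
    set U := W⁻¹ * E * R with hU
    have hUt : Uᵀ = R * E * W⁻¹ := by
      rw [hU, Matrix.transpose_mul, Matrix.transpose_mul, hRt, hEt, hWit, Matrix.mul_assoc]
    have hT2 : T * T = W * W - (2 * δ) • W + (δ * δ) • (1 : Matrix (Fin n) (Fin n) ℝ) := by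
      have : T = W - δ • (1 : Matrix (Fin n) (Fin n) ℝ) := by rw [hW, add_sub_cancel_right]
      rw [this]
      simp only [Matrix.sub_mul, Matrix.mul_sub, Matrix.smul_mul, Matrix.mul_smul, Matrix.one_mul,
        Matrix.mul_one]
      module
    have hWW : W⁻¹ * W = 1 := Matrix.nonsing_inv_mul _ hWu
    have hWW' : W * W⁻¹ = 1 := Matrix.mul_nonsing_inv _ hWu
    have hUU : 1 - U * Uᵀ = W⁻¹ * ((2 * δ) • T + (δ * δ) • (1 : Matrix (Fin n) (Fin n) ℝ)) * W⁻¹ᵀ := by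
      have e1 : U * Uᵀ = W⁻¹ * (T * T) * W⁻¹ := by
        rw [h, hUt, hU, ← hRR]; simp only [Matrix.mul_assoc]
      have e2 : (2 * δ) • T + (δ * δ) • (1 : Matrix (Fin n) (Fin n) ℝ) = W * W - T * T := by
        rw [hT2, hW]
        simp only [smul_add, smul_smul, two_mul, add_smul, add_mul]
        abel
      rw [e1, e2, hWit, Matrix.mul_sub, Matrix.sub_mul, ← Matrix.mul_assoc W⁻¹ W W, hWW,
        Matrix.one_mul, hWW']
    have hpsd1 : (1 - U * Uᵀ).PosSemidef := by
      rw [hUU]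
      exact PosSemidef.conj ((hT.smul (by positivity)).add
        (Matrix.PosSemidef.one.smul (by positivity))) _
    have hpsd2 : (1 - Uᵀ * U).PosSemidef := by
      -- This identity passes from UUᵀ ≤ 1 to UᵀU ≤ 1 without singular values.
      have e : 1 - Uᵀ * U = (1 - Uᵀ * U)ᵀ * (1 - Uᵀ * U) + Uᵀ * (1 - U * Uᵀ) * Uᵀᵀ := by
        simp only [Matrix.transpose_sub, Matrix.transpose_one, Matrix.transpose_mul,
          Matrix.transpose_transpose]
        noncomm_ring
      rw [e]
      refine Matrix.PosSemidef.add ?_ (PosSemidef.conj hpsd1 _)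
      have := Matrix.posSemidef_conjTranspose_mul_self (1 - Uᵀ * U)
      rwa [Matrix.conjTranspose_eq_transpose_of_trivial] at this
    have t1 : 0 ≤ S.trace - (U * S * Uᵀ).trace := by
      have := (PosSemidef.conj hpsd2 R).trace_nonneg
      rw [hRt, Matrix.mul_sub, Matrix.sub_mul, Matrix.mul_one, hRR, Matrix.trace_sub] at this
      have e : (R * (Uᵀ * U) * R).trace = (U * S * Uᵀ).trace := by
        rw [← Matrix.mul_assoc, Matrix.mul_assoc (R * Uᵀ), Matrix.trace_mul_comm, ← hRR]
        simp only [Matrix.mul_assoc]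
      rwa [e] at this
    have t2 : 0 ≤ ((U * R - E) * (U * R - E)ᵀ).trace := by
      have := (Matrix.posSemidef_self_mul_conjTranspose (U * R - E)).trace_nonneg
      rwa [Matrix.conjTranspose_eq_transpose_of_trivial] at this
    have e3 : U * R * E = W - (2 * δ) • (1 : Matrix (Fin n) (Fin n) ℝ) + (δ * δ) • W⁻¹ := by
      have : U * R * E = W⁻¹ * (T * T) := by
        rw [h, hU, ← hRR]; simp only [Matrix.mul_assoc]
      rw [this, hT2, Matrix.mul_add, Matrix.mul_sub, ← Matrix.mul_assoc, hWW, Matrix.one_mul,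
        Matrix.mul_smul, hWW, Matrix.mul_smul, Matrix.mul_one]
    have t3 : ((U * R - E) * (U * R - E)ᵀ).trace =
        (U * S * Uᵀ).trace - 2 * (U * R * E).trace + (E * E).trace := by
      have e4 : (E * (U * R)ᵀ).trace = (U * R * E).trace := by
        rw [← Matrix.trace_transpose, Matrix.transpose_mul, Matrix.transpose_transpose, hEt]
      have e5 : U * R * (U * R)ᵀ = U * S * Uᵀ := by
        rw [Matrix.transpose_mul, hRt, ← hRR]; simp only [Matrix.mul_assoc]
      rw [Matrix.transpose_sub, Matrix.sub_mul, Matrix.mul_sub, Matrix.mul_sub, hEt, e5]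
      simp only [Matrix.trace_sub, e4]
      ring
    have t4 : (U * R * E).trace = T.trace - δ * n + δ * δ * (W⁻¹).trace := by
      rw [e3, hW]
      simp only [Matrix.trace_add, Matrix.trace_sub, Matrix.trace_smul, Matrix.trace_one,
        smul_eq_mul, Fintype.card_fin]
      ring
    have t5 : 0 ≤ δ * δ * (W⁻¹).trace := mul_nonneg (by positivity) hWipd.trace_nonneg
    linarith
  refine le_of_forall_pos_le_add fun ε hε => ?_
  -- The `+ 1` keeps the denominator positive when n = 0.
  refine (key (ε / (2 * n + 1)) (by positivity)).trans (add_le_add_right ?_ _)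
  rw [div_mul_eq_mul_div, div_le_iff₀ (by positivity)]
  nlinarith

theorem buresSq_nonneg {S S' : Matrix (Fin n) (Fin n) ℝ} (hS : S.PosSemidef)
    (hS' : S'.PosSemidef) : 0 ≤ buresSq S S' := by
  have hE := msqrt_posSemidef S'
  have hESE : (msqrt S' * S * msqrt S').PosSemidef := by
    have := PosSemidef.conj hS (msqrt S')
    rwa [msqrt_transpose] at this
  have h := two_trace_le_of_mul_self_eq hE hS (msqrt_posSemidef _) (msqrt_mul_self hESE)
  rw [msqrt_mul_self hS'] at h
  rw [buresSq, Matrix.trace_sub, Matrix.trace_add, Matrix.trace_smul, smul_eq_mul]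
  linarith

/-- `Real.sqrt` is zero on negative arguments, so undoing it needs a nonnegative radicand, supplied
by `buresSq_nonneg`. -/
theorem gelbrich_sq {P P' : Measure (Fin n → ℝ)} {m m' : Fin n → ℝ}
    {S S' : Matrix (Fin n) (Fin n) ℝ} (h : HasMoments P m S) (h' : HasMoments P' m' S') :
    gelbrich P P' ^ 2 = (m - m') ⬝ᵥ (m - m') + buresSq S S' := by
  rw [gelbrich, h.mean_eq, h.cov_eq, h'.mean_eq, h'.cov_eq, Real.sq_sqrt]
  have h1 : 0 ≤ (m - m') ⬝ᵥ (m - m') := Finset.sum_nonneg fun i _ => mul_self_nonneg _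
  exact add_nonneg h1 (buresSq_nonneg h.posSemidef h'.posSemidef)

end Gelbrich

/-! ### Mean-square stability -/

section MeanSquare

variable {n : ℕ}

/-- The squared Frobenius norm. -/
def frobSq {m : ℕ} (A : Matrix (Fin m) (Fin n) ℝ) : ℝ := ∑ i, ∑ j, A i j ^ 2

theorem frobSq_nonneg {m : ℕ} (A : Matrix (Fin m) (Fin n) ℝ) : 0 ≤ frobSq A :=
  Finset.sum_nonneg fun _ _ => Finset.sum_nonneg fun _ _ => sq_nonneg _

theorem dotProduct_self_nonneg' (v : Fin n → ℝ) : 0 ≤ v ⬝ᵥ v :=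
  Finset.sum_nonneg fun _ _ => mul_self_nonneg _

theorem mulVec_dotProduct_self_le {m : ℕ} (A : Matrix (Fin m) (Fin n) ℝ) (v : Fin n → ℝ) :
    (A *ᵥ v) ⬝ᵥ (A *ᵥ v) ≤ frobSq A * (v ⬝ᵥ v) := by
  rw [frobSq, Finset.sum_mul]
  refine Finset.sum_le_sum fun i _ => ?_
  have := Finset.sum_mul_sq_le_sq_mul_sq Finset.univ (fun j => A i j) v
  simpa only [sq, dotProduct, Matrix.mulVec] using this

/-- Take the finite sum Z = ∑_{k<N} (F^k)ᵀF^k with N ≥ 1 so large that the squared Frobenius norm of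
F^N is at most 1/2. Applying F telescopes: the form drops by |v|² - |F^N v|² ≥ |v|²/2, a fixed
fraction of vᵀZv. -/
theorem IsStable.exists_lyapunov {F : Matrix (Fin n) (Fin n) ℝ} (hF : IsStable F) :
    ∃ Z : Matrix (Fin n) (Fin n) ℝ, Z.PosSemidef ∧ ∃ ρ : ℝ, 0 ≤ ρ ∧ ρ < 1 ∧
      ∀ v : Fin n → ℝ, v ⬝ᵥ v ≤ v ⬝ᵥ (Z *ᵥ v) ∧
        (F *ᵥ v) ⬝ᵥ (Z *ᵥ (F *ᵥ v)) ≤ ρ * (v ⬝ᵥ (Z *ᵥ v)) := by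
  have hfrob : Tendsto (fun k : ℕ => frobSq (F ^ k)) atTop (𝓝 0) := by
    have hc : Continuous fun A : Matrix (Fin n) (Fin n) ℝ => frobSq A := by
      unfold frobSq; fun_prop
    have := (hc.tendsto 0).comp hF.tendsto_pow
    simpa [frobSq, Function.comp_def] using this
  obtain ⟨N, hN, hN1⟩ := ((hfrob.eventually_le_const (show (0 : ℝ) < 1 / 2 by norm_num)).and
    (eventually_ge_atTop 1)).exists
  have hq : ∀ v : Fin n → ℝ, v ⬝ᵥ ((∑ k ∈ Finset.range N, (F ^ k)ᵀ * F ^ k) *ᵥ v) =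
      ∑ k ∈ Finset.range N, (F ^ k *ᵥ v) ⬝ᵥ (F ^ k *ᵥ v) := by
    intro v
    rw [Matrix.sum_mulVec, dotProduct_sum]
    refine Finset.sum_congr rfl fun k _ => ?_
    rw [← Matrix.mulVec_mulVec, dotProduct_mulVec_transpose, Matrix.transpose_transpose]
  set κ : ℝ := ∑ k ∈ Finset.range N, frobSq (F ^ k) with hκ
  have hκ0 : 0 ≤ κ := Finset.sum_nonneg fun k _ => frobSq_nonneg _
  -- The rate comes from vᵀZv ≤ κ|v|²; `κ + 1` avoids division by zero in dimension zero.
  refine ⟨∑ k ∈ Finset.range N, (F ^ k)ᵀ * F ^ k, ?_, 1 - 1 / (2 * (κ + 1)), ?_, ?_, fun v => ?_⟩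
  · refine Matrix.posSemidef_sum _ fun k _ => ?_
    have := Matrix.posSemidef_conjTranspose_mul_self (F ^ k)
    rwa [Matrix.conjTranspose_eq_transpose_of_trivial] at this
  · rw [sub_nonneg, div_le_one (by positivity)]
    linarith
  · have : 0 < 1 / (2 * (κ + 1)) := by positivity
    linarith
  · rw [hq, hq]
    have hv := dotProduct_self_nonneg' v
    have h0 : v ⬝ᵥ v ≤ ∑ k ∈ Finset.range N, (F ^ k *ᵥ v) ⬝ᵥ (F ^ k *ᵥ v) := by
      have := Finset.single_le_sum (f := fun k => (F ^ k *ᵥ v) ⬝ᵥ (F ^ k *ᵥ v))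
        (fun k _ => dotProduct_self_nonneg' _) (Finset.mem_range.mpr hN1)
      simpa using this
    refine ⟨h0, ?_⟩
    have hup : ∑ k ∈ Finset.range N, (F ^ k *ᵥ v) ⬝ᵥ (F ^ k *ᵥ v) ≤ κ * (v ⬝ᵥ v) := by
      rw [hκ, Finset.sum_mul]
      exact Finset.sum_le_sum fun k _ => mulVec_dotProduct_self_le _ _
    have hshift : ∑ k ∈ Finset.range N, (F ^ k *ᵥ (F *ᵥ v)) ⬝ᵥ (F ^ k *ᵥ (F *ᵥ v)) =
        ∑ k ∈ Finset.range N, (F ^ k *ᵥ v) ⬝ᵥ (F ^ k *ᵥ v)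
          + (F ^ N *ᵥ v) ⬝ᵥ (F ^ N *ᵥ v) - v ⬝ᵥ v := by
      have h1 := Finset.sum_range_succ' (fun k => (F ^ k *ᵥ v) ⬝ᵥ (F ^ k *ᵥ v)) N
      rw [Finset.sum_range_succ] at h1
      simp only [pow_zero, Matrix.one_mulVec] at h1
      rw [h1, add_sub_cancel_right]
      refine Finset.sum_congr rfl fun k _ => ?_
      rw [Matrix.mulVec_mulVec, ← pow_succ]
    have hlast := (mulVec_dotProduct_self_le (F ^ N) v).trans (mul_le_mul_of_nonneg_right hN hv)
    rw [hshift]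
    set q := ∑ k ∈ Finset.range N, (F ^ k *ᵥ v) ⬝ᵥ (F ^ k *ᵥ v)
    have hq2 : 1 / (2 * (κ + 1)) * q ≤ 1 / 2 * (v ⬝ᵥ v) := by
      rw [div_mul_eq_mul_div, one_mul, div_le_iff₀ (by positivity)]
      nlinarith
    linarith

/-- Young's inequality for the form Z, from its nonnegativity at εa - b. -/
theorem quadratic_add_le {Z : Matrix (Fin n) (Fin n) ℝ} (hZ : Z.PosSemidef) {ε : ℝ} (hε : 0 < ε)
    (a b : Fin n → ℝ) : (a + b) ⬝ᵥ (Z *ᵥ (a + b)) ≤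
      (1 + ε) * (a ⬝ᵥ (Z *ᵥ a)) + (1 + 1 / ε) * (b ⬝ᵥ (Z *ᵥ b)) := by
  have h := PosSemidef.dotProduct_nonneg hZ (ε • a - b)
  have hs : b ⬝ᵥ (Z *ᵥ a) = a ⬝ᵥ (Z *ᵥ b) := by
    rw [dotProduct_mulVec_transpose, PosSemidef.transpose_eq hZ, dotProduct_comm]
  simp only [Matrix.mulVec_sub, Matrix.mulVec_smul, dotProduct_sub, sub_dotProduct,
    smul_dotProduct, dotProduct_smul, smul_eq_mul, hs] at h
  simp only [Matrix.mulVec_add, dotProduct_add, add_dotProduct, hs]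
  have h2 : 2 * (a ⬝ᵥ (Z *ᵥ b)) ≤ ε * (a ⬝ᵥ (Z *ᵥ a)) + 1 / ε * (b ⬝ᵥ (Z *ᵥ b)) := by
    have h3 : ε * (2 * (a ⬝ᵥ (Z *ᵥ b))) ≤
        ε * (ε * (a ⬝ᵥ (Z *ᵥ a)) + 1 / ε * (b ⬝ᵥ (Z *ᵥ b))) := by
      have : ε * (1 / ε * (b ⬝ᵥ (Z *ᵥ b))) = b ⬝ᵥ (Z *ᵥ b) := by
        rw [← mul_assoc, mul_one_div_cancel hε.ne', one_mul]
      rw [mul_add, this]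
      linarith
    exact le_of_mul_le_mul_left h3 hε
  linarith

theorem exists_bound_of_contraction {a : ℕ → ℝ} {ρ b : ℝ} (h0 : 0 ≤ ρ) (h1 : ρ < 1)
    (h : ∀ t, a (t + 1) ≤ ρ * a t + b) : ∃ C, ∀ t, a t ≤ C := by
  refine ⟨max (a 0) (b / (1 - ρ)), fun t => ?_⟩
  have h2 : 0 < 1 - ρ := by linarith
  induction t with
  | zero => exact le_max_left _ _
  | succ t ih =>
    have h3 := le_max_right (a 0) (b / (1 - ρ))
    set C := max (a 0) (b / (1 - ρ))
    rw [div_le_iff₀ h2] at h3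
    have h4 := mul_le_mul_of_nonneg_left ih h0
    linarith [h t]

variable {Ω : Type*} [MeasurableSpace Ω] {μ : Measure Ω}

/-- A stable linear recursion driven by inputs of bounded second moments has bounded second
moments. -/
theorem exists_bound_second_moment {F : Matrix (Fin n) (Fin n) ℝ} (hF : IsStable F)
    {x h : ℕ → Ω → Fin n → ℝ} (hx : ∀ t, MemL2 μ (x t)) (hh : ∀ t, MemL2 μ (h t))
    (hrec : ∀ t, x (t + 1) =ᵐ[μ] fun ω => F *ᵥ x t ω + h t ω)
    (hb : ∀ Z : Matrix (Fin n) (Fin n) ℝ, Z.PosSemidef →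
      ∃ b, ∀ t, ∫ ω, h t ω ⬝ᵥ (Z *ᵥ h t ω) ∂μ ≤ b) :
    ∃ C, ∀ t, ∫ ω, x t ω ⬝ᵥ x t ω ∂μ ≤ C := by
  obtain ⟨Z, hZ, ρ, h0, h1, hlyap⟩ := hF.exists_lyapunov
  obtain ⟨b, hb⟩ := hb Z hZ
  -- This choice gives (1+ε)ρ ≤ (1+ρ)/2 < 1, so the recursion still contracts after the input is
  -- split off.
  set ε := (1 - ρ) / 2 with hε
  have hε0 : 0 < ε := by rw [hε]; linarith
  have hxi : ∀ t, Integrable (fun ω => x t ω ⬝ᵥ (Z *ᵥ x t ω)) μ := fun t =>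
    (hx t).integrable_dotProduct ((hx t).mulVec Z)
  have hhi : ∀ t, Integrable (fun ω => h t ω ⬝ᵥ (Z *ᵥ h t ω)) μ := fun t =>
    (hh t).integrable_dotProduct ((hh t).mulVec Z)
  have hstep : ∀ t, ∫ ω, x (t + 1) ω ⬝ᵥ (Z *ᵥ x (t + 1) ω) ∂μ ≤
      (1 + ρ) / 2 * ∫ ω, x t ω ⬝ᵥ (Z *ᵥ x t ω) ∂μ + (1 + 1 / ε) * b := by
    intro t
    calc ∫ ω, x (t + 1) ω ⬝ᵥ (Z *ᵥ x (t + 1) ω) ∂μ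
        ≤ ∫ ω, ((1 + ρ) / 2 * (x t ω ⬝ᵥ (Z *ᵥ x t ω))
          + (1 + 1 / ε) * (h t ω ⬝ᵥ (Z *ᵥ h t ω))) ∂μ := by
          refine integral_mono_ae (hxi (t + 1)) (((hxi t).const_mul _).add ((hhi t).const_mul _)) ?_
          filter_upwards [hrec t] with ω hω
          rw [hω]
          refine (quadratic_add_le hZ hε0 _ _).trans (add_le_add_left ?_ _)
          have hq := (hlyap (x t ω)).2
          have hq0 := PosSemidef.dotProduct_nonneg hZ (x t ω)
          refine (mul_le_mul_of_nonneg_left hq (by linarith)).trans ?_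
          rw [← mul_assoc]
          refine mul_le_mul_of_nonneg_right ?_ hq0
          rw [hε]
          nlinarith
      _ = (1 + ρ) / 2 * ∫ ω, x t ω ⬝ᵥ (Z *ᵥ x t ω) ∂μ
          + (1 + 1 / ε) * ∫ ω, h t ω ⬝ᵥ (Z *ᵥ h t ω) ∂μ := by
          rw [integral_add ((hxi t).const_mul _) ((hhi t).const_mul _), integral_const_mul,
            integral_const_mul]
      _ ≤ _ := by
          refine add_le_add_right (mul_le_mul_of_nonneg_left (hb t) ?_) _
          positivity
  obtain ⟨C, hC⟩ := exists_bound_of_contraction (ρ := (1 + ρ) / 2)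
    (a := fun t => ∫ ω, x t ω ⬝ᵥ (Z *ᵥ x t ω) ∂μ) (by linarith) (by linarith) hstep
  exact ⟨C, fun t => (integral_mono ((hx t).integrable_dotProduct (hx t)) (hxi t)
    fun ω => (hlyap (x t ω)).1).trans (hC t)⟩

end MeanSquare

/-! ### The average cost -/

section Value

variable {nx nu ny : ℕ} {D : Data nx nu ny} {P : Matrix (Fin nx) (Fin nx) ℝ}

theorem Data.value_add (hP : P.PosSemidef) (z w : Fin nx → ℝ) :
    D.value P (z + w) = D.value P z + 2 * ((P *ᵥ z + D.rss P) ⬝ᵥ w) + w ⬝ᵥ (P *ᵥ w) := by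
  have h1 : z ⬝ᵥ (P *ᵥ w) = (P *ᵥ z) ⬝ᵥ w := by
    rw [dotProduct_mulVec_transpose, PosSemidef.transpose_eq hP]
  have h2 : w ⬝ᵥ (P *ᵥ z) = (P *ᵥ z) ⬝ᵥ w := dotProduct_comm _ _
  simp only [Data.value, Matrix.mulVec_add, dotProduct_add, add_dotProduct, h1, h2]
  ring

theorem two_mul_dotProduct_le {n : ℕ} (a b : Fin n → ℝ) :
    2 * |a ⬝ᵥ b| ≤ a ⬝ᵥ a + b ⬝ᵥ b := by
  have h1 := dotProduct_self_nonneg' (a - b)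
  have h2 := dotProduct_self_nonneg' (a + b)
  simp only [sub_dotProduct, dotProduct_sub, add_dotProduct, dotProduct_add,
    dotProduct_comm b a] at h1 h2
  have h3 : |a ⬝ᵥ b| ≤ (a ⬝ᵥ a + b ⬝ᵥ b) / 2 := abs_le.mpr ⟨by linarith, by linarith⟩
  linarith

theorem Data.abs_value_le (x : Fin nx → ℝ) :
    |D.value P x| ≤ (2 + frobSq P) * (x ⬝ᵥ x) + D.rss P ⬝ᵥ D.rss P := by
  have h1 := two_mul_dotProduct_le x (P *ᵥ x)
  have h2 := two_mul_dotProduct_le (D.rss P) x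
  have h3 := mulVec_dotProduct_self_le P x
  have h4 := dotProduct_self_nonneg' x
  have h5 : 0 ≤ |x ⬝ᵥ (P *ᵥ x)| := abs_nonneg _
  rw [Data.value]
  refine (abs_add_le _ _).trans ?_
  rw [abs_mul, abs_two]
  linarith

theorem MemL2.integrable_value {Ω : Type*} [MeasurableSpace Ω] {μ : Measure Ω} [IsFiniteMeasure μ]
    {X : Ω → Fin nx → ℝ} (hX : MemL2 μ X) : Integrable (fun ω => D.value P (X ω)) μ :=
  (hX.integrable_dotProduct (hX.mulVec P)).add ((hX.integrable_dotProduct_const _).const_mul 2)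

end Value

/-! ### Expected stage costs, boundedness of the value and the Cesàro limit. -/

section Cost

variable {nx nu ny : ℕ} {Ω : Type*} [MeasurableSpace Ω] {D : Data nx nu ny} {μ : Measure Ω}
  {pol : ∀ t, Info ny nu t → Fin nu → ℝ} {γ : ∀ t, Kernel (Info ny nu t) (Fin nx → ℝ)}
  {x w : ℕ → Ω → Fin nx → ℝ} {y v : ℕ → Ω → Fin ny → ℝ} {u : ℕ → Ω → Fin nu → ℝ}
  {P S : Matrix (Fin nx) (Fin nx) ℝ} {X : ℕ → Matrix (Fin nx) (Fin nx) ℝ}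
  {xbar : ∀ t, Info ny nu t → Fin nx → ℝ} {Qnom : ℕ → Measure (Fin nx → ℝ)}

theorem gelbrich_sq_ae_eq (hpair : D.IsStationaryPair P S xbar pol γ)
    (hQnom : ∀ t, HasMoments (Qnom t) D.wHat D.SigHat)
    (hae : ∀ t, (fun ω => xbar t (infoProc y u t ω)) =ᵐ[μ] estProc D P X y u t) (t : ℕ) :
    (fun ω => gelbrich (γ t (infoProc y u t ω)) (Qnom t) ^ 2) =ᵐ[μ] fun ω =>
      (D.Hss P *ᵥ estProc D P X y u t ω + D.Gss P - D.wHat) ⬝ᵥ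
        (D.Hss P *ᵥ estProc D P X y u t ω + D.Gss P - D.wHat) + buresSq S D.SigHat := by
  filter_upwards [hae t] with ω hω
  rw [gelbrich_sq (hpair.moments t _) (hQnom t), hω]

variable [IsProbabilityMeasure μ]

theorem IsClosedLoop.estProc_memL2 (h : IsClosedLoop D μ pol γ x y u w v)
    (hpair : D.IsStationaryPair P S xbar pol γ) (hxm : ∀ t, Measurable (xbar t))
    (hae : ∀ t, (fun ω => xbar t (infoProc y u t ω)) =ᵐ[μ] estProc D P X y u t) (t : ℕ) :
    MemL2 μ (estProc D P X y u t) := by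
  have hx := h.state_memL2 hpair t (fun s _ => hxm s) fun s _ => hae s
  have he := (h.estErr_moments hpair t (fun s _ => hxm s) fun s _ => hae s).1
  exact (hx.sub he).congr (ae_of_all _ fun ω => sub_sub_cancel _ _)

theorem IsClosedLoop.control_memL2 (h : IsClosedLoop D μ pol γ x y u w v)
    (hpair : D.IsStationaryPair P S xbar pol γ) (hxm : ∀ t, Measurable (xbar t))
    (hae : ∀ t, (fun ω => xbar t (infoProc y u t ω)) =ᵐ[μ] estProc D P X y u t) (t : ℕ) :
    MemL2 μ (u t) :=
  (((h.estProc_memL2 hpair hxm hae t).mulVec (D.Kss P)).add (MemL2.const (D.Lss P))).congr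
    (control_ae_eq h hpair t (hae t)).symm

theorem IsClosedLoop.integrable_stageCost (h : IsClosedLoop D μ pol γ x y u w v)
    (hpair : D.IsStationaryPair P S xbar pol γ) (hxm : ∀ t, Measurable (xbar t))
    (hae : ∀ t, (fun ω => xbar t (infoProc y u t ω)) =ᵐ[μ] estProc D P X y u t) (t : ℕ) :
    Integrable (stageCost D x u t) μ := by
  have hx := h.state_memL2 hpair t (fun s _ => hxm s) fun s _ => hae s
  have hu := h.control_memL2 hpair hxm hae t
  exact (hx.integrable_dotProduct (hx.mulVec D.Q)).add (hu.integrable_dotProduct (hu.mulVec D.R))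

theorem IsClosedLoop.integrable_gelbrich_sq (h : IsClosedLoop D μ pol γ x y u w v)
    (hpair : D.IsStationaryPair P S xbar pol γ)
    (hQnom : ∀ t, HasMoments (Qnom t) D.wHat D.SigHat) (hxm : ∀ t, Measurable (xbar t))
    (hae : ∀ t, (fun ω => xbar t (infoProc y u t ω)) =ᵐ[μ] estProc D P X y u t) (t : ℕ) :
    Integrable (fun ω => gelbrich (γ t (infoProc y u t ω)) (Qnom t) ^ 2) μ := by
  have hw := (((h.estProc_memL2 hpair hxm hae t).mulVec (D.Hss P)).add
    (MemL2.const (D.Gss P))).sub (MemL2.const D.wHat)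
  exact ((hw.integrable_dotProduct hw).add (integrable_const _)).congr
    (gelbrich_sq_ae_eq hpair hQnom hae t).symm

/-- The penalized cost of one stage, in terms of the change of the value function. -/
theorem IsClosedLoop.integral_cost_eq (h : IsClosedLoop D μ pol γ x y u w v)
    (hpair : D.IsStationaryPair P S xbar pol γ)
    (hQnom : ∀ t, HasMoments (Qnom t) D.wHat D.SigHat) (hxm : ∀ t, Measurable (xbar t))
    (hae : ∀ t, (fun ω => xbar t (infoProc y u t ω)) =ᵐ[μ] estProc D P X y u t)
    (hP : D.SolvesARE P) (hΦ : D.Phi.PosSemidef) (hlam : 0 < D.lam)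
    (hpen : (D.lam • (1 : Matrix (Fin nx) (Fin nx) ℝ) - P).PosDef) (hF : IsStable (D.Fss P))
    (hQ : D.Q.PosSemidef) (hR : D.R.PosDef) (t : ℕ) :
    ∫ ω, stageCost D x u t ω ∂μ
        - D.lam * ∫ ω, gelbrich (γ t (infoProc y u t ω)) (Qnom t) ^ 2 ∂μ =
      ∫ ω, D.value P (x t ω) ∂μ - ∫ ω, D.value P (x (t + 1) ω) ∂μ + D.meanCost P
        + (D.Sss P * D.errCov X S t).trace + (P * S).trace - D.lam * buresSq S D.SigHat := by
  have hc := h.integrable_stageCost hpair hxm hae t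
  have hg := h.integrable_gelbrich_sq hpair hQnom hxm hae t
  have hx := h.state_memL2 hpair t (fun s _ => hxm s) fun s _ => hae s
  have hx' := h.state_memL2 hpair (t + 1) (fun s _ => hxm s) fun s _ => hae s
  have hu := h.control_memL2 hpair hxm hae t
  have he := h.estProc_memL2 hpair hxm hae t
  obtain ⟨hε, hεc⟩ := h.estErr_moments hpair t (fun s _ => hxm s) fun s _ => hae s
  obtain ⟨hd, hdc, hd0⟩ := h.distErr_moments hpair t (hxm t) (hae t)
  have hv := hx.integrable_value (D := D) (P := P)
  have hv' := hx'.integrable_value (D := D) (P := P)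
  -- Half the gradient of the value at the conditional mean of the next state. It is known before
  -- w_t is drawn, so its pairing with the centred disturbance has mean zero.
  set Y : Ω → Fin nx → ℝ := fun ω => P *ᵥ (D.A *ᵥ x t ω + D.B *ᵥ u t ω
    + (D.Hss P *ᵥ estProc D P X y u t ω + D.Gss P)) + D.rss P with hY
  have hYm : Measurable[sigW x w v t] Y :=
    (measurable_mulVec (((measurable_mulVec ((h.adapted t).1.mono (sigV_le_sigW t) le_rfl) _).add
      (measurable_mulVec (h.measurable_control t) _)).add
      ((measurable_mulVec (h.measurable_estProc t) _).add measurable_const)) _).add measurable_const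
  have hYL : MemL2 μ Y :=
    ((((hx.mulVec D.A).add (hu.mulVec D.B)).add ((he.mulVec (D.Hss P)).add
      (MemL2.const (D.Gss P)))).mulVec P).add (MemL2.const (D.rss P))
  have hY0 : ∫ ω, Y ω ⬝ᵥ distErr D P X y u w t ω ∂μ = 0 := by
    have h1 := integral_dotProduct_mulVec hYL hd 1
    simp only [Matrix.one_mulVec, Matrix.one_mul] at h1
    rw [h1, ← crossMoment_transpose, hd0 hYm hYL, Matrix.transpose_zero, Matrix.trace_zero]
  have hde : ∫ ω, distErr D P X y u w t ω ⬝ᵥ (P *ᵥ distErr D P X y u w t ω) ∂μ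
      = (P * S).trace := by rw [integral_dotProduct_mulVec hd hd, hdc]
  have hee : ∫ ω, (x t ω - estProc D P X y u t ω) ⬝ᵥ
      (D.Sss P *ᵥ (x t ω - estProc D P X y u t ω)) ∂μ = (D.Sss P * D.errCov X S t).trace := by
    rw [integral_dotProduct_mulVec hε hε, hεc]
  have i1 := hε.integrable_dotProduct (hε.mulVec (D.Sss P))
  have i2 := hYL.integrable_dotProduct hd
  have i3 := hd.integrable_dotProduct (hd.mulVec P)
  have key : (fun ω => stageCost D x u t ω
      - D.lam * gelbrich (γ t (infoProc y u t ω)) (Qnom t) ^ 2 + D.value P (x (t + 1) ω)) =ᵐ[μ]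
      fun ω => D.value P (x t ω) + (D.meanCost P - D.lam * buresSq S D.SigHat)
        + (x t ω - estProc D P X y u t ω) ⬝ᵥ (D.Sss P *ᵥ (x t ω - estProc D P X y u t ω))
        + 2 * (Y ω ⬝ᵥ distErr D P X y u w t ω)
        + distErr D P X y u w t ω ⬝ᵥ (P *ᵥ distErr D P X y u w t ω) := by
    filter_upwards [gelbrich_sq_ae_eq hpair hQnom hae t, control_ae_eq h hpair t (hae t)]
      with ω h1 h2
    -- The identity is used at the estimate, with the estimation error as e; expanding the value
    -- around the conditional mean then brings in the centred disturbance.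
    have h3 := Data.saddle_identity hP hΦ hlam hpen hF hQ hR (estProc D P X y u t ω)
      (x t ω - estProc D P X y u t ω) h2 rfl
    have h4 : x (t + 1) ω = D.A *ᵥ x t ω + D.B *ᵥ u t ω
        + (D.Hss P *ᵥ estProc D P X y u t ω + D.Gss P) + distErr D P X y u w t ω := by
      rw [h.state, distErr]; abel
    rw [add_sub_cancel] at h3
    rw [h1, h4, Data.value_add hP.1, stageCost]
    linarith
  have hint := integral_congr_ae key
  have j1 : Integrable (fun ω => stageCost D x u t ω
      - D.lam * gelbrich (γ t (infoProc y u t ω)) (Qnom t) ^ 2) μ := hc.sub (hg.const_mul _)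
  have j2 : Integrable (fun ω => D.value P (x t ω)
      + (D.meanCost P - D.lam * buresSq S D.SigHat)) μ := hv.add (integrable_const _)
  have j3 : Integrable (fun ω => D.value P (x t ω) + (D.meanCost P - D.lam * buresSq S D.SigHat)
      + (x t ω - estProc D P X y u t ω) ⬝ᵥ (D.Sss P *ᵥ (x t ω - estProc D P X y u t ω))) μ :=
    j2.add i1
  have j4 : Integrable (fun ω => D.value P (x t ω) + (D.meanCost P - D.lam * buresSq S D.SigHat)
      + (x t ω - estProc D P X y u t ω) ⬝ᵥ (D.Sss P *ᵥ (x t ω - estProc D P X y u t ω))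
      + 2 * (Y ω ⬝ᵥ distErr D P X y u w t ω)) μ := j3.add (i2.const_mul 2)
  rw [integral_add j1 hv', integral_sub hc (hg.const_mul _), integral_const_mul,
    integral_add j4 i3, integral_add j3 (i2.const_mul 2), integral_add j2 i1,
    integral_add hv (integrable_const _), integral_const_mul, hY0, hde, hee, integral_const,
    probReal_univ, one_smul] at hint
  linarith

/-- In terms of the true state the loop reads x_{t+1} = F x_t + (A-F)e_t + g + d_t. The error e_t
has convergent and d_t constant second moments, and F is stable. -/
theorem IsClosedLoop.exists_bound_value (h : IsClosedLoop D μ pol γ x y u w v)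
    (hpair : D.IsStationaryPair P S xbar pol γ) (hxm : ∀ t, Measurable (xbar t))
    (hae : ∀ t, (fun ω => xbar t (infoProc y u t ω)) =ᵐ[μ] estProc D P X y u t)
    {Xs : Matrix (Fin nx) (Fin nx) ℝ} (hlim : Tendsto (D.errCov X S) atTop (𝓝 Xs))
    (hP : D.SolvesARE P) (hΦ : D.Phi.PosSemidef) (hlam : 0 < D.lam)
    (hpen : (D.lam • (1 : Matrix (Fin nx) (Fin nx) ℝ) - P).PosDef) (hF : IsStable (D.Fss P)) :
    ∃ C, ∀ t, |∫ ω, D.value P (x t ω) ∂μ| ≤ C := by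
  have hx := fun t => h.state_memL2 hpair t (fun s _ => hxm s) fun s _ => hae s
  have hε := fun t => h.estErr_moments hpair t (fun s _ => hxm s) fun s _ => hae s
  have hd := fun t => h.distErr_moments hpair t (hxm t) (hae t)
  set E := D.A - D.Fss P with hE
  have hh : ∀ t, MemL2 μ fun ω => E *ᵥ (x t ω - estProc D P X y u t ω)
      + (D.gss P + distErr D P X y u w t ω) := fun t =>
    ((hε t).1.mulVec E).add ((MemL2.const (D.gss P)).add (hd t).1)
  have hrec : ∀ t, x (t + 1) =ᵐ[μ] fun ω => D.Fss P *ᵥ x t ω +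
      (E *ᵥ (x t ω - estProc D P X y u t ω) + (D.gss P + distErr D P X y u w t ω)) := by
    intro t
    filter_upwards [control_ae_eq h hpair t (hae t)] with ω hω
    have hn := Data.next_mean_eq hP hΦ hlam hpen (estProc D P X y u t ω)
    have h4 : x (t + 1) ω = D.A *ᵥ (x t ω - estProc D P X y u t ω)
        + (D.A *ᵥ estProc D P X y u t ω
          + D.B *ᵥ (D.Kss P *ᵥ estProc D P X y u t ω + D.Lss P)
          + (D.Hss P *ᵥ estProc D P X y u t ω + D.Gss P)) + distErr D P X y u w t ω := by
      rw [h.state, distErr, hω, Matrix.mulVec_sub]; abel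
    rw [h4, hn, hE, Matrix.sub_mulVec, Matrix.mulVec_sub (D.Fss P)]
    abel
  have hbd : ∀ Z : Matrix (Fin nx) (Fin nx) ℝ, Z.PosSemidef → ∃ b, ∀ t,
      ∫ ω, (E *ᵥ (x t ω - estProc D P X y u t ω) + (D.gss P + distErr D P X y u w t ω)) ⬝ᵥ
        (Z *ᵥ (E *ᵥ (x t ω - estProc D P X y u t ω)
          + (D.gss P + distErr D P X y u w t ω))) ∂μ ≤ b := by
    intro Z hZ
    have hb : Tendsto (fun t => 2 * (Eᵀ * Z * E * D.errCov X S t).trace) atTop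
        (𝓝 (2 * (Eᵀ * Z * E * Xs).trace)) := by
      have hcont : Continuous fun Y : Matrix (Fin nx) (Fin nx) ℝ => 2 * (Eᵀ * Z * E * Y).trace := by
        fun_prop
      exact (hcont.tendsto Xs).comp hlim
    obtain ⟨b, hb⟩ := hb.bddAbove_range
    refine ⟨b + (4 * (D.gss P ⬝ᵥ (Z *ᵥ D.gss P)) + 4 * (Z * S).trace), fun t => ?_⟩
    have i1 := ((hε t).1.mulVec E).integrable_dotProduct (((hε t).1.mulVec E).mulVec Z)
    have i2 := (hd t).1.integrable_dotProduct ((hd t).1.mulVec Z)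
    have e1 : ∫ ω, (E *ᵥ (x t ω - estProc D P X y u t ω)) ⬝ᵥ
        (Z *ᵥ (E *ᵥ (x t ω - estProc D P X y u t ω))) ∂μ
        = (Eᵀ * Z * E * D.errCov X S t).trace := by
      rw [← (hε t).2, ← integral_dotProduct_mulVec (hε t).1 (hε t).1]
      refine integral_congr_ae (ae_of_all _ fun ω => ?_)
      simp only [← Matrix.mulVec_mulVec]
      rw [dotProduct_mulVec_transpose Eᵀ, Matrix.transpose_transpose]
    have e2 : ∫ ω, distErr D P X y u w t ω ⬝ᵥ (Z *ᵥ distErr D P X y u w t ω) ∂μ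
        = (Z * S).trace := by rw [integral_dotProduct_mulVec (hd t).1 (hd t).1, (hd t).2.1]
    have i3 : Integrable (fun ω => 4 * (D.gss P ⬝ᵥ (Z *ᵥ D.gss P))
        + 4 * (distErr D P X y u w t ω ⬝ᵥ (Z *ᵥ distErr D P X y u w t ω))) μ :=
      (integrable_const _).add (i2.const_mul _)
    calc _ ≤ ∫ ω, (2 * ((E *ᵥ (x t ω - estProc D P X y u t ω)) ⬝ᵥ
            (Z *ᵥ (E *ᵥ (x t ω - estProc D P X y u t ω))))
          + (4 * (D.gss P ⬝ᵥ (Z *ᵥ D.gss P))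
            + 4 * (distErr D P X y u w t ω ⬝ᵥ (Z *ᵥ distErr D P X y u w t ω)))) ∂μ := by
          refine integral_mono ((hh t).integrable_dotProduct ((hh t).mulVec Z))
            ((i1.const_mul _).add i3) fun ω => ?_
          -- Two applications with ε = 1 produce the factors 2, 4 and 4.
          have q1 := quadratic_add_le hZ one_pos (E *ᵥ (x t ω - estProc D P X y u t ω))
            (D.gss P + distErr D P X y u w t ω)
          have q2 := quadratic_add_le hZ one_pos (D.gss P) (distErr D P X y u w t ω)
          norm_num at q1 q2 ⊢
          linarith
      _ = 2 * (Eᵀ * Z * E * D.errCov X S t).trace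
          + (4 * (D.gss P ⬝ᵥ (Z *ᵥ D.gss P)) + 4 * (Z * S).trace) := by
          rw [integral_add (i1.const_mul _) i3,
            integral_add (integrable_const _) (i2.const_mul _), integral_const_mul,
            integral_const, probReal_univ, one_smul, integral_const_mul, e1, e2]
      _ ≤ _ := add_le_add_left (hb ⟨t, rfl⟩) _
  obtain ⟨C, hC⟩ := exists_bound_second_moment hF hx hh hrec hbd
  refine ⟨(2 + frobSq P) * C + D.rss P ⬝ᵥ D.rss P, fun t => ?_⟩
  have hi := (hx t).integrable_dotProduct (hx t)
  have hfr := frobSq_nonneg P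
  calc |∫ ω, D.value P (x t ω) ∂μ| ≤ ∫ ω, |D.value P (x t ω)| ∂μ := abs_integral_le_integral_abs
    _ ≤ ∫ ω, ((2 + frobSq P) * (x t ω ⬝ᵥ x t ω) + D.rss P ⬝ᵥ D.rss P) ∂μ :=
        integral_mono (hx t).integrable_value.abs ((hi.const_mul _).add (integrable_const _))
          fun ω => Data.abs_value_le _
    _ = (2 + frobSq P) * ∫ ω, x t ω ⬝ᵥ x t ω ∂μ + D.rss P ⬝ᵥ D.rss P := by
        rw [integral_add (hi.const_mul _) (integrable_const _), integral_const_mul,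
          integral_const, probReal_univ, one_smul]
    _ ≤ _ := add_le_add_left (mul_le_mul_of_nonneg_left (hC t) (by linarith)) _

/-- The tower property removes the inner conditional expectations. -/
theorem IsClosedLoop.horizonCost_eq (h : IsClosedLoop D μ pol γ x y u w v)
    (hg : ∀ t, Integrable (fun ω => gelbrich (γ t (infoProc y u t ω)) (Qnom t) ^ 2) μ) (T : ℕ) :
    horizonCost D Qnom μ γ x y u T = ∑ t ∈ Finset.range T, (∫ ω, stageCost D x u t ω ∂μ
      - D.lam * ∫ ω, gelbrich (γ t (infoProc y u t ω)) (Qnom t) ^ 2 ∂μ) := by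
  have hi : ∀ t, Integrable (fun ω => (μ[stageCost D x u t |
      MeasurableSpace.comap (fun ω' => (infoProc y u t ω', u t ω')) inferInstance]) ω
      - D.lam * gelbrich (γ t (infoProc y u t ω)) (Qnom t) ^ 2) μ :=
    fun t => integrable_condExp.sub ((hg t).const_mul _)
  rw [horizonCost, integral_finsetSum _ fun t _ => hi t]
  refine Finset.sum_congr rfl fun t _ => ?_
  have hm : Measurable fun ω => (infoProc y u t ω, u t ω) :=
    (h.measurable_infoProc t).prodMk
      ((h.measurable_control t).mono (h.measurable_pastW t).comap_le le_rfl)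
  rw [integral_sub integrable_condExp ((hg t).const_mul _), integral_condExp hm.comap_le,
    integral_const_mul]

/-- The Cesàro means of a sequence that converges up to the increments of a bounded sequence. -/
theorem tendsto_cesaro_of_increments {a V : ℕ → ℝ} {l C : ℝ} (ha : Tendsto a atTop (𝓝 l))
    (hV : ∀ t, |V t| ≤ C) :
    Tendsto (fun T : ℕ => 1 / (T : ℝ) * ∑ t ∈ Finset.range T, (V t - V (t + 1) + a t)) atTop
      (𝓝 l) := by
  have h1 := ha.cesaro
  have h2 : Tendsto (fun T : ℕ => (T : ℝ)⁻¹ * (V 0 - V T)) atTop (𝓝 0) := by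
    refine (tendsto_inv_atTop_nhds_zero_nat (𝕜 := ℝ)).zero_mul_isBoundedUnder_le ?_
    refine isBoundedUnder_of ⟨C + C, fun T => ?_⟩
    exact (abs_sub _ _).trans (add_le_add (hV 0) (hV T))
  have h3 := h2.add h1
  rw [zero_add] at h3
  refine h3.congr fun T => ?_
  rw [Finset.sum_add_distrib, Finset.sum_range_sub', one_div, mul_add]

theorem Data.IsOptimal.zss_eq {Xs Xm : Matrix (Fin nx) (Fin nx) ℝ}
    (hopt : D.IsOptimal P Xs Xm S) : D.zss P = D.objective P Xs S := by
  refine IsGreatest.csSup_eq ⟨⟨Xs, Xm, S, hopt.1, rfl⟩, ?_⟩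
  rintro z ⟨X', Xm', S', hf, rfl⟩
  exact hopt.2 X' Xm' S' hf

/-- The objective is the limiting covariance cost per stage, except that it omits the constant -λ Tr
Σ̂ of the Bures term; this is why that trace appears separately in the average cost. -/
theorem Data.objective_eq (Xs : Matrix (Fin nx) (Fin nx) ℝ) : D.objective P Xs S =
    (D.Sss P * Xs).trace + (P * S).trace - D.lam * buresSq S D.SigHat
      + D.lam * D.SigHat.trace := by
  simp only [Data.objective, buresSq, Matrix.sub_mul, Matrix.smul_mul, Matrix.one_mul,
    Matrix.trace_add, Matrix.trace_sub, Matrix.trace_smul, smul_eq_mul]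
  ring

/-- The stage costs are increments of the bounded sequence E V(x_t) plus a convergent sequence, so
the averages converge and the limsup is a limit. -/
theorem IsClosedLoop.avgCost_eq (h : IsClosedLoop D μ pol γ x y u w v)
    (hpair : D.IsStationaryPair P S xbar pol γ)
    (hQnom : ∀ t, HasMoments (Qnom t) D.wHat D.SigHat) (hxm : ∀ t, Measurable (xbar t))
    (hae : ∀ t, (fun ω => xbar t (infoProc y u t ω)) =ᵐ[μ] estProc D P X y u t)
    {Xs : Matrix (Fin nx) (Fin nx) ℝ} (hlim : Tendsto (D.errCov X S) atTop (𝓝 Xs))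
    (hP : D.SolvesARE P) (hΦ : D.Phi.PosSemidef) (hlam : 0 < D.lam)
    (hpen : (D.lam • (1 : Matrix (Fin nx) (Fin nx) ℝ) - P).PosDef) (hF : IsStable (D.Fss P))
    (hQ : D.Q.PosSemidef) (hR : D.R.PosDef) :
    avgCost D Qnom μ γ x y u =
      (D.meanCost P - D.lam * D.SigHat.trace + D.objective P Xs S : ℝ) := by
  obtain ⟨C, hC⟩ := h.exists_bound_value hpair hxm hae hlim hP hΦ hlam hpen hF
  have hcont : Continuous fun Y : Matrix (Fin nx) (Fin nx) ℝ => D.meanCost P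
      + (D.Sss P * Y).trace + (P * S).trace - D.lam * buresSq S D.SigHat := by fun_prop
  have ht := tendsto_cesaro_of_increments ((hcont.tendsto Xs).comp hlim) hC
  have hl : D.meanCost P - D.lam * D.SigHat.trace + D.objective P Xs S = D.meanCost P
      + (D.Sss P * Xs).trace + (P * S).trace - D.lam * buresSq S D.SigHat := by
    rw [Data.objective_eq]; ring
  rw [hl, avgCost]
  refine Tendsto.limsup_eq ((continuous_coe_real_ereal.tendsto _).comp (ht.congr fun T => ?_))
  rw [h.horizonCost_eq (h.integrable_gelbrich_sq hpair hQnom hxm hae)]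
  congr 1
  refine Finset.sum_congr rfl fun t _ => ?_
  rw [h.integral_cost_eq hpair hQnom hxm hae hP hΦ hlam hpen hF hQ hR t]
  simp only [Function.comp_apply]
  ring

end Cost

end WDRC

theorem mainTheorem5 {nx nu ny : ℕ} (D : WDRC.Data nx nu ny)
    (hQ : D.Q.PosSemidef) (hR : D.R.PosDef) (hM : D.M.PosDef) (hlam : 0 < D.lam)
    -- the nominal distributions, with stationary mean and covariance
    (Qnom : ℕ → Measure (Fin nx → ℝ))
    (hQnom : ∀ t, WDRC.HasMoments (Qnom t) D.wHat D.SigHat)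
    -- `Φ ⪰ 0`, `(A, Φ^{1/2})` stabilizable, `(A, Q^{1/2})` observable
    (hPhi : D.Phi.PosSemidef)
    (hstab : WDRC.Stabilizable D.A (WDRC.msqrt D.Phi))
    (hobs : WDRC.Observable D.A (WDRC.msqrt D.Q))
    -- the solution of the Riccati equation and the penalty condition `λ I ≻ P_ss`
    (Pss : Matrix (Fin nx) (Fin nx) ℝ) (hPss : D.SolvesARE Pss)
    (hpen : (D.lam • (1 : Matrix (Fin nx) (Fin nx) ℝ) - Pss).PosDef)
    -- an optimal solution of the stationary covariance maximization problem
    (Xss Xmss Sigss : Matrix (Fin nx) (Fin nx) ℝ)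
    (hopt : D.IsOptimal Pss Xss Xmss Sigss)
    (hdet : WDRC.Detectable D.A D.C)
    (hstab' : WDRC.Stabilizable D.A (WDRC.msqrt Sigss))
    -- the stationary policy pair and the process it generates
    {Ω : Type*} [MeasurableSpace Ω] (μ : Measure Ω) [IsProbabilityMeasure μ]
    (xbar : ∀ t, WDRC.Info ny nu t → Fin nx → ℝ)
    (pol : ∀ t, WDRC.Info ny nu t → Fin nu → ℝ)
    (γ : ∀ t, Kernel (WDRC.Info ny nu t) (Fin nx → ℝ))
    (x : ℕ → Ω → Fin nx → ℝ) (y : ℕ → Ω → Fin ny → ℝ) (u : ℕ → Ω → Fin nu → ℝ)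
    (w : ℕ → Ω → Fin nx → ℝ) (v : ℕ → Ω → Fin ny → ℝ)
    (hpair : D.IsStationaryPair Pss Sigss xbar pol γ)
    (hloop : WDRC.IsClosedLoop D μ pol γ x y u w v)
    (hest : D.IsStateEstimate Pss μ γ x y u Xss Sigss xbar) :
    (∀ t, Integrable (WDRC.stageCost D x u t) μ) ∧
    (∀ t, Integrable
      (fun ω => WDRC.gelbrich (γ t (WDRC.infoProc y u t ω)) (Qnom t) ^ 2) μ) ∧
    WDRC.avgCost D Qnom μ γ x y u =
      (((2 : ℝ) • D.wHat - D.Phi *ᵥ D.rss Pss) ⬝ᵥ ((1 + Pss * D.Phi)⁻¹ *ᵥ D.rss Pss)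
        - D.lam * D.SigHat.trace
        + D.wHat ⬝ᵥ (((1 + Pss * D.Phi)⁻¹ * Pss) *ᵥ D.wHat)
        + D.zss Pss : ℝ) := by
  -- Feasibility makes X_ss a positive semidefinite fixed point of the Riccati recursion for Σ*_ss;
  -- optimality is needed only to identify z_ss.
  obtain ⟨⟨hX, -, hS, hXm, hfix⟩, -⟩ := id hopt
  have hF := hPss.isStable_Fss hPhi hQ hobs
  obtain ⟨hxm, X, hae, hlim⟩ := hloop.exists_filter hpair hM hS hstab' hX
    (by rw [WDRC.Data.riccati, ← hXm]; exact hfix) hest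
  refine ⟨hloop.integrable_stageCost hpair hxm hae,
    hloop.integrable_gelbrich_sq hpair hQnom hxm hae, ?_⟩
  rw [hloop.avgCost_eq hpair hQnom hxm hae hlim hPss hPhi hlam hpen hF hQ hR, hopt.zss_eq,
    WDRC.Data.meanCost_eq hPss hPhi]
  congr 1
  ring
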